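/- **Setting.** Let $n,k\ge 1$, let $\mathcal N$ be a smooth manifold of dimension $n+k$ with a closed nowhere vanishing smooth $n$-form $\omega$. For $q\in\mathcal N$ let $D^\omega_q$ be the manifold of decomposable $n$-vectors $z\in\Lambda^nT_q\mathcal N$ with $\langle z,\omega\rangle=1$; it is identified with the set of oriented $n$-dimensional subspaces of $T_q\mathcal N$ on which $\omega>0$. Let $L$ be a smooth real function on the bundle $D^\omega\mathcal N=\{(q,z):z\in D^\omega_q\}$ and put $W(q,z,p)=\langle z,p\rangle-L(q,z)$ for $p\in\Lambda^nT_q^*\mathcal N$, and $Z_q(p)=\{z\in D^\omega_q:\ \partial W/\partial z\,(q,z,p)=0\}$, where $\partial W/\partial z$ is the differential along $D^\omega_q$. Let $\mathcal M\subset\Lambda^nT^*\mathcal N$ be a smooth subbundle over $\mathcal N$ (a locally trivial embedded submanifold, possibly with boundary) with fibres $\mathcal M_q$ of dimension $d$, $1\le d\le\binom{n+k}{n}$, satisfying the Legendre correspondence hypothesis: for all $(q,p)\in\mathcal M$, $Z_q(p)$ is a non-empty connected smooth submanifold of $D^\omega_q$, and, for every $z_0\in Z_q(p)$, $Z_q(p)=\{z\in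 D_q^\omega:\ \langle z-z_0,\dot p\rangle=0\ \ \forall\dot p\in T_p\mathcal M_q\}$. Let $\mathcal H:\mathcal M\to\mathbb R$ be the Hamiltonian function, $\mathcal H(q,p)=W(q,z,p)$ for $z\in Z_q(p)$; assume that $\mathcal H$ is of class $C^1$. Let $\theta$ be the canonical (Poincaré–Cartan) $n$-form on $\Lambda^nT^*\mathcal N$, $\theta_{(q,p)}(X_1,\dots,X_n)=p(\Pi_*X_1,\dots,\Pi_*X_n)$ with $\Pi$ the projection to $\mathcal N$, and $\Omega=d\theta$. Denote again by $\theta$, $\Omega$, $\omega$ the forms on $\mathcal M$ obtained by restricting $\theta$, $\Omega$ and $\Pi^*\omega$. For an $n$-vector $X$ and an $(n+1)$-form $\mu$, $X\lrcorner\mu$ is the $1$-form $\xi\mapsto\langle X\wedge\xi,\mu\rangle$. Let $\Gamma\subset\mathcal M$ be an embedded oriented $n$-dimensional submanifold with $\omega_{|\Gamma}>0$. It is a critical point of $\mathcal I[\Gamma]=\int_\Gamma(\theta-\mathcal H\omega)$ if, for every compact $K\subset\mathcal M$ such that $\Gamma\cap K$ is compact (automatic if $\Gamma$ is closed) and every smooth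 family $(\varphi_s)_{s\ge0}$ of maps $\mathcal M\to\mathcal M$ with $\varphi_0=\mathrm{id}$ and $\varphi_s=\mathrm{id}$ outside $K$, the right derivative at $s=0$ of $s\mapsto\int_{\Gamma\cap K}\varphi_s^*(\theta-\mathcal H\omega)$ exists and is $0$. **Theorem.** 1. $\Gamma$ is a critical point of $\mathcal I$ if and only if $$\forall m\in\Gamma,\ \forall X\in\Lambda^nT_m\Gamma,\qquad X\lrcorner(\Omega-d\mathcal H\wedge\omega)=0 .$$ 2. Suppose moreover that $\mathcal H$ is constant on $\Gamma$. Then: (a) $\Gamma$ is a critical point of $\mathcal I$ if and only if for all $m\in\Gamma$ there is a unique $X\in\Lambda^nT_m\Gamma$ with $\langle X,\omega\rangle=1$ and $X\lrcorner\Omega=(-1)^n\,d\mathcal H$. (b) If $\Gamma$ is a critical point of $\mathcal I$, then at every $m\in\Gamma$ with $d\mathcal H_m\ne0$ there is a unique $X\in\Lambda^nT_m\Gamma$ (without normalisation) with $X\lrcorner\Omega=(-1)^n\,d\mathcal H$. (c) Suppose that for every $(q,p)\in\Gamma$ one has $(q,p+\lambda\omega_q)\in\mathcal M$ for all sufficiently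 small $\lambda\ge0$ (for instance, $\mathcal M$ is open in $\Lambda^nT^*\mathcal N$). Then $\Gamma$ is a critical point of $\mathcal I$ if and only if for all $m\in\Gamma$ there is a unique $X\in\Lambda^nT_m\Gamma$ with $X\lrcorner\Omega=(-1)^n\,d\mathcal H$. -/

import Mathlib

open Set Filter Topology Manifold MeasureTheory
open scoped ContDiff Bundle

noncomputable section

namespace LepageDedecker

/-! ### Multivectors of a finite-dimensional space -/

section Algebra

variable {V W : Type*} [NormedAddCommGroup V] [NormedSpace ℝ V]
  [NormedAddCommGroup W] [NormedSpace ℝ W] {n : ℕ}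

/-- The space `Λⁿ V` of `n`-vectors of a finite-dimensional space `V`, realised (canonically, by
the duality pairing) as the dual of the space of `n`-forms: `X p` is the pairing `⟨X, p⟩`. -/
abbrev MultiVector (n : ℕ) (V : Type*) [NormedAddCommGroup V] [NormedSpace ℝ V] : Type _ :=
  (V [⋀^Fin n]→L[ℝ] ℝ) →L[ℝ] ℝ

/-- The decomposable `n`-vector `v₁ ∧ ⋯ ∧ vₙ`, that is `p ↦ p (v₁, …, vₙ)`. -/
def wedge (v : Fin n → V) : MultiVector n V :=
  ContinuousAlternatingMap.apply ℝ V ℝ v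

/-- The push-forward `Λⁿ A : Λⁿ V → Λⁿ W` by a linear map `A : V → W`. -/
def MultiVector.map (A : V →L[ℝ] W) (X : MultiVector n V) : MultiVector n W :=
  X.comp (ContinuousAlternatingMap.compContinuousLinearMapCLM A)

/-- The interior product `X ⌟ μ` of an `n`-vector with an `(n+1)`-form, normalised by
`⟨Y, X ⌟ μ⟩ = ⟨X ∧ Y, μ⟩`; see `interiorProduct_wedge`. -/
def interiorProduct (X : MultiVector n V) (μ : V [⋀^Fin (n + 1)]→L[ℝ] ℝ) : V →L[ℝ] ℝ :=
  (-1 : ℝ) ^ n • X.comp μ.curryLeft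

/-- The wedge product `a ∧ p` of a `1`-form and an `n`-form,
`(a ∧ p)(v₀, …, vₙ) = ∑ᵢ (-1)ⁱ a(vᵢ) p(v₀, …, v̂ᵢ, …, vₙ)`. -/
def oneWedge (a : V →L[ℝ] ℝ) (p : V [⋀^Fin n]→L[ℝ] ℝ) : V [⋀^Fin (n + 1)]→L[ℝ] ℝ :=
  ContinuousAlternatingMap.alternatizeUncurryFin (a.smulRight p)

/-- The set `D^ω` of decomposable `n`-vectors `z` with `⟨z, ω⟩ = 1`. It is identified with the set
of oriented `n`-dimensional subspaces on which `ω > 0`. -/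
def decomposables (w : V [⋀^Fin n]→L[ℝ] ℝ) : Set (MultiVector n V) :=
  {z | (∃ v : Fin n → V, z = wedge v) ∧ z w = 1}

/-- `∂W/∂z (z, p) = 0`, where `W (z, p) = ⟨z, p⟩ - ℓ z`: the differential of `z ↦ W (z, p)`
vanishes on the tangent space at `z` to the manifold `D^ω`, i.e. on the velocities of the smooth
curves drawn on `D^ω` and passing through `z`. -/
def IsLegendreRelated (w : V [⋀^Fin n]→L[ℝ] ℝ) (ℓ : MultiVector n V → ℝ)
    (z : MultiVector n V) (p : V [⋀^Fin n]→L[ℝ] ℝ) : Prop :=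
  ∀ c : ℝ → MultiVector n V, ContDiff ℝ ∞ c → c 0 = z → (∀ s, c s ∈ decomposables w) →
    HasDerivAt (fun s => c s p - ℓ (c s)) 0 0

/-- The set `Z(p)` of all `z ∈ D^ω` that are in Legendre correspondence with `p`. -/
def legendreSet (w : V [⋀^Fin n]→L[ℝ] ℝ) (ℓ : MultiVector n V → ℝ)
    (p : V [⋀^Fin n]→L[ℝ] ℝ) : Set (MultiVector n V) :=
  {z | z ∈ decomposables w ∧ IsLegendreRelated w ℓ z p}

open Classical in
/-- The value `W (z, p)` at a point `z` of `Z(p)` (and `0` if `Z(p)` is empty). -/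
def legendreValue (w : V [⋀^Fin n]→L[ℝ] ℝ) (ℓ : MultiVector n V → ℝ)
    (p : V [⋀^Fin n]→L[ℝ] ℝ) : ℝ :=
  if h : (legendreSet w ℓ p).Nonempty then h.some p - ℓ h.some else 0

/-- `S` is a smooth embedded submanifold (without boundary) of the vector space `V`. -/
def IsSmoothSubmanifold (S : Set V) : Prop :=
  ∀ z ∈ S, ∃ (Φ : OpenPartialHomeomorph V V) (T : Submodule ℝ V), z ∈ Φ.source ∧
    ContDiffOn ℝ ∞ Φ Φ.source ∧ ContDiffOn ℝ ∞ Φ.symm Φ.target ∧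
    Φ '' (Φ.source ∩ S) = Φ.target ∩ T

theorem interiorProduct_wedge (v : Fin n → V) (μ : V [⋀^Fin (n + 1)]→L[ℝ] ℝ) (ξ : V) :
    interiorProduct (wedge v) μ ξ = μ (Fin.snoc v ξ) := by
  have h : (Fin.snoc v ξ : Fin (n + 1) → V) = (Matrix.vecCons ξ v) ∘ finRotate (n + 1) := by
    ext1 i
    rw [Fin.snoc_eq_cons_rotate]
    rfl
  have h' := μ.toAlternatingMap.map_perm (Matrix.vecCons ξ v) (finRotate (n + 1))
  rw [h]
  refine Eq.trans ?_ h'.symm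
  rw [sign_finRotate]
  simp [interiorProduct, wedge, Units.smul_def]

end Algebra

/-! ### Differential forms on manifolds -/

section Forms

variable {F F' H H' : Type*} [NormedAddCommGroup F] [NormedSpace ℝ F]
  [NormedAddCommGroup F'] [NormedSpace ℝ F'] [TopologicalSpace H] [TopologicalSpace H']
  (J : ModelWithCorners ℝ F H) (J' : ModelWithCorners ℝ F' H')
  {M M' : Type*} [TopologicalSpace M] [ChartedSpace H M]
  [TopologicalSpace M'] [ChartedSpace H' M']

/-- Differential forms of degree `r` on the manifold `M` (no regularity required). -/
abbrev DForm (r : ℕ) (M : Type*) [TopologicalSpace M] [ChartedSpace H M] : Type _ :=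
  ∀ m : M, TangentSpace J m [⋀^Fin r]→L[ℝ] ℝ

variable {J J'} in
/-- The pull-back `f^* β`. -/
def pullbackForm {r : ℕ} (f : M → M') (β : DForm J' r M') : DForm J r M :=
  fun m => (β (f m)).compContinuousLinearMap (mfderiv J J' f m)

/-- The exterior derivative `dβ`, computed at `m` in the preferred chart at `m`. -/
def exteriorDeriv {r : ℕ} (β : DForm J r M) : DForm J (r + 1) M := fun m =>
  ContinuousAlternatingMap.compContinuousLinearMap
    (extDerivWithin (fun y : F => ContinuousAlternatingMap.compContinuousLinearMap
        (β ((extChartAt J m).symm y))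
        (mfderivWithin 𝓘(ℝ, F) J (extChartAt J m).symm (range J) y))
      (range J) (extChartAt J m m))
    (mfderiv J 𝓘(ℝ, F) (extChartAt J m) m)

end Forms

/-! ### Integration of top-degree forms -/

section Integral

variable {n : ℕ} {X : Type*} [TopologicalSpace X] [ChartedSpace (EuclideanSpace ℝ (Fin n)) X]

/-- The coordinate frame `∂/∂x¹, …, ∂/∂xⁿ` of the preferred chart at `i`, at the point of
coordinates `y`. -/
def coordFrame (i : X) (y : EuclideanSpace ℝ (Fin n)) :
    Fin n → TangentSpace (𝓡 n) ((extChartAt (𝓡 n) i).symm y) :=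
  fun j => mfderiv 𝓘(ℝ, EuclideanSpace ℝ (Fin n)) (𝓡 n) (extChartAt (𝓡 n) i).symm y
    (EuclideanSpace.single j 1)

/-- The integral over `S ⊆ X` of the `n`-form `β` on the `n`-manifold `X`, oriented by the nowhere
vanishing `n`-form `τ`, by means of a smooth partition of unity subordinate to the charts. -/
def integralForm [IsManifold (𝓡 n) ∞ X] [T2Space X] [SigmaCompactSpace X]
    (τ : DForm (𝓡 n) n X) (S : Set X) (β : DForm (𝓡 n) n X) : ℝ :=
  let ρ := (SmoothPartitionOfUnity.exists_isSubordinate_chartAt_source (𝓡 n) X).choose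
  ∑ᶠ i : X, ∫ y in extChartAt (𝓡 n) i '' (S ∩ (chartAt (EuclideanSpace ℝ (Fin n)) i).source),
    ρ i ((extChartAt (𝓡 n) i).symm y) *
      (SignType.sign (τ ((extChartAt (𝓡 n) i).symm y) (coordFrame i y)) : ℝ) *
      β ((extChartAt (𝓡 n) i).symm y) (coordFrame i y)

end Integral

/-! ### The bundle of `n`-forms, the Poincaré–Cartan form and the Legendre correspondence -/

section Legendre

variable (n k : ℕ) (N : Type*) [TopologicalSpace N]
  [ChartedSpace (EuclideanSpace ℝ (Fin (n + k))) N] [IsManifold (𝓡 (n + k)) ∞ N]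

/-- The model fibre of the bundle of `n`-forms of a manifold of dimension `n + k`. -/
abbrev ModelForms : Type := EuclideanSpace ℝ (Fin (n + k)) [⋀^Fin n]→L[ℝ] ℝ

/-- The manifold `Λⁿ T^*N`, with its points `⟨q, p⟩`. -/
abbrev FormBundle : Type _ :=
  Bundle.TotalSpace (ModelForms n k)
    (fun q : N => TangentSpace (𝓡 (n + k)) q [⋀^Fin n]→L[ℝ] Bundle.Trivial N ℝ q)

/-- The model with corners of the manifold `Λⁿ T^*N`. -/
abbrev formModel := (𝓡 (n + k)).prod 𝓘(ℝ, ModelForms n k)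

/-- The canonical Poincaré–Cartan form `θ` on `Λⁿ T^*N`. -/
def poincareCartan : DForm (formModel n k) n (FormBundle n k N) := fun P =>
  ContinuousAlternatingMap.compContinuousLinearMap P.2
    (mfderiv (formModel n k) (𝓡 (n + k)) Bundle.TotalSpace.proj P)

/-- The multisymplectic form `Ω = dθ` on `Λⁿ T^*N`. -/
def multisymplectic : DForm (formModel n k) (n + 1) (FormBundle n k N) :=
  exteriorDeriv (formModel n k) (poincareCartan n k N)

variable {n k N}

/-- Smoothness of an `n`-form on `N`, as a section of `Λⁿ T^*N`. -/
def IsSmoothForm (w : DForm (𝓡 (n + k)) n N) : Prop :=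
  ContMDiff (𝓡 (n + k)) (formModel n k) ∞ (fun q => (⟨q, w q⟩ : FormBundle n k N))

/-- A function on `Gr^ω N ≃ D^ω N`: only its values at the points of `D^ω_q` matter. -/
abbrev LagrangianDensity (n k : ℕ) (N : Type*) : Type _ :=
  N → MultiVector n (EuclideanSpace ℝ (Fin (n + k))) → ℝ

variable {H₁ : Type*} [TopologicalSpace H₁] {d : ℕ}
  {J : ModelWithCorners ℝ (EuclideanSpace ℝ (Fin (n + k + d))) H₁}
  {M : Type*} [TopologicalSpace M] [ChartedSpace H₁ M]

/-- Smoothness of `L : Gr^ω N → ℝ`: in charts of `N`, the function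
`(q, v₁, …, vₙ) ↦ L (q, span (v₁, …, vₙ))` is smooth on the open set of all frames such that
`ω (v₁, …, vₙ) > 0`. -/
def IsSmoothLagrangian (w : DForm (𝓡 (n + k)) n N) (L : LagrangianDensity n k N) : Prop :=
  ∀ q₀ : N,
    let ψ : EuclideanSpace ℝ (Fin (n + k)) → N := (extChartAt (𝓡 (n + k)) q₀).symm
    let u : EuclideanSpace ℝ (Fin (n + k)) × (Fin n → EuclideanSpace ℝ (Fin (n + k))) →
        Fin n → EuclideanSpace ℝ (Fin (n + k)) :=
      fun a i => mfderiv 𝓘(ℝ, EuclideanSpace ℝ (Fin (n + k))) (𝓡 (n + k)) ψ a.1 (a.2 i)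
    ContDiffOn ℝ ∞ (fun a => L (ψ a.1) ((w (ψ a.1) (u a))⁻¹ • wedge (u a)))
      {a | a.1 ∈ (extChartAt (𝓡 (n + k)) q₀).target ∧ 0 < w (ψ a.1) (u a)}

/-- `Z_q(p)` as a set of `n`-vectors of `T_q N`. -/
def bundleLegendreSet (w : DForm (𝓡 (n + k)) n N) (L : LagrangianDensity n k N)
    (P : FormBundle n k N) : Set (MultiVector n (EuclideanSpace ℝ (Fin (n + k)))) :=
  legendreSet (V := EuclideanSpace ℝ (Fin (n + k))) (w P.1) (L P.1) P.2

variable (J) in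
/-- The tangent space `T_p M_q` to the fibre of `M` through the point `m = (q, p)`: the set of all
`ṗ ∈ Λⁿ T_q^*N` whose vertical lift at `(q, p)` is tangent to `M`. -/
def fibreTangent (ι : M → FormBundle n k N) (m : M) : Set (ModelForms n k) :=
  {p' | ∃ v : TangentSpace J m, mfderiv J (formModel n k) ι m v =
    mfderiv 𝓘(ℝ, ℝ) (formModel n k)
      (fun s : ℝ => (⟨(ι m).1, (show ModelForms n k from (ι m).2) + s • p'⟩ : FormBundle n k N)) 0 (1 : ℝ)}

variable (J) in
/-- The Legendre correspondence hypothesis for the submanifold `ι : M ↪ Λⁿ T^*N` (possibly with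
boundary) with typical fibre `S`. -/
structure LegendreCorrespondence {H₂ : Type*} [TopologicalSpace H₂]
    (JS : ModelWithCorners ℝ (EuclideanSpace ℝ (Fin d)) H₂)
    (S : Type*) [TopologicalSpace S] [ChartedSpace H₂ S]
    (w : DForm (𝓡 (n + k)) n N) (L : LagrangianDensity n k N) (ι : M → FormBundle n k N) :
    Prop where
  isSmoothEmbedding : IsSmoothEmbedding J (formModel n k) ∞ ι
  locallyTrivial : ∀ q : N, ∃ e : Bundle.Trivialization S (fun m => (ι m).1), q ∈ e.baseSet ∧
    ContMDiffOn J ((𝓡 (n + k)).prod JS) ∞ e e.source ∧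
    ContMDiffOn ((𝓡 (n + k)).prod JS) J ∞ e.toOpenPartialHomeomorph.symm e.target
  one_le_dim : 1 ≤ d
  dim_le : d ≤ (n + k).choose n
  /- The set `Z_q(p)` is non-empty, connected, and a smooth submanifold. -/
  isConnected : ∀ m, IsConnected (bundleLegendreSet w L (ι m))
  isSmoothSubmanifold : ∀ m, IsSmoothSubmanifold (bundleLegendreSet w L (ι m))
  eq_affine : ∀ m, ∀ z₀ ∈ bundleLegendreSet w L (ι m), bundleLegendreSet w L (ι m) =
    {z | z ∈ decomposables (V := EuclideanSpace ℝ (Fin (n + k))) (w (ι m).1) ∧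
      ∀ p' ∈ fibreTangent J ι m, (z - z₀) p' = 0}

/-- The Hamiltonian function `ℋ (q, p) = W (q, z, p)`, with `z ∈ Z_q(p)`, on `M`. -/
def hamiltonian (w : DForm (𝓡 (n + k)) n N) (L : LagrangianDensity n k N)
    (ι : M → FormBundle n k N) (m : M) : ℝ :=
  legendreValue (V := EuclideanSpace ℝ (Fin (n + k))) (w (ι m).1) (L (ι m).1) (ι m).2

variable (J) in
/-- The form `ω` pulled back to `M` by the projection to `N`. -/
def volumeOn (w : DForm (𝓡 (n + k)) n N) (ι : M → FormBundle n k N) : DForm J n M :=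
  pullbackForm (fun m => (ι m).1) w

variable (J) in
/-- The integrand `θ - ℋ ω` of the functional `𝓘`, as an `n`-form on `M`. -/
def actionForm (w : DForm (𝓡 (n + k)) n N) (L : LagrangianDensity n k N)
    (ι : M → FormBundle n k N) : DForm J n M := fun m =>
  pullbackForm ι (poincareCartan n k N) m - hamiltonian w L ι m • volumeOn J w ι m

variable (J) in
/-- The restriction of `Ω` to `M`. -/
def multisymplecticOn (ι : M → FormBundle n k N) : DForm J (n + 1) M :=
  pullbackForm ι (multisymplectic n k N)

variable (J) in
/-- The `(n+1)`-form `Ω - dℋ ∧ ω` on `M`. -/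
def hamiltonForm (w : DForm (𝓡 (n + k)) n N) (L : LagrangianDensity n k N)
    (ι : M → FormBundle n k N) : DForm J (n + 1) M := fun m =>
  multisymplecticOn J ι m -
    show TangentSpace J m [⋀^Fin (n + 1)]→L[ℝ] ℝ from
      oneWedge (V := EuclideanSpace ℝ (Fin (n + k + d)))
        (mvfderiv J (hamiltonian w L ι) m) (volumeOn J w ι m)

variable (J) in
/-- `X ⌟ μ` for an `n`-vector `X` tangent at `x` to the parametrised submanifold `γ` and an
`(n+1)`-form `μ` on `M`. -/
def tangentInterior {X : Type*} [TopologicalSpace X] [ChartedSpace (EuclideanSpace ℝ (Fin n)) X]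
    (γ : X → M) (x : X) (Y : MultiVector n (EuclideanSpace ℝ (Fin n)))
    (μ : DForm J (n + 1) M) : EuclideanSpace ℝ (Fin (n + k + d)) →L[ℝ] ℝ :=
  interiorProduct (MultiVector.map (V := EuclideanSpace ℝ (Fin n))
    (W := EuclideanSpace ℝ (Fin (n + k + d))) (mfderiv (𝓡 n) J γ x) Y) (μ (γ x))

end Legendre

/-! ### Submanifolds with `ω > 0` and critical points -/

section Critical

variable {n : ℕ} {X : Type*} [TopologicalSpace X] [ChartedSpace (EuclideanSpace ℝ (Fin n)) X]
  {F H : Type*} [NormedAddCommGroup F] [NormedSpace ℝ F] [TopologicalSpace H]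
  (J : ModelWithCorners ℝ F H) {M : Type*} [TopologicalSpace M] [ChartedSpace H M]

/-- `γ` parametrises an embedded `n`-dimensional submanifold `Γ` of `M` on which the `n`-form `w`
does not vanish; `Γ` is given the orientation for which `w` is positive. -/
structure IsPositiveSubmanifold (w : DForm J n M) (γ : X → M) : Prop where
  contMDiff : ContMDiff (𝓡 n) J ∞ γ
  isEmbedding : IsEmbedding γ
  injective_mfderiv : ∀ x, Function.Injective (mfderiv (𝓡 n) J γ x)
  ne_zero : ∀ x, pullbackForm (J := 𝓡 n) γ w x ≠ 0

/-- A smooth deformation `(φ_s)_{s ≥ 0}` of the identity of `M` with support in `K`. -/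
structure IsDeformation (K : Set M) (φ : ℝ → M → M) : Prop where
  contMDiffOn : ContMDiffOn (𝓘(ℝ, ℝ).prod J) J ∞ (fun a : ℝ × M => φ a.1 a.2) (Ici 0 ×ˢ univ)
  map_zero : ∀ m, φ 0 m = m
  eq_of_notMem : ∀ s, 0 ≤ s → ∀ m, m ∉ K → φ s m = m

/-- The submanifold `Γ` parametrised by `γ`, and oriented by `w`, is a critical point of the
functional `Γ ↦ ∫_Γ α`: for all compact sets `K` (such that `Γ ∩ K` is compact, which is automatic
when `Γ` is closed), the integral over `Γ ∩ K` is stationary with respect to the variations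
`Γ_s = φ_s(Γ)` with support in `K`. -/
def IsCritical [IsManifold (𝓡 n) ∞ X] [T2Space X] [SigmaCompactSpace X]
    (w α : DForm J n M) (γ : X → M) : Prop :=
  ∀ K : Set M, IsCompact K → IsCompact (γ ⁻¹' K) → ∀ φ : ℝ → M → M, IsDeformation J K φ →
    HasDerivWithinAt
      (fun s => integralForm (pullbackForm γ w) (γ ⁻¹' K) (pullbackForm (fun x => φ s (γ x)) α))
      0 (Ici 0) 0

end Critical

end LepageDedecker

end

open LepageDedecker

noncomputable section

namespace LepageDedecker

/-! ### Smoothness of the pull-back of alternating maps -/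

section AlternatingCalculus

variable {ι E F G : Type*} [Fintype ι] [NormedAddCommGroup E] [NormedSpace ℝ E]
  [NormedAddCommGroup F] [NormedSpace ℝ F] [NormedAddCommGroup G] [NormedSpace ℝ G]

/-! Put `α = θ - ℋω`. Since `dω = 0`, `dα = Ω - dℋ ∧ ω`. For a deformation of `Γ` with initial
velocity `ξ`, Cartan's formula expresses the derivative of the action as `∫ ξ⌟dα + ∫ d(ξ⌟α)`, where
`ξ` is inserted in the first slot. The second integral vanishes by Stokes, because `ξ` is zero on
`Γ` outside a compact set (`IsExteriorDerivative.hasDerivWithinAt_integralForm`). As `ℋ` is only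
`C¹`, all of this is done on the pull-back of `α` to `[0, ∞) × (chart of Γ)`, a region of a vector
space on which `d` commutes with pull-back (`IsC1Form.extDerivWithin_formPull`). The boundary of `M`
then causes no trouble in the formula.

So `Γ` is critical as soon as `ξ⌟dα` restricts to zero on `Γ` for every `ξ`. The converse is the
fundamental lemma of the calculus of variations
(`IsExteriorDerivative.apply_eq_zero_of_isCritical`). At a boundary point only velocities that do
not leave `M` are available, so the test deformations slide points, in a chart, along segments
towards a fixed point of a convex part of the chart. Their velocities suffice to detect a nonzero
linear form (`exists_mem_range_apply_sub_ne_zero`).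

If `ℋ` is constant on `Γ`, then `dℋ` kills `TΓ`, and criticality becomes `ξ⌟Ω = dℋ(ξ) ω` on `Γ` for
all `ξ`. Each `ΛⁿT_mΓ` is a line on which `ω` does not vanish, so this says that the `X` with `⟨X,
ω⟩ = 1` solves Hamilton's equation, which is (a); the sign `(-1)ⁿ` appears because `X⌟` leaves the
last slot free. If `dℋ(ξ₀) ≠ 0`, the equation at `ξ₀` forces `⟨X, ω⟩ = 1`, whence (b). For (c), the
vertical lift `v` of `ω` is tangent to `M`, with `v⌟Ω = ω` (`multisymplectic_verticalVector`) and
`dℋ(v) = 1`, because replacing `p` by `p + tω` leaves `Z_q(p)` unchanged and adds `t` to `W`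
(`legendreValue_add_smul`). The equation at `v` is then the normalisation itself. -/

theorem exists_leftInverse_toContinuousMultilinearMapCLM :
    ∃ A : ContinuousMultilinearMap ℝ (fun _ : ι => E) G →L[ℝ] E [⋀^ι]→L[ℝ] G,
      ∀ f : E [⋀^ι]→L[ℝ] G, A f.toContinuousMultilinearMap = f := by
  classical
  have hcont : Continuous (ContinuousMultilinearMap.alternatization
      (R := ℝ) (M := E) (N := G) (ι := ι)) := by
    rw [ContinuousAlternatingMap.isEmbedding_toContinuousMultilinearMap.continuous_iff]
    change Continuous fun f : ContinuousMultilinearMap ℝ (fun _ : ι => E) G =>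
      ∑ σ : Equiv.Perm ι, Equiv.Perm.sign σ • f.domDomCongr σ
    refine continuous_finsetSum _ fun σ _ => ?_
    refine Continuous.const_smul ?_ (Equiv.Perm.sign σ)
    exact (ContinuousMultilinearMap.domDomCongrₗᵢ ℝ E G σ).continuous
  -- On an alternating map each of the `(card ι)!` terms of the alternatization equals the map
  -- itself, so the normalised alternatization is a left inverse of the inclusion.
  refine ⟨((Fintype.card ι).factorial : ℝ)⁻¹ •
    ContinuousMultilinearMap.alternatization.toRealLinearMap hcont, fun f => ?_⟩
  ext v
  have h0 : ((Fintype.card ι).factorial : ℝ) ≠ 0 := by positivity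
  have h1 : ∀ σ : Equiv.Perm ι, Equiv.Perm.sign σ • f (v ∘ σ) = f v := fun σ => by
    rw [show f (v ∘ σ) = _ from f.toAlternatingMap.map_perm v σ, smul_smul]
    simp
  simp only [smul_apply, ContinuousAlternatingMap.smul_apply,
    AddMonoidHom.coe_toRealLinearMap, ContinuousMultilinearMap.alternatization_apply_apply]
  change _ • ∑ σ : Equiv.Perm ι, Equiv.Perm.sign σ • f (v ∘ σ) = _
  simp only [h1, Finset.sum_const, Finset.card_univ, Fintype.card_perm]
  rw [← Nat.cast_smul_eq_nsmul ℝ, smul_smul, inv_mul_cancel₀ h0, one_smul]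

/-- For multilinear maps the pull-back is linear in the map and multilinear in the linear maps,
hence smooth. The retraction `A` brings the result back to alternating maps. -/
theorem contDiff_compContinuousLinearMap {k : ℕ∞ω} :
    ContDiff ℝ k (fun fg : (F [⋀^ι]→L[ℝ] G) × (E →L[ℝ] F) =>
      fg.1.compContinuousLinearMap fg.2) := by
  obtain ⟨A, hA⟩ := exists_leftInverse_toContinuousMultilinearMapCLM (ι := ι) (E := E) (G := G)
  have h : (fun fg : (F [⋀^ι]→L[ℝ] G) × (E →L[ℝ] F) => fg.1.compContinuousLinearMap fg.2) =
      fun fg => A ((ContinuousMultilinearMap.compContinuousLinearMapContinuousMultilinear ℝ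
        (fun _ : ι => E) (fun _ : ι => F) G (fun _ => fg.2)) fg.1.toContinuousMultilinearMap) := by
    funext fg
    exact (hA (fg.1.compContinuousLinearMap fg.2)).symm
  rw [h]
  refine A.contDiff.comp (ContDiff.clm_apply ?_ ?_)
  · exact (ContinuousMultilinearMap.contDiff _).comp (contDiff_pi.2 fun _ => contDiff_snd)
  · exact ContDiff.comp (g := fun f : F [⋀^ι]→L[ℝ] G => f.toContinuousMultilinearMap)
      (ContinuousAlternatingMap.toContinuousMultilinearMapCLM (𝕜 := ℝ) (E := F) (F := G)
        (ι := ι) ℝ).contDiff contDiff_fst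

theorem contDiff_compContinuousLinearMapCLM {k : ℕ∞ω} [FiniteDimensional ℝ (F [⋀^ι]→L[ℝ] G)] :
    ContDiff ℝ k (ContinuousAlternatingMap.compContinuousLinearMapCLM :
      (E →L[ℝ] F) → (F [⋀^ι]→L[ℝ] G) →L[ℝ] (E [⋀^ι]→L[ℝ] G)) := by
  rw [contDiff_clm_apply_iff]
  intro f
  exact contDiff_compContinuousLinearMap.comp (contDiff_const.prodMk contDiff_id)

instance [FiniteDimensional ℝ F] [FiniteDimensional ℝ G] :
    FiniteDimensional ℝ (F [⋀^ι]→L[ℝ] G) := by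
  let T : (F [⋀^ι]→L[ℝ] G) →ₗ[ℝ] MultilinearMap ℝ (fun _ : ι => F) G :=
    { toFun := fun f => f.toContinuousMultilinearMap.toMultilinearMap
      map_add' := fun _ _ => rfl
      map_smul' := fun _ _ => rfl }
  refine FiniteDimensional.of_injective T fun f g h => ?_
  ext v
  exact congrArg (fun m : MultilinearMap ℝ (fun _ : ι => F) G => m v) h

end AlternatingCalculus

/-! ### Forms of class `C¹` and naturality of the exterior derivative -/

section Naturality

variable {E F H : Type*} [NormedAddCommGroup E] [NormedSpace ℝ E]
  [NormedAddCommGroup F] [NormedSpace ℝ F] [TopologicalSpace H]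
  (I : ModelWithCorners ℝ F H) {Q : Type*} [TopologicalSpace Q] [ChartedSpace H Q]

/-- The pull-back of a form by a map defined on a subset of a vector space. -/
def formPull {r : ℕ} (G : E → Q) (D : Set E) (β : DForm I r Q) : E → E [⋀^Fin r]→L[ℝ] ℝ := fun y =>
  ContinuousAlternatingMap.compContinuousLinearMap (β (G y)) (mfderivWithin 𝓘(ℝ, E) I G D y)

/-- A differential form is of class `C¹` if its expressions in the charts are. -/
def IsC1Form {r : ℕ} (β : DForm I r Q) : Prop :=
  ∀ P : Q, ContDiffOn ℝ 1 (formPull I (extChartAt I P).symm (range I) β) (extChartAt I P).target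

variable {I}

theorem exteriorDeriv_eq {r : ℕ} (β : DForm I r Q) (P : Q) : exteriorDeriv I β P =
    ContinuousAlternatingMap.compContinuousLinearMap
      (extDerivWithin (formPull I (extChartAt I P).symm (range I) β) (range I) (extChartAt I P P))
      (mfderiv I 𝓘(ℝ, F) (extChartAt I P) P) := rfl

theorem eventually_mem_extChartAt_source {Z : Type*} [TopologicalSpace Z] {G : Z → Q} {D : Set Z} {a : Z} {P : Q}
    (hG : ContinuousWithinAt G D a) (hP : G a ∈ (extChartAt I P).source) :
    ∀ᶠ y in 𝓝[D] a, G y ∈ (extChartAt I P).source :=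
  hG ((isOpen_extChartAt_source P).mem_nhds hP)

variable [IsManifold I ∞ Q]

/-- Chain rule for `G = φ⁻¹ ∘ (φ ∘ G)`, with `φ` the chart at `P`: pull-backs to `Q` reduce to
pull-backs between vector spaces. -/
theorem formPull_eq_chart {r : ℕ} (β : DForm I r Q) {G : E → Q} {D : Set E} {y : E}
    (hG : MDifferentiableWithinAt 𝓘(ℝ, E) I G D y) (hy : UniqueDiffWithinAt ℝ D y) {P : Q}
    (hP : G y ∈ (extChartAt I P).source) :
    formPull I G D β y = ContinuousAlternatingMap.compContinuousLinearMap
      (formPull I (extChartAt I P).symm (range I) β (extChartAt I P (G y)))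
      (fderivWithin ℝ (extChartAt I P ∘ G) D y) := by
  have : IsManifold I 1 Q := IsManifold.of_le (n := ∞) (by simp)
  have hP' : G y ∈ (chartAt H P).source := by rwa [← extChartAt_source I]
  have h1 : fderivWithin ℝ (extChartAt I P ∘ G) D y =
      (mfderiv I 𝓘(ℝ, F) (extChartAt I P) (G y)).comp (mfderivWithin 𝓘(ℝ, E) I G D y) := by
    rw [← mfderivWithin_eq_fderivWithin]
    exact mfderiv_comp_mfderivWithin y (mdifferentiableAt_extChartAt hP') hG hy.uniqueMDiffWithinAt
  have h2 := mfderivWithin_extChartAt_symm_comp_mfderiv_extChartAt' (I := I) hP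
  have h3 : (extChartAt I P).symm (extChartAt I P (G y)) = G y := (extChartAt I P).left_inv hP
  -- The base points `φ⁻¹ (φ (G y))` and `G y` are equal but not definitionally, and the type of `β`
  -- depends on them. Generalising over `q` allows the substitution.
  have key : ∀ (q : Q) (_ : q = G y) (A : F →L[ℝ] TangentSpace I q)
      (_ : ∀ v : F, (A v : F) = mfderivWithin 𝓘(ℝ, F) I (extChartAt I P).symm (range I)
        (extChartAt I P (G y)) v) ,
      formPull I G D β y = ContinuousAlternatingMap.compContinuousLinearMap
        (ContinuousAlternatingMap.compContinuousLinearMap (β q) A)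
        (fderivWithin ℝ (extChartAt I P ∘ G) D y) := by
    rintro q rfl A hA
    ext v
    rw [h1]
    change β (G y) _ = β (G y) _
    congr 1
    funext i
    refine Eq.trans ?_ (hA _).symm
    exact (DFunLike.congr_fun h2 (mfderivWithin 𝓘(ℝ, E) I G D y (v i))).symm
  exact key _ h3 _ fun _ => rfl

theorem contDiffWithinAt_extChartAt_comp {G : E → Q} {D : Set E} {a : E} {P : Q}
    (hG : ContMDiffWithinAt 𝓘(ℝ, E) I ∞ G D a) (hP : G a ∈ (extChartAt I P).source) :
    ContDiffWithinAt ℝ ∞ (extChartAt I P ∘ G) D a := by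
  rw [← contMDiffWithinAt_iff_contDiffWithinAt]
  exact (contMDiffAt_extChartAt' (by rwa [← extChartAt_source I])).comp_contMDiffWithinAt a hG

theorem formPull_eventuallyEq {r : ℕ} (β : DForm I r Q) {G : E → Q} {D : Set E} {a : E} {P : Q}
    (hD : UniqueDiffOn ℝ D) (hG : ContMDiffOn 𝓘(ℝ, E) I ∞ G D) (ha : a ∈ D)
    (hP : G a ∈ (extChartAt I P).source) :
    formPull I G D β =ᶠ[𝓝[D] a] fun y => ContinuousAlternatingMap.compContinuousLinearMap
      (formPull I (extChartAt I P).symm (range I) β ((extChartAt I P ∘ G) y))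
      (fderivWithin ℝ (extChartAt I P ∘ G) D y) := by
  filter_upwards [eventually_mem_extChartAt_source (hG a ha).continuousWithinAt hP,
    self_mem_nhdsWithin] with y hy hyD
  exact formPull_eq_chart β ((hG y hyD).mdifferentiableWithinAt (by simp)) (hD y hyD) hy

theorem IsC1Form.contDiffOn_formPull {r : ℕ} {β : DForm I r Q} (hβ : IsC1Form I β) {G : E → Q}
    {D : Set E} (hD : UniqueDiffOn ℝ D) (hG : ContMDiffOn 𝓘(ℝ, E) I ∞ G D) :
    ContDiffOn ℝ 1 (formPull I G D β) D := by
  intro a ha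
  have hP : G a ∈ (extChartAt I (G a)).source := mem_extChartAt_source _
  have hg := contDiffWithinAt_extChartAt_comp (hG a ha) hP
  have hev := formPull_eventuallyEq β hD hG ha hP
  refine ContDiffWithinAt.congr_of_eventuallyEq_of_mem ?_ hev ha
  refine contDiff_compContinuousLinearMap.contDiffAt.comp_contDiffWithinAt a (ContDiffWithinAt.prodMk ?_
    (hg.fderivWithin_right hD (by norm_cast) ha))
  -- The chart expression of `β` is controlled only on the target of the chart, so `D` is cut down
  -- to a part that `G` maps into its source.
  obtain ⟨u, hu, huD⟩ := mem_nhdsWithin_iff_exists_mem_nhds_inter.1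
    (eventually_mem_extChartAt_source (hG a ha).continuousWithinAt hP)
  have h1 : ContDiffWithinAt ℝ 1 (formPull I (extChartAt I (G a)).symm (range I) β ∘
      (extChartAt I (G a) ∘ G)) (D ∩ u) a := by
    refine ContDiffWithinAt.comp a (hβ (G a) _ ((extChartAt I (G a)).map_source hP))
      ((hg.of_le (by simp)).mono inter_subset_left) fun y hy => ?_
    exact (extChartAt I (G a)).map_source (huD ⟨hy.2, hy.1⟩)
  exact (contDiffWithinAt_inter hu).1 h1

/-- Naturality of `d`. At `G a` the exterior derivative is defined in the chart at `G a`, so it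
suffices to factor `G` through that chart and use naturality in vector spaces. The latter rests on
the symmetry of second derivatives, which is why `D` must lie in the closure of its interior. -/
theorem IsC1Form.extDerivWithin_formPull {r : ℕ} {β : DForm I r Q} (hβ : IsC1Form I β) {G : E → Q}
    {D : Set E} (hD : UniqueDiffOn ℝ D) (hDi : D ⊆ closure (interior D))
    (hG : ContMDiffOn 𝓘(ℝ, E) I ∞ G D) {a : E} (ha : a ∈ D) :
    extDerivWithin (formPull I G D β) D a = formPull I G D (exteriorDeriv I β) a := by
  have hP : G a ∈ (extChartAt I (G a)).source := mem_extChartAt_source _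
  have hg := contDiffWithinAt_extChartAt_comp (hG a ha) hP
  rw [(formPull_eventuallyEq β hD hG ha hP).extDerivWithin_eq_of_mem ha]
  have hd : DifferentiableWithinAt ℝ (formPull I (extChartAt I (G a)).symm (range I) β) (range I)
      (extChartAt I (G a) (G a)) := by
    have := (hβ (G a)).differentiableOn one_ne_zero _ ((extChartAt I (G a)).map_source hP)
    exact this.mono_of_mem_nhdsWithin (extChartAt_target_mem_nhdsWithin _)
  have h := extDerivWithin_pullback (f := extChartAt I (G a) ∘ G) (r := (2 : ℕ∞ω)) hd
    (hg.of_le (by norm_cast)) (by simp) hD (hDi ha) ha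
    (fun y _ => by
      change extChartAt I (G a) (G y) ∈ range I
      exact mem_range_self _)
  refine h.trans ?_
  have hP' : G a ∈ (chartAt H (G a)).source := mem_chart_source _ _
  have : IsManifold I 1 Q := IsManifold.of_le (n := ∞) (by simp)
  have h1 : fderivWithin ℝ (extChartAt I (G a) ∘ G) D a =
      (mfderiv I 𝓘(ℝ, F) (extChartAt I (G a)) (G a)).comp (mfderivWithin 𝓘(ℝ, E) I G D a) := by
    rw [← mfderivWithin_eq_fderivWithin]
    exact mfderiv_comp_mfderivWithin a (mdifferentiableAt_extChartAt hP')
      ((hG a ha).mdifferentiableWithinAt (by simp)) (hD a ha).uniqueMDiffWithinAt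
  rw [h1]
  rfl

end Naturality

/-! ### The manifold structure of the bundle of forms -/

section Bundles

open Bundle

variable {B F₁ F₂ : Type*} {ι : Type*} [Fintype ι]
  {E₁ : B → Type*} {E₂ : B → Type*}
  [∀ x, AddCommGroup (E₁ x)] [∀ x, Module ℝ (E₁ x)] [NormedAddCommGroup F₁] [NormedSpace ℝ F₁]
  [TopologicalSpace (TotalSpace F₁ E₁)] [∀ x, TopologicalSpace (E₁ x)] [∀ x, AddCommGroup (E₂ x)]
  [∀ x, Module ℝ (E₂ x)] [NormedAddCommGroup F₂] [NormedSpace ℝ F₂]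
  [TopologicalSpace (TotalSpace F₂ E₂)] [∀ x, TopologicalSpace (E₂ x)]
  {EB : Type*} [NormedAddCommGroup EB] [NormedSpace ℝ EB] {HB : Type*} [TopologicalSpace HB]
  {IB : ModelWithCorners ℝ EB HB} [TopologicalSpace B] [ChartedSpace HB B]
  [FiberBundle F₁ E₁] [VectorBundle ℝ F₁ E₁] [FiberBundle F₂ E₂] [VectorBundle ℝ F₂ E₂]

set_option synthInstance.maxHeartbeats 200000 in
-- The coordinate change composes an alternating map on one side with the coordinate change of `E₂`
-- and on the other with the inverse one of `E₁`. Both operations depend smoothly on the linear maps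
-- involved.
theorem contMDiffOn_continuousAlternatingMapCoordChange {n : ℕ∞ω}
    [FiniteDimensional ℝ F₁] [FiniteDimensional ℝ F₂]
    {e₁ e₁' : Trivialization F₁ (π F₁ E₁)} {e₂ e₂' : Trivialization F₂ (π F₂ E₂)}
    [ContMDiffVectorBundle n F₁ E₁ IB] [ContMDiffVectorBundle n F₂ E₂ IB]
    [MemTrivializationAtlas e₁] [MemTrivializationAtlas e₁']
    [MemTrivializationAtlas e₂] [MemTrivializationAtlas e₂'] :
    ContMDiffOn IB 𝓘(ℝ, (F₁ [⋀^ι]→L[ℝ] F₂) →L[ℝ] (F₁ [⋀^ι]→L[ℝ] F₂)) n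
      (Pretrivialization.continuousAlternatingMapCoordChange ℝ ι e₁ e₁' e₂ e₂')
      (e₁.baseSet ∩ e₂.baseSet ∩ (e₁'.baseSet ∩ e₂'.baseSet)) := by
  have h₁ := contMDiffOn_coordChangeL (IB := IB) e₁' e₁ (n := n)
  have h₂ := contMDiffOn_coordChangeL (IB := IB) e₂ e₂' (n := n)
  simp +unfoldPartialApp only [Pretrivialization.continuousAlternatingMapCoordChange,
    ContinuousLinearEquiv.coe_continuousAlternatingMapCongr, ContinuousLinearEquiv.symm_symm]
  have h₁' := h₁.mono (t := e₁.baseSet ∩ e₂.baseSet ∩ (e₁'.baseSet ∩ e₂'.baseSet))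
    (by mfld_set_tac)
  have h₂' := h₂.mono (t := e₁.baseSet ∩ e₂.baseSet ∩ (e₁'.baseSet ∩ e₂'.baseSet))
    (by mfld_set_tac)
  refine ContMDiffOn.clm_comp ?_ ?_
  · exact (ContinuousLinearMap.contMDiff (E := F₂ →L[ℝ] F₂)
      (F := (F₁ [⋀^ι]→L[ℝ] F₂) →L[ℝ] (F₁ [⋀^ι]→L[ℝ] F₂))
      (ContinuousLinearMap.compContinuousAlternatingMapCLM (ι := ι) ℝ F₁ F₂ F₂)).comp_contMDiffOn h₂'
  · exact (contDiff_compContinuousLinearMapCLM (ι := ι) (E := F₁) (F := F₁) (G := F₂)).contMDiff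
      |>.comp_contMDiffOn h₁'

variable [∀ x, IsTopologicalAddGroup (E₂ x)] [∀ x, ContinuousSMul ℝ (E₂ x)]

instance {n : ℕ∞ω} [FiniteDimensional ℝ F₁] [FiniteDimensional ℝ F₂]
    [ContMDiffVectorBundle n F₁ E₁ IB] [ContMDiffVectorBundle n F₂ E₂ IB] :
    (Bundle.ContinuousAlternatingMap.vectorPrebundle ℝ ι F₁ E₁ F₂ E₂).IsContMDiff IB n where
  exists_contMDiffCoordChange := by
    rintro _ ⟨e₁, e₂, he₁, he₂, rfl⟩ _ ⟨e₁', e₂', he₁', he₂', rfl⟩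
    exact ⟨Pretrivialization.continuousAlternatingMapCoordChange ℝ ι e₁ e₁' e₂ e₂',
      contMDiffOn_continuousAlternatingMapCoordChange,
      Pretrivialization.continuousAlternatingMapCoordChange_apply⟩

instance contMDiffVectorBundle_continuousAlternatingMap {n : ℕ∞ω}
    [FiniteDimensional ℝ F₁] [FiniteDimensional ℝ F₂]
    [ContMDiffVectorBundle n F₁ E₁ IB] [ContMDiffVectorBundle n F₂ E₂ IB] :
    ContMDiffVectorBundle n (F₁ [⋀^ι]→L[ℝ] F₂) (fun x => E₁ x [⋀^ι]→L[ℝ] E₂ x) IB :=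
  (Bundle.ContinuousAlternatingMap.vectorPrebundle ℝ ι F₁ E₁ F₂ E₂).contMDiffVectorBundle IB

end Bundles

/-! ### Canonical coordinates on `ΛⁿT^*N` and the forms `θ` and `Ω`. -/

section FormBundle

variable {n k : ℕ} {N : Type*} [TopologicalSpace N]
  [ChartedSpace (EuclideanSpace ℝ (Fin (n + k))) N] [IsManifold (𝓡 (n + k)) ∞ N]

instance : IsManifold (formModel n k) ∞ (FormBundle n k N) :=
  Bundle.TotalSpace.isManifold _ _

theorem contMDiff_proj_formBundle :
    ContMDiff (formModel n k) (𝓡 (n + k)) ∞ (fun P : FormBundle n k N => P.1) :=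
  Bundle.contMDiff_proj _

theorem trivializationAt_formBundle (q : N) (P : FormBundle n k N) :
    trivializationAt (ModelForms n k)
      (fun q : N => TangentSpace (𝓡 (n + k)) q [⋀^Fin n]→L[ℝ] Bundle.Trivial N ℝ q) q P =
    (P.1, ContinuousAlternatingMap.compContinuousLinearMap P.2
      ((trivializationAt (EuclideanSpace ℝ (Fin (n + k))) (TangentSpace (𝓡 (n + k))) q).symmL
        ℝ P.1)) := by
  rw [FiberBundle.trivializationAt_continuousAlternatingMap_apply]
  refine Prod.ext rfl ?_
  ext v
  simp [ContinuousAlternatingMap.inCoordinates]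

/-- The second component of the chart of the bundle of forms. -/
theorem trivializationAt_formBundle_snd (q : N) (P : FormBundle n k N)
    (hP : P.1 ∈ (chartAt (EuclideanSpace ℝ (Fin (n + k))) q).source) :
    (trivializationAt (ModelForms n k)
      (fun q : N => TangentSpace (𝓡 (n + k)) q [⋀^Fin n]→L[ℝ] Bundle.Trivial N ℝ q) q P).2 =
    ContinuousAlternatingMap.compContinuousLinearMap P.2
      (mfderivWithin 𝓘(ℝ, EuclideanSpace ℝ (Fin (n + k))) (𝓡 (n + k))
        (extChartAt (𝓡 (n + k)) q).symm (range (𝓡 (n + k))) (extChartAt (𝓡 (n + k)) q P.1)) := by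
  rw [trivializationAt_formBundle, TangentBundle.symmL_trivializationAt hP]; rfl

/-- The fibre coordinate of the section in the trivialization at `q` is the pull-back of the form by
the inverse chart at `q`, so the two notions of regularity compare directly. -/
theorem IsSmoothForm.isC1Form {w : DForm (𝓡 (n + k)) n N} (hw : IsSmoothForm w) :
    IsC1Form (𝓡 (n + k)) w := by
  intro q a ha
  have hx : (extChartAt (𝓡 (n + k)) q).symm a ∈
      (chartAt (EuclideanSpace ℝ (Fin (n + k))) q).source := by
    rw [← extChartAt_source (𝓡 (n + k))]
    exact (extChartAt (𝓡 (n + k)) q).map_target ha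
  have h1 : ContMDiffOn (𝓡 (n + k)) 𝓘(ℝ, ModelForms n k) ∞ (fun x => (trivializationAt (ModelForms n k)
      (fun q : N => TangentSpace (𝓡 (n + k)) q [⋀^Fin n]→L[ℝ] Bundle.Trivial N ℝ q) q
        (⟨x, w x⟩ : FormBundle n k N)).2)
      (chartAt (EuclideanSpace ℝ (Fin (n + k))) q).source := by
    refine ((Bundle.Trivialization.contMDiffOn_iff (fun x hx => ?_)).1 hw.contMDiffOn).2
    simpa using hx
  have h2 : ContDiffOn ℝ ∞ ((fun x => (trivializationAt (ModelForms n k)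
      (fun q : N => TangentSpace (𝓡 (n + k)) q [⋀^Fin n]→L[ℝ] Bundle.Trivial N ℝ q) q
        (⟨x, w x⟩ : FormBundle n k N)).2) ∘ (extChartAt (𝓡 (n + k)) q).symm)
      (extChartAt (𝓡 (n + k)) q).target := by
    rw [← contMDiffOn_iff_contDiffOn]
    refine h1.comp (contMDiffOn_extChartAt_symm q) fun a ha => ?_
    rw [← extChartAt_source (𝓡 (n + k))]
    exact (extChartAt (𝓡 (n + k)) q).map_target ha
  refine ((h2.of_le (by simp)).congr (fun b hb => ?_)) a ha
  have hx' : (extChartAt (𝓡 (n + k)) q).symm b ∈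
      (chartAt (EuclideanSpace ℝ (Fin (n + k))) q).source := by
    rw [← extChartAt_source (𝓡 (n + k))]
    exact (extChartAt (𝓡 (n + k)) q).map_target hb
  have h3 := trivializationAt_formBundle_snd q ⟨_, w ((extChartAt (𝓡 (n + k)) q).symm b)⟩ hx'
  refine Eq.trans ?_ h3.symm
  have h4 : ∀ (z : EuclideanSpace ℝ (Fin (n + k))), z = b → ∀ u : EuclideanSpace ℝ (Fin (n + k)),
      (mfderivWithin 𝓘(ℝ, EuclideanSpace ℝ (Fin (n + k))) (𝓡 (n + k)) (extChartAt (𝓡 (n + k)) q).symm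
        (range (𝓡 (n + k))) b u : EuclideanSpace ℝ (Fin (n + k))) =
      mfderivWithin 𝓘(ℝ, EuclideanSpace ℝ (Fin (n + k))) (𝓡 (n + k)) (extChartAt (𝓡 (n + k)) q).symm
        (range (𝓡 (n + k))) z u := by
    rintro _ rfl u
    rfl
  ext v
  change w _ _ = w _ _
  congr 1
  funext i
  exact h4 _ ((extChartAt (𝓡 (n + k)) q).right_inv hb) (v i)

/-- The tautological property of `θ`: it factors through the projection, so only the derivative of
the base map enters. -/
theorem formPull_poincareCartan {E : Type*} [NormedAddCommGroup E] [NormedSpace ℝ E] {G : E → FormBundle n k N}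
    {D : Set E} {y : E} (hG : MDifferentiableWithinAt 𝓘(ℝ, E) (formModel n k) G D y)
    (hy : UniqueDiffWithinAt ℝ D y) :
    formPull (formModel n k) G D (poincareCartan n k N) y =
      ContinuousAlternatingMap.compContinuousLinearMap (G y).2
        (mfderivWithin 𝓘(ℝ, E) (𝓡 (n + k)) (fun y => (G y).1) D y) := by
  have h := mfderiv_comp_mfderivWithin y (contMDiff_proj_formBundle.mdifferentiable (by simp) (G y))
    hG hy.uniqueMDiffWithinAt
  ext v
  change (G y).2 _ = (G y).2 _
  congr 1
  funext i
  exact (DFunLike.congr_fun h (v i)).symm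

theorem extChartAt_formBundle (P Q : FormBundle n k N) :
    extChartAt (formModel n k) P Q = (extChartAt (𝓡 (n + k)) P.1
      (trivializationAt (ModelForms n k)
      (fun q : N => TangentSpace (𝓡 (n + k)) q [⋀^Fin n]→L[ℝ] Bundle.Trivial N ℝ q) P.1 Q).1,
        (trivializationAt (ModelForms n k)
      (fun q : N => TangentSpace (𝓡 (n + k)) q [⋀^Fin n]→L[ℝ] Bundle.Trivial N ℝ q) P.1 Q).2) := by
  rw [FiberBundle.extChartAt]
  rfl

theorem mem_extChartAt_source_formBundle {P Q : FormBundle n k N} :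
    Q ∈ (extChartAt (formModel n k) P).source ↔
      Q.1 ∈ (chartAt (EuclideanSpace ℝ (Fin (n + k))) P.1).source := by
  rw [extChartAt_source, FiberBundle.chartedSpace_chartAt]
  simp only [mfld_simps]
  rw [trivializationAt_formBundle]
  simp

/-- In canonical coordinates `(x, p)` this is `θ = ∑ p_I dx^I`: the expression is linear in `p` and
does not depend on `x`. -/
theorem formPull_poincareCartan_chart (P : FormBundle n k N)
    {b : EuclideanSpace ℝ (Fin (n + k)) × ModelForms n k}
    (hb : b ∈ (extChartAt (formModel n k) P).target) :
    formPull (formModel n k) (extChartAt (formModel n k) P).symm (range (formModel n k))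
      (poincareCartan n k N) b =
    b.2.compContinuousLinearMap (ContinuousLinearMap.fst ℝ _ _) := by
  set G := (extChartAt (formModel n k) P).symm with hG
  have hQ : G b ∈ (extChartAt (formModel n k) P).source := (extChartAt (formModel n k) P).map_target hb
  have hQ' := mem_extChartAt_source_formBundle.1 hQ
  have hr : range (formModel n k) = univ := (formModel n k).range_eq_univ
  have hGb : ∀ b' ∈ (extChartAt (formModel n k) P).target, extChartAt (𝓡 (n + k)) P.1 (G b').1 = b'.1 ∧
      (trivializationAt (ModelForms n k)
      (fun q : N => TangentSpace (𝓡 (n + k)) q [⋀^Fin n]→L[ℝ] Bundle.Trivial N ℝ q) P.1 (G b')).2 = b'.2 := by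
    intro b' hb'
    have h := (extChartAt (formModel n k) P).right_inv hb'
    rw [← hG, extChartAt_formBundle, trivializationAt_formBundle] at h
    exact ⟨congrArg Prod.fst h, (by rw [trivializationAt_formBundle]; exact congrArg Prod.snd h)⟩
  rw [formPull_poincareCartan]
  rotate_left
  · exact mdifferentiableWithinAt_extChartAt_symm hb
  · exact (formModel n k).uniqueDiffOn _ (by rw [hr]; trivial)
  -- The bundle chart covers the chart of `N`, so the projection reads as the first coordinate near
  -- `b`.
  have h1 : (fun y => (G y).1) =ᶠ[𝓝[range (formModel n k)] b]
      (extChartAt (𝓡 (n + k)) P.1).symm ∘ Prod.fst := by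
    filter_upwards [extChartAt_target_mem_nhdsWithin_of_mem hb] with b' hb'
    have h2 := (extChartAt (formModel n k) P).map_target hb'
    rw [mem_extChartAt_source_formBundle, ← extChartAt_source (𝓡 (n + k))] at h2
    change _ = (extChartAt (𝓡 (n + k)) P.1).symm b'.1
    rw [← (hGb b' hb').1]
    exact ((extChartAt (𝓡 (n + k)) P.1).left_inv h2).symm
  have hb1 : b.1 ∈ (extChartAt (𝓡 (n + k)) P.1).target := by
    rw [← (hGb b hb).1]
    exact (extChartAt (𝓡 (n + k)) P.1).map_source (by rwa [extChartAt_source])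
  have hr' : range (𝓡 (n + k)) = univ := (𝓡 (n + k)).range_eq_univ
  have h3 := mfderiv_comp_mfderivWithin (I := 𝓘(ℝ, EuclideanSpace ℝ (Fin (n + k)) × ModelForms n k)) (I' := 𝓘(ℝ, EuclideanSpace ℝ (Fin (n + k))))
    (I'' := 𝓡 (n + k)) (g := (extChartAt (𝓡 (n + k)) P.1).symm) (f := Prod.fst)
    (s := range (formModel n k)) b
    (by
      have := mdifferentiableWithinAt_extChartAt_symm (I := 𝓡 (n + k)) hb1
      rwa [hr', mdifferentiableWithinAt_univ] at this)
    (differentiableAt_fst.mdifferentiableAt.mdifferentiableWithinAt)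
    ((formModel n k).uniqueMDiffOn _ (by rw [hr]; trivial))
  have h4 : mfderivWithin 𝓘(ℝ, EuclideanSpace ℝ (Fin (n + k)) × ModelForms n k)
      𝓘(ℝ, EuclideanSpace ℝ (Fin (n + k))) Prod.fst (range (formModel n k)) b =
      ContinuousLinearMap.fst ℝ (EuclideanSpace ℝ (Fin (n + k))) (ModelForms n k) := by
    rw [mfderivWithin_eq_fderivWithin]
    exact fderivWithin_fst ((formModel n k).uniqueDiffOn _ (by rw [hr]; trivial))
  have h5 := trivializationAt_formBundle_snd P.1 (G b) hQ'
  rw [(hGb b hb).2, (hGb b hb).1, hr', mfderivWithin_univ] at h5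
  have h6 := h1.mfderivWithin_eq (I := 𝓘(ℝ, EuclideanSpace ℝ (Fin (n + k)) × ModelForms n k))
    (I' := 𝓡 (n + k)) (h1.self_of_nhdsWithin (by rw [hr]; trivial))
  ext v
  rw [h5]
  change (G b).2 _ = (G b).2 _
  congr 1
  funext i
  have h7 := (DFunLike.congr_fun h6 (v i)).trans (DFunLike.congr_fun h3 (v i))
  refine h7.trans ?_
  change mfderiv _ _ _ _ (mfderivWithin _ _ _ _ _ _) = _
  rw [h4]
  rfl

theorem isC1Form_poincareCartan : IsC1Form (formModel n k) (poincareCartan n k N) := by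
  intro P
  refine ContDiffOn.congr ?_ fun b hb => formPull_poincareCartan_chart P hb
  exact (contDiff_compContinuousLinearMap.comp (contDiff_snd.prodMk contDiff_const)).contDiffOn

/-- The vertical tangent vector `d/ds (q, p + s p')` at a point of the bundle of forms. -/
def verticalVector (P : FormBundle n k N) (p' : ModelForms n k) : TangentSpace (formModel n k) P :=
  mfderiv 𝓘(ℝ, ℝ) (formModel n k)
    (fun s : ℝ => (⟨P.1, (show ModelForms n k from P.2) + s • p'⟩ : FormBundle n k N)) 0 (1 : ℝ)

/-- The tangent trivialization at `q` is the identity on the fibre over `q` itself, and so is the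
induced one on forms. -/
theorem extChartAt_formBundle_self_fibre (q : N) (p : ModelForms n k) :
    (trivializationAt (ModelForms n k)
      (fun q : N => TangentSpace (𝓡 (n + k)) q [⋀^Fin n]→L[ℝ] Bundle.Trivial N ℝ q) q
      (⟨q, p⟩ : FormBundle n k N)).2 = p := by
  refine (trivializationAt_formBundle_snd q (⟨q, p⟩ : FormBundle n k N) (mem_chart_source _ _)).trans ?_
  ext v
  change p _ = p _
  congr 1
  funext i
  exact DFunLike.congr_fun (mfderivWithin_range_extChartAt_symm (I := 𝓡 (n + k)) (x := q)) (v i)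

theorem contMDiff_verticalCurve (P : FormBundle n k N) (p' : ModelForms n k) :
    ContMDiff 𝓘(ℝ, ℝ) (formModel n k) ∞
      (fun s : ℝ => (⟨P.1, (show ModelForms n k from P.2) + s • p'⟩ : FormBundle n k N)) := by
  intro s
  rw [Bundle.contMDiffAt_totalSpace]
  refine ⟨contMDiffAt_const, ?_⟩
  simp only [extChartAt_formBundle_self_fibre]
  exact ContDiff.contMDiff (contDiff_const.add (contDiff_id.smul contDiff_const)) s

theorem mfderiv_extChartAt_verticalVector (P : FormBundle n k N) (p' : ModelForms n k) :
    mfderiv (formModel n k) 𝓘(ℝ, EuclideanSpace ℝ (Fin (n + k)) × ModelForms n k)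
      (extChartAt (formModel n k) P) P (verticalVector P p') =
      ((0 : EuclideanSpace ℝ (Fin (n + k))), p') := by
  have h0 : (⟨P.1, (show ModelForms n k from P.2) + (0 : ℝ) • p'⟩ : FormBundle n k N) = P := by
    rw [zero_smul, add_zero]
  have hs : MDifferentiableAt (formModel n k) 𝓘(ℝ, EuclideanSpace ℝ (Fin (n + k)) × ModelForms n k)
      (extChartAt (formModel n k) P)
      (⟨P.1, (show ModelForms n k from P.2) + (0 : ℝ) • p'⟩ : FormBundle n k N) := by
    rw [h0]; exact mdifferentiableAt_extChartAt (mem_chart_source _ _)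
  have h := mfderiv_comp (0 : ℝ) hs
    ((contMDiff_verticalCurve P p').mdifferentiable (by simp) 0)
  have h1 : (extChartAt (formModel n k) P ∘ fun s : ℝ =>
      (⟨P.1, (show ModelForms n k from P.2) + s • p'⟩ : FormBundle n k N)) =
      fun s => (extChartAt (𝓡 (n + k)) P.1 P.1, (show ModelForms n k from P.2) + s • p') := by
    funext s
    rw [Function.comp_apply, extChartAt_formBundle, extChartAt_formBundle_self_fibre,
      trivializationAt_formBundle]
  have h2 : HasFDerivAt (fun s : ℝ => (extChartAt (𝓡 (n + k)) P.1 P.1,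
      (show ModelForms n k from P.2) + s • p'))
      ((0 : ℝ →L[ℝ] EuclideanSpace ℝ (Fin (n + k))).prod
        ((ContinuousLinearMap.id ℝ ℝ).smulRight p')) 0 :=
    (hasFDerivAt_const _ _).prodMk (((hasFDerivAt_id (0 : ℝ)).smul_const p').const_add _)
  rw [h1, mfderiv_eq_fderiv, h2.fderiv] at h
  have h3 := DFunLike.congr_fun h (1 : ℝ)
  have h4 : ∀ (Q : FormBundle n k N) (_ : Q = P) (v : TangentSpace (formModel n k) Q),
      (mfderiv (formModel n k) 𝓘(ℝ, EuclideanSpace ℝ (Fin (n + k)) × ModelForms n k)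
        (extChartAt (formModel n k) P) Q v : EuclideanSpace ℝ (Fin (n + k)) × ModelForms n k) =
      mfderiv (formModel n k) 𝓘(ℝ, EuclideanSpace ℝ (Fin (n + k)) × ModelForms n k)
        (extChartAt (formModel n k) P) P v := by
    rintro Q rfl v
    rfl
  refine ((h4 _ h0 _).symm.trans (h3.symm.trans ?_))
  change ((0 : EuclideanSpace ℝ (Fin (n + k))), (1 : ℝ) • p') = _
  rw [one_smul]

/-- `Ω = ∑ dp_I ∧ dx^I`: in the chart `θ` is locally a linear map, so its derivative is constant and
`Ω` is the alternatization of that map. -/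
theorem multisymplectic_apply (P : FormBundle n k N)
    (v : Fin (n + 1) → EuclideanSpace ℝ (Fin (n + k)) × ModelForms n k) :
    extDerivWithin (formPull (formModel n k) (extChartAt (formModel n k) P).symm
      (range (formModel n k)) (poincareCartan n k N)) (range (formModel n k))
      (extChartAt (formModel n k) P P) v =
    ∑ i : Fin (n + 1), (-1) ^ (i : ℕ) • (v i).2 (fun j => (i.removeNth v j).1) := by
  have hr : range (formModel n k) = univ := (formModel n k).range_eq_univ
  let A : ModelForms n k →L[ℝ] (EuclideanSpace ℝ (Fin (n + k)) × ModelForms n k) [⋀^Fin n]→L[ℝ] ℝ :=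
    ContinuousAlternatingMap.compContinuousLinearMapCLM (ContinuousLinearMap.fst ℝ _ _)
  have h : formPull (formModel n k) (extChartAt (formModel n k) P).symm
      (range (formModel n k)) (poincareCartan n k N) =ᶠ[𝓝[range (formModel n k)]
      (extChartAt (formModel n k) P P)]
      A.comp (ContinuousLinearMap.snd ℝ (EuclideanSpace ℝ (Fin (n + k))) (ModelForms n k)) := by
    filter_upwards [extChartAt_target_mem_nhdsWithin P] with b hb
    exact formPull_poincareCartan_chart P hb
  rw [h.extDerivWithin_eq_of_mem (mem_range_self _), hr, extDerivWithin_univ, extDeriv,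
    ContinuousLinearMap.fderiv, ContinuousAlternatingMap.alternatizeUncurryFin_apply]
  rfl

/-- In the coordinate sum for `Ω` only the term that differentiates along the vertical vector
survives; in the others it is an argument of a form that sees base components only. -/
theorem multisymplectic_verticalVector (P : FormBundle n k N) (p' : ModelForms n k)
    (v : Fin n → TangentSpace (formModel n k) P) :
    multisymplectic n k N P (Fin.cons (verticalVector P p') v) =
      p' (fun j => mfderiv (formModel n k) (𝓡 (n + k)) Bundle.TotalSpace.proj P (v j)) := by
  rw [multisymplectic, exteriorDeriv_eq]
  refine (multisymplectic_apply P _).trans ?_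
  have hd := mfderiv_extChartAt_verticalVector P p'
  set u : Fin (n + 1) → EuclideanSpace ℝ (Fin (n + k)) × ModelForms n k := fun i =>
    mfderiv (formModel n k) 𝓘(ℝ, EuclideanSpace ℝ (Fin (n + k)) × ModelForms n k)
      (extChartAt (formModel n k) P) P
      ((Fin.cons (verticalVector P p') v : Fin (n + 1) → TangentSpace (formModel n k) P) i) with hu
  have hu0 : u 0 = ((0 : EuclideanSpace ℝ (Fin (n + k))), p') := hd
  change ∑ i : Fin (n + 1), (-1) ^ (i : ℕ) • (u i).2 (fun j => (i.removeNth u j).1) = _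
  rw [Fin.sum_univ_succ, Finset.sum_eq_zero, add_zero]
  · rw [hu0, Fin.val_zero, pow_zero, one_smul]
    congr 1
    funext j
    change (u j.succ).1 = _
    have h1 := mfderiv_comp P (g := extChartAt (𝓡 (n + k)) P.1) (I' := 𝓡 (n + k))
      (I'' := 𝓘(ℝ, EuclideanSpace ℝ (Fin (n + k))))
      (mdifferentiableAt_extChartAt (mem_chart_source _ _))
      (contMDiff_proj_formBundle.mdifferentiable (by simp) P)
    have h2 := mfderiv_comp P (f := extChartAt (formModel n k) P) (I := formModel n k)
      (I' := 𝓘(ℝ, EuclideanSpace ℝ (Fin (n + k)) × ModelForms n k))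
      (g := (Prod.fst : EuclideanSpace ℝ (Fin (n + k)) × ModelForms n k → _))
      (I'' := 𝓘(ℝ, EuclideanSpace ℝ (Fin (n + k))))
      differentiableAt_fst.mdifferentiableAt
      (mdifferentiableAt_extChartAt (mem_chart_source _ _))
    have h3 : (Prod.fst ∘ extChartAt (formModel n k) P) =
        extChartAt (𝓡 (n + k)) P.1 ∘ fun Q : FormBundle n k N => Q.1 := by
      funext Q
      simp only [Function.comp_apply]
      rw [extChartAt_formBundle, trivializationAt_formBundle]
    rw [h3, h1, mfderiv_eq_fderiv, fderiv_fst] at h2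
    have h4 := DFunLike.congr_fun h2 (v j)
    refine h4.symm.trans ?_
    exact DFunLike.congr_fun (mfderiv_extChartAt_self (I := 𝓡 (n + k)) (x := P.1)) _
  · intro i _
    have h0 : (u i.succ).2 (fun j => (Fin.removeNth i.succ u j).1) = 0 := by
      have hn : 0 < n := i.pos
      obtain ⟨m, rfl⟩ : ∃ m, n = m + 1 := ⟨n - 1, by omega⟩
      -- Removing a later argument leaves the vertical vector in slot `0`, where its base component
      -- is zero.
      refine ContinuousAlternatingMap.map_coord_zero _ (0 : Fin (m + 1)) ?_
      change (u (i.succ.succAbove 0)).1 = 0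
      rw [Fin.succ_succAbove_zero, hu0]
    rw [h0, smul_zero]

end FormBundle

/-! ### The exterior derivative of the action form -/

section ActionForm

theorem oneWedge_compContinuousLinearMap {V W : Type*} [NormedAddCommGroup V] [NormedSpace ℝ V]
    [NormedAddCommGroup W] [NormedSpace ℝ W] {r : ℕ} (a : W →L[ℝ] ℝ) (p : W [⋀^Fin r]→L[ℝ] ℝ)
    (A : V →L[ℝ] W) :
    (oneWedge a p).compContinuousLinearMap A =
      oneWedge (a.comp A) (p.compContinuousLinearMap A) := by
  ext v
  simp only [oneWedge, ContinuousAlternatingMap.compContinuousLinearMap_apply,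
    ContinuousAlternatingMap.alternatizeUncurryFin_apply]
  rfl

theorem extDerivWithin_sub_smul {E : Type*} [NormedAddCommGroup E] [NormedSpace ℝ E] {r : ℕ}
    {a b : E → E [⋀^Fin r]→L[ℝ] ℝ} {h : E → ℝ} {D : Set E} {x : E}
    (ha : DifferentiableWithinAt ℝ a D x) (hb : DifferentiableWithinAt ℝ b D x)
    (hh : DifferentiableWithinAt ℝ h D x) (hx : UniqueDiffWithinAt ℝ D x) :
    extDerivWithin (fun y => a y - h y • b y) D x =
      extDerivWithin a D x - (h x • extDerivWithin b D x + oneWedge (fderivWithin ℝ h D x) (b x)) := by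
  have h1 : fderivWithin ℝ (fun y => a y - h y • b y) D x = fderivWithin ℝ a D x -
      (h x • fderivWithin ℝ b D x + (fderivWithin ℝ h D x).smulRight (b x)) := by
    rw [fderivWithin_fun_sub hx ha (hh.fun_smul hb), fderivWithin_fun_smul hx hh hb]
  simp only [extDerivWithin, oneWedge]
  rw [h1]
  refine (map_sub (ContinuousAlternatingMap.alternatizeUncurryFinCLM ℝ E ℝ (n := r)) _ _).trans ?_
  congr 1
  refine (map_add (ContinuousAlternatingMap.alternatizeUncurryFinCLM ℝ E ℝ (n := r)) _ _).trans ?_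
  congr 1
  exact map_smul (ContinuousAlternatingMap.alternatizeUncurryFinCLM ℝ E ℝ (n := r)) _ _

variable {F F' H H' : Type*} [NormedAddCommGroup F] [NormedSpace ℝ F]
  [NormedAddCommGroup F'] [NormedSpace ℝ F'] [TopologicalSpace H] [TopologicalSpace H']
  {J : ModelWithCorners ℝ F H} {J' : ModelWithCorners ℝ F' H'}
  {M M' : Type*} [TopologicalSpace M] [ChartedSpace H M]
  [TopologicalSpace M'] [ChartedSpace H' M']

variable (J) in
/-- The form `μ` is the exterior derivative of the form `α` (of class `C¹`) in the sense that the
pull-back of `α` by any smooth map `G` from a subset of a vector space is of class `C¹`, and its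
exterior derivative is the pull-back of `μ`. -/
structure IsExteriorDerivative {r : ℕ} (α : DForm J r M) (μ : DForm J (r + 1) M) : Prop where
  contDiffOn : ∀ {E : Type} [NormedAddCommGroup E] [NormedSpace ℝ E] (G : E → M) (D : Set E),
    UniqueDiffOn ℝ D → ContMDiffOn 𝓘(ℝ, E) J ∞ G D → ContDiffOn ℝ 1 (formPull J G D α) D
  extDerivWithin_eq : ∀ {E : Type} [NormedAddCommGroup E] [NormedSpace ℝ E] (G : E → M) (D : Set E),
    UniqueDiffOn ℝ D → D ⊆ closure (interior D) → ContMDiffOn 𝓘(ℝ, E) J ∞ G D →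
      ∀ a ∈ D, extDerivWithin (formPull J G D α) D a = formPull J G D μ a

theorem formPull_pullbackForm {E : Type*} [NormedAddCommGroup E] [NormedSpace ℝ E] {r : ℕ}
    {f : M → M'} (β : DForm J' r M') {G : E → M} {D : Set E} {y : E}
    (hf : MDifferentiableAt J J' f (G y)) (hG : MDifferentiableWithinAt 𝓘(ℝ, E) J G D y)
    (hy : UniqueDiffWithinAt ℝ D y) :
    formPull J G D (pullbackForm f β) y = formPull J' (f ∘ G) D β y := by
  have h := mfderiv_comp_mfderivWithin y hf hG hy.uniqueMDiffWithinAt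
  ext v
  change β (f (G y)) _ = β (f (G y)) _
  congr 1
  funext i
  exact (DFunLike.congr_fun h (v i)).symm

variable {n k : ℕ} {N : Type*} [TopologicalSpace N]
  [ChartedSpace (EuclideanSpace ℝ (Fin (n + k))) N] [IsManifold (𝓡 (n + k)) ∞ N]
  {H₁ : Type*} [TopologicalSpace H₁] {d : ℕ}
  {J : ModelWithCorners ℝ (EuclideanSpace ℝ (Fin (n + k + d))) H₁}
  {M : Type*} [TopologicalSpace M] [ChartedSpace H₁ M]

/-- The pull-back of `α` by `G` is built from `θ` along `ι ∘ G`, `ω` along the projection of `ι ∘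
G`, and the `C¹` function `ℋ ∘ G`. Naturality is thus applied on `ΛⁿT^*N` and on `N`, which have no
boundary, and the Leibniz rule gives the rest. -/
theorem isExteriorDerivative_actionForm {w : DForm (𝓡 (n + k)) n N}
    (hw : IsSmoothForm w) (hw_closed : ∀ q, exteriorDeriv (𝓡 (n + k)) w q = 0)
    {L : LagrangianDensity n k N} {ι : M → FormBundle n k N}
    (hι : ContMDiff J (formModel n k) ∞ ι)
    (hℋ : ContMDiff J 𝓘(ℝ, ℝ) 1 (hamiltonian w L ι)) :
    IsExteriorDerivative J (actionForm J w L ι) (hamiltonForm J w L ι) := by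
  have hπι : ContMDiff J (𝓡 (n + k)) ∞ (fun m => (ι m).1) := contMDiff_proj_formBundle.comp hι
  have hA : ∀ {E : Type} [NormedAddCommGroup E] [NormedSpace ℝ E] (G : E → M) (D : Set E),
      UniqueDiffOn ℝ D → ContMDiffOn 𝓘(ℝ, E) J ∞ G D → ∀ y ∈ D,
      formPull J G D (actionForm J w L ι) y =
        formPull (formModel n k) (ι ∘ G) D (poincareCartan n k N) y -
          (hamiltonian w L ι ∘ G) y •
            formPull (𝓡 (n + k)) ((fun m => (ι m).1) ∘ G) D w y := by
    intro E _ _ G D hD hG y hy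
    have hGy := (hG y hy).mdifferentiableWithinAt (by simp)
    rw [← formPull_pullbackForm _ (hι.mdifferentiable (by simp) _) hGy (hD y hy),
      ← formPull_pullbackForm _ (hπι.mdifferentiable (by simp) _) hGy (hD y hy)]
    rfl
  have hcℋ : ∀ {E : Type} [NormedAddCommGroup E] [NormedSpace ℝ E] (G : E → M) (D : Set E),
      ContMDiffOn 𝓘(ℝ, E) J ∞ G D → ContDiffOn ℝ 1 (hamiltonian w L ι ∘ G) D := by
    intro E _ _ G D hG
    rw [← contMDiffOn_iff_contDiffOn]
    exact hℋ.comp_contMDiffOn (hG.of_le (by simp))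
  refine ⟨fun {E} _ _ G D hD hG => ?_, fun {E} _ _ G D hD hDi hG a ha => ?_⟩
  · refine ContDiffOn.congr ?_ (hA G D hD hG)
    refine (isC1Form_poincareCartan.contDiffOn_formPull hD (hι.comp_contMDiffOn hG)).sub
      ((hcℋ G D hG).smul (hw.isC1Form.contDiffOn_formPull hD (hπι.comp_contMDiffOn hG)))
  · rw [extDerivWithin_congr' (hA G D hD hG) ha, extDerivWithin_sub_smul
      ((isC1Form_poincareCartan.contDiffOn_formPull hD (hι.comp_contMDiffOn hG)).differentiableOn
        one_ne_zero a ha)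
      ((hw.isC1Form.contDiffOn_formPull hD (hπι.comp_contMDiffOn hG)).differentiableOn
        one_ne_zero a ha)
      (h := hamiltonian w L ι ∘ G)
      ((hcℋ G D hG).differentiableOn one_ne_zero a ha) (hD a ha),
      isC1Form_poincareCartan.extDerivWithin_formPull hD hDi (hι.comp_contMDiffOn hG) ha,
      hw.isC1Form.extDerivWithin_formPull hD hDi (hπι.comp_contMDiffOn hG) ha]
    have hGa := (hG a ha).mdifferentiableWithinAt (by simp)
    -- Closedness of `ω` removes the Leibniz term `ℋ dω`.
    have h1 : formPull (𝓡 (n + k)) ((fun m => (ι m).1) ∘ G) D (exteriorDeriv (𝓡 (n + k)) w) a = 0 := by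
      ext v
      change exteriorDeriv (𝓡 (n + k)) w _ _ = 0
      rw [hw_closed]
      rfl
    rw [h1, smul_zero, zero_add]
    have h2 : fderivWithin ℝ (hamiltonian w L ι ∘ G) D a =
        (mvfderiv J (hamiltonian w L ι) (G a)).comp (mfderivWithin 𝓘(ℝ, E) J G D a) := by
      rw [← mfderivWithin_eq_fderivWithin]
      exact mfderiv_comp_mfderivWithin a (hℋ.mdifferentiable one_ne_zero _) hGa
        (hD a ha).uniqueMDiffWithinAt
    rw [h2, ← formPull_pullbackForm _ (hι.mdifferentiable (by simp) _) hGa (hD a ha),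
      ← formPull_pullbackForm _ (hπι.mdifferentiable (by simp) _) hGa (hD a ha)]
    have h3 := oneWedge_compContinuousLinearMap (V := E) (W := EuclideanSpace ℝ (Fin (n + k + d)))
      (mvfderiv J (hamiltonian w L ι) (G a)) (volumeOn J w ι (G a))
      (mfderivWithin 𝓘(ℝ, E) J G D a)
    ext v
    have h4 := DFunLike.congr_fun h3 v
    have h5 : formPull J G D (hamiltonForm J w L ι) a v =
      formPull J G D (pullbackForm ι (exteriorDeriv (formModel n k) (poincareCartan n k N))) a v -
        (ContinuousAlternatingMap.compContinuousLinearMap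
          (oneWedge (V := EuclideanSpace ℝ (Fin (n + k + d)))
            (mvfderiv J (hamiltonian w L ι) (G a)) (volumeOn J w ι (G a)))
          (mfderivWithin 𝓘(ℝ, E) J G D a)) v := rfl
    refine (ContinuousAlternatingMap.sub_apply _ _ _).trans ?_
    refine Eq.trans ?_ h5.symm
    exact congrArg (fun z : ℝ => formPull J G D (pullbackForm ι
      (exteriorDeriv (formModel n k) (poincareCartan n k N))) a v - z) h4.symm

end ActionForm

/-! ### Top-degree forms in charts -/

section TopForms

/-- The standard frame of `ℝⁿ`. -/
def stdFrame (n : ℕ) : Fin n → EuclideanSpace ℝ (Fin n) := fun j => EuclideanSpace.single j 1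

theorem apply_comp_stdFrame {n : ℕ} (η : EuclideanSpace ℝ (Fin n) [⋀^Fin n]→L[ℝ] ℝ)
    (A : EuclideanSpace ℝ (Fin n) →L[ℝ] EuclideanSpace ℝ (Fin n)) :
    η (fun j => A (stdFrame n j)) = A.det * η (stdFrame n) := by
  let b : Module.Basis (Fin n) ℝ (EuclideanSpace ℝ (Fin n)) :=
    (EuclideanSpace.basisFun (Fin n) ℝ).toBasis
  have hb : (b : Fin n → EuclideanSpace ℝ (Fin n)) = stdFrame n := by
    funext j
    simp [b, stdFrame]
  have h := η.toAlternatingMap.eq_smul_basis_det b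
  have h1 : ∀ v, η v = η (stdFrame n) * b.det v := fun v => by
    have := DFunLike.congr_fun h v
    rw [hb] at this
    exact this
  rw [h1 (fun j => A (stdFrame n j)), mul_comm]
  congr 1
  have h2 := b.det_comp (A : EuclideanSpace ℝ (Fin n) →ₗ[ℝ] EuclideanSpace ℝ (Fin n)) b
  rw [Module.Basis.det_self, mul_one] at h2
  rw [← hb]
  exact h2

theorem eq_zero_of_apply_stdFrame {n : ℕ} {η : EuclideanSpace ℝ (Fin n) [⋀^Fin n]→L[ℝ] ℝ}
    (h : η (stdFrame n) = 0) : η = 0 := by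
  have h1 := η.toAlternatingMap.eq_smul_basis_det (EuclideanSpace.basisFun (Fin n) ℝ).toBasis
  have hb : ((EuclideanSpace.basisFun (Fin n) ℝ).toBasis : Fin n → EuclideanSpace ℝ (Fin n)) =
      stdFrame n := by
    funext j
    simp [stdFrame]
  rw [hb] at h1
  ext v
  have := DFunLike.congr_fun h1 v
  refine this.trans ?_
  change η (stdFrame n) * _ = 0
  rw [h, zero_mul]

variable {n : ℕ} {X : Type*} [TopologicalSpace X] [ChartedSpace (EuclideanSpace ℝ (Fin n)) X]

/-- The coefficient of a top-degree form in the preferred chart at `i`. -/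
def chartCoeff (β : DForm (𝓡 n) n X) (i : X) (y : EuclideanSpace ℝ (Fin n)) : ℝ :=
  β ((extChartAt (𝓡 n) i).symm y) (coordFrame i y)

theorem isOpen_target (i : X) : IsOpen (extChartAt (𝓡 n) i).target := isOpen_extChartAt_target i

theorem chartCoeff_eq_formPull (β : DForm (𝓡 n) n X) {i : X} {y : EuclideanSpace ℝ (Fin n)}
    (hy : y ∈ (extChartAt (𝓡 n) i).target) :
    chartCoeff β i y = formPull (𝓡 n) (extChartAt (𝓡 n) i).symm (extChartAt (𝓡 n) i).target β y
      (stdFrame n) := by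
  rw [formPull, mfderivWithin_of_isOpen (isOpen_target i) hy]
  rfl

/-- An `n`-form that orients the `n`-manifold `X`. -/
structure IsOrientation (τ : DForm (𝓡 n) n X) : Prop where
  continuousOn : ∀ i, ContinuousOn (chartCoeff τ i) (extChartAt (𝓡 n) i).target
  ne_zero : ∀ i, ∀ y ∈ (extChartAt (𝓡 n) i).target, chartCoeff τ i y ≠ 0

/-- The sign of the orientation form in the chart at `i`. -/
def chartSign (τ : DForm (𝓡 n) n X) (i : X) (y : EuclideanSpace ℝ (Fin n)) : ℝ :=
  (SignType.sign (chartCoeff τ i y) : ℝ)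

theorem IsOrientation.eventually_chartSign_eq {τ : DForm (𝓡 n) n X} (hτ : IsOrientation τ) {i : X}
    {y : EuclideanSpace ℝ (Fin n)} (hy : y ∈ (extChartAt (𝓡 n) i).target) :
    ∀ᶠ z in 𝓝 y, chartSign τ i z = chartSign τ i y := by
  have hc := (hτ.continuousOn i).continuousAt ((isOpen_target i).mem_nhds hy)
  rcases lt_or_gt_of_ne (hτ.ne_zero i y hy) with h | h
  · filter_upwards [hc.eventually_lt_const h] with z hz
    simp [chartSign, sign_neg h, sign_neg hz]
  · filter_upwards [hc.eventually_const_lt h] with z hz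
    simp [chartSign, sign_pos h, sign_pos hz]

theorem IsOrientation.continuousOn_chartSign {τ : DForm (𝓡 n) n X} (hτ : IsOrientation τ) (i : X) :
    ContinuousOn (chartSign τ i) (extChartAt (𝓡 n) i).target := fun _ hy =>
  (continuousAt_const.congr ((hτ.eventually_chartSign_eq hy).mono fun _ h =>
    h.symm)).continuousWithinAt

variable [IsManifold (𝓡 n) ∞ X]

theorem contMDiffOn_chart_symm (i : X) :
    ContMDiffOn 𝓘(ℝ, EuclideanSpace ℝ (Fin n)) (𝓡 n) ∞ (extChartAt (𝓡 n) i).symm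
      (extChartAt (𝓡 n) i).target := contMDiffOn_extChartAt_symm i

/-- The transition map from the chart at `i` to the chart at `j`, with its derivative. -/
theorem chartCoeff_change (β : DForm (𝓡 n) n X) {i j : X} {y : EuclideanSpace ℝ (Fin n)}
    (hy : y ∈ (extChartAt (𝓡 n) i).target)
    (hj : (extChartAt (𝓡 n) i).symm y ∈ (extChartAt (𝓡 n) j).source) :
    chartCoeff β i y =
      (fderiv ℝ (extChartAt (𝓡 n) j ∘ (extChartAt (𝓡 n) i).symm) y).det *
        chartCoeff β j (extChartAt (𝓡 n) j ((extChartAt (𝓡 n) i).symm y)) := by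
  have hr : range (𝓡 n) = univ := (𝓡 n).range_eq_univ
  have hj' := (extChartAt (𝓡 n) j).map_source hj
  rw [chartCoeff_eq_formPull β hy, chartCoeff_eq_formPull β hj',
    formPull_eq_chart β ((contMDiffOn_chart_symm i y hy).mdifferentiableWithinAt (by simp))
      ((isOpen_target i).uniqueDiffWithinAt hy) hj, fderivWithin_of_isOpen (isOpen_target i) hy,
    ← apply_comp_stdFrame]
  rw [formPull, formPull, hr, mfderivWithin_univ, mfderivWithin_of_isOpen (isOpen_target j) hj']
  rfl

theorem differentiableAt_chart_change {i j : X} {y : EuclideanSpace ℝ (Fin n)}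
    (hy : y ∈ (extChartAt (𝓡 n) i).target)
    (hj : (extChartAt (𝓡 n) i).symm y ∈ (extChartAt (𝓡 n) j).source) :
    DifferentiableAt ℝ (extChartAt (𝓡 n) j ∘ (extChartAt (𝓡 n) i).symm) y := by
  have h := contDiffWithinAt_extChartAt_comp (contMDiffOn_chart_symm i y hy) hj
  exact (h.contDiffAt ((isOpen_target i).mem_nhds hy)).differentiableAt (by simp)

/-- Both coefficients acquire the Jacobian determinant; its sign, coming from `τ`, turns the
determinant coming from `β` into the absolute value required by the change of variables formula. -/
theorem chartSign_mul_chartCoeff_change {τ : DForm (𝓡 n) n X} (β : DForm (𝓡 n) n X) {i j : X}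
    {y : EuclideanSpace ℝ (Fin n)} (hy : y ∈ (extChartAt (𝓡 n) i).target)
    (hj : (extChartAt (𝓡 n) i).symm y ∈ (extChartAt (𝓡 n) j).source) :
    chartSign τ i y * chartCoeff β i y =
      |(fderiv ℝ (extChartAt (𝓡 n) j ∘ (extChartAt (𝓡 n) i).symm) y).det| *
        (chartSign τ j (extChartAt (𝓡 n) j ((extChartAt (𝓡 n) i).symm y)) *
        chartCoeff β j (extChartAt (𝓡 n) j ((extChartAt (𝓡 n) i).symm y))) := by
  rw [chartSign, chartCoeff_change τ hy hj, chartCoeff_change β hy hj, sign_mul, chartSign]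
  rw [← sign_mul_self ((fderiv ℝ (extChartAt (𝓡 n) j ∘ (extChartAt (𝓡 n) i).symm) y).det)]
  push_cast
  ring

theorem setIntegral_chart_change {τ : DForm (𝓡 n) n X} (β : DForm (𝓡 n) n X) (i j : X) {B : Set X}
    (hB : IsCompact B) (hi : B ⊆ (extChartAt (𝓡 n) i).source)
    (hj : B ⊆ (extChartAt (𝓡 n) j).source) (g : X → ℝ) :
    ∫ y in extChartAt (𝓡 n) i '' B, g ((extChartAt (𝓡 n) i).symm y) *
        (chartSign τ i y * chartCoeff β i y) =
      ∫ y in extChartAt (𝓡 n) j '' B, g ((extChartAt (𝓡 n) j).symm y) *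
        (chartSign τ j y * chartCoeff β j y) := by
  set σ := extChartAt (𝓡 n) j ∘ (extChartAt (𝓡 n) i).symm with hσ
  have hBi : IsCompact (extChartAt (𝓡 n) i '' B) := hB.image_of_continuousOn
    ((continuousOn_extChartAt i).mono hi)
  have himg : extChartAt (𝓡 n) j '' B = σ '' (extChartAt (𝓡 n) i '' B) := by
    rw [image_image]
    refine image_congr fun x hx => ?_
    rw [hσ, Function.comp_apply, (extChartAt (𝓡 n) i).left_inv (hi hx)]
  have hmem : ∀ y ∈ extChartAt (𝓡 n) i '' B, y ∈ (extChartAt (𝓡 n) i).target ∧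
      (extChartAt (𝓡 n) i).symm y ∈ B := by
    rintro _ ⟨x, hx, rfl⟩
    exact ⟨(extChartAt (𝓡 n) i).map_source (hi hx), by
      rwa [(extChartAt (𝓡 n) i).left_inv (hi hx)]⟩
  have hinj : InjOn σ (extChartAt (𝓡 n) i '' B) := by
    intro y hy z hz h
    have h1 := (extChartAt (𝓡 n) j).injOn (hj (hmem y hy).2) (hj (hmem z hz).2) h
    exact (extChartAt (𝓡 n) i).symm.injOn (hmem y hy).1 (hmem z hz).1 h1
  rw [himg, integral_image_eq_integral_abs_det_fderiv_smul volume hBi.measurableSet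
    (fun y hy => (differentiableAt_chart_change (hmem y hy).1
      (hj (hmem y hy).2)).hasFDerivAt.hasFDerivWithinAt) hinj]
  refine setIntegral_congr_fun hBi.measurableSet fun y hy => ?_
  have h1 : (extChartAt (𝓡 n) j).symm (σ y) = (extChartAt (𝓡 n) i).symm y :=
    (extChartAt (𝓡 n) j).left_inv (hj (hmem y hy).2)
  simp only [smul_eq_mul]
  rw [h1, chartSign_mul_chartCoeff_change β (hmem y hy).1 (hj (hmem y hy).2), mul_left_comm]
  rfl

variable [T2Space X] [SigmaCompactSpace X]

variable (n X) in
/-- The partition of unity used in the definition of the integral. -/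
def integralPartition : SmoothPartitionOfUnity X (𝓡 n) X univ :=
  (SmoothPartitionOfUnity.exists_isSubordinate_chartAt_source (𝓡 n) X).choose

theorem tsupport_integralPartition_subset (i : X) :
    tsupport (integralPartition n X i) ⊆ (extChartAt (𝓡 n) i).source := by
  rw [extChartAt_source]
  exact (SmoothPartitionOfUnity.exists_isSubordinate_chartAt_source (𝓡 n) X).choose_spec i

/-- The compact part of the chart at `i` that contributes to the integral over `S`. -/
def chartPart (S : Set X) (i : X) : Set (EuclideanSpace ℝ (Fin n)) :=
  extChartAt (𝓡 n) i '' (S ∩ tsupport (integralPartition n X i))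

theorem isCompact_chartPart {S : Set X} (hS : IsCompact S) (i : X) : IsCompact (chartPart (n := n) S i) :=
  (hS.inter_right (isClosed_tsupport _)).image_of_continuousOn
    ((continuousOn_extChartAt i).mono
      (inter_subset_right.trans (tsupport_integralPartition_subset i)))

theorem mem_of_mem_chartPart {S : Set X} {i : X} {y : EuclideanSpace ℝ (Fin n)}
    (hy : y ∈ chartPart S i) :
    y ∈ (extChartAt (𝓡 n) i).target ∧ (extChartAt (𝓡 n) i).symm y ∈ S := by
  obtain ⟨x, hx, rfl⟩ := hy
  have := tsupport_integralPartition_subset i hx.2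
  exact ⟨(extChartAt (𝓡 n) i).map_source this, by
    rw [(extChartAt (𝓡 n) i).left_inv this]; exact hx.1⟩

theorem finite_integralPartition {S : Set X} (hS : IsCompact S) :
    {i | (Function.support (integralPartition n X i) ∩ S).Nonempty}.Finite :=
  (integralPartition n X).locallyFinite.finite_nonempty_inter_compact hS

/-- The integral as a finite sum of integrals over compact sets. -/
theorem integralForm_eq_sum (τ : DForm (𝓡 n) n X) {S : Set X} (hS : IsCompact S)
    (β : DForm (𝓡 n) n X) :
    integralForm τ S β = ∑ i ∈ (finite_integralPartition (n := n) hS).toFinset,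
      ∫ y in chartPart S i, integralPartition n X i ((extChartAt (𝓡 n) i).symm y) *
        (chartSign τ i y * chartCoeff β i y) := by
  have hterm : ∀ i : X, (∫ y in extChartAt (𝓡 n) i ''
        (S ∩ (chartAt (EuclideanSpace ℝ (Fin n)) i).source),
      integralPartition n X i ((extChartAt (𝓡 n) i).symm y) *
        (SignType.sign (τ ((extChartAt (𝓡 n) i).symm y) (coordFrame i y)) : ℝ) *
        β ((extChartAt (𝓡 n) i).symm y) (coordFrame i y)) =
      ∫ y in chartPart S i, integralPartition n X i ((extChartAt (𝓡 n) i).symm y) *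
        (chartSign τ i y * chartCoeff β i y) := by
    intro i
    have hV : extChartAt (𝓡 n) i '' (S ∩ (chartAt (EuclideanSpace ℝ (Fin n)) i).source) =
        (extChartAt (𝓡 n) i).target ∩ (extChartAt (𝓡 n) i).symm ⁻¹' S := by
      rw [← extChartAt_source (𝓡 n), inter_comm, (extChartAt (𝓡 n) i).image_source_inter_eq']
    have hVm : MeasurableSet (extChartAt (𝓡 n) i ''
        (S ∩ (chartAt (EuclideanSpace ℝ (Fin n)) i).source)) := by
      have h1 := (continuousOn_extChartAt_symm (I := 𝓡 n) i).isOpen_inter_preimage (isOpen_target i)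
        hS.isClosed.isOpen_compl
      have h2 : (extChartAt (𝓡 n) i).target ∩ (extChartAt (𝓡 n) i).symm ⁻¹' S =
          (extChartAt (𝓡 n) i).target \
            ((extChartAt (𝓡 n) i).target ∩ (extChartAt (𝓡 n) i).symm ⁻¹' Sᶜ) := by
        ext y
        simp only [mem_inter_iff, mem_preimage, Set.mem_sdiff, mem_compl_iff]
        tauto
      rw [hV, h2]
      exact (isOpen_target i).measurableSet.diff h1.measurableSet
    have hsub : chartPart S i ⊆ extChartAt (𝓡 n) i ''
        (S ∩ (chartAt (EuclideanSpace ℝ (Fin n)) i).source) := by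
      refine image_mono (inter_subset_inter_right _ ?_)
      rw [← extChartAt_source (𝓡 n)]
      exact tsupport_integralPartition_subset i
    simp only [mul_assoc]
    -- The partition function vanishes off its support, so the domain of integration, which need not
    -- be compact, shrinks to the compact `chartPart`.
    refine (setIntegral_eq_of_subset_of_forall_sdiff_eq_zero hVm hsub ?_)
    rintro _ ⟨⟨x, hx, rfl⟩, hx'⟩
    have hxs : x ∈ (extChartAt (𝓡 n) i).source := by rw [extChartAt_source]; exact hx.2
    have h0 : integralPartition n X i x = 0 := by
      by_contra h
      exact hx' ⟨x, ⟨hx.1, subset_tsupport _ h⟩, rfl⟩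
    rw [(extChartAt (𝓡 n) i).left_inv hxs, h0, zero_mul]
  have h := finsum_eq_sum_of_support_subset (fun i : X =>
    ∫ y in chartPart S i, integralPartition n X i ((extChartAt (𝓡 n) i).symm y) *
        (chartSign τ i y * chartCoeff β i y)) (s := (finite_integralPartition (n := n) hS).toFinset) ?_
  · rw [← h]
    exact finsum_congr hterm
  · intro i hi
    simp only [Finite.coe_toFinset, mem_ofPred_eq]
    by_contra hne
    rw [not_nonempty_iff_eq_empty] at hne
    refine hi ?_
    refine setIntegral_eq_zero_of_forall_eq_zero fun y hy => ?_
    have h1 : integralPartition n X i ((extChartAt (𝓡 n) i).symm y) = 0 := by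
      by_contra h2
      exact (hne ▸ (⟨h2, (mem_of_mem_chartPart hy).2⟩ :
        (extChartAt (𝓡 n) i).symm y ∈ Function.support (integralPartition n X i) ∩ S) :
        (extChartAt (𝓡 n) i).symm y ∈ (∅ : Set X))
    rw [h1, zero_mul]

theorem sum_integralPartition_eq_one {S : Set X} (hS : IsCompact S) {x : X} (hx : x ∈ S) :
    ∑ i ∈ (finite_integralPartition (n := n) hS).toFinset, integralPartition n X i x = 1 := by
  refine (integralPartition n X).sum_finsupport' x (mem_univ x) fun i hi => ?_
  rw [SmoothPartitionOfUnity.mem_finsupport] at hi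
  simp only [Finite.mem_toFinset, mem_ofPred_eq]
  exact ⟨x, hi, hx⟩

end TopForms

/-! ### Stokes' theorem for compactly supported forms -/

section Stokes

theorem integral_fderiv_eq_zero {E : Type*} [NormedAddCommGroup E] [NormedSpace ℝ E]
    [FiniteDimensional ℝ E] [MeasurableSpace E] [BorelSpace E] (μ : Measure E) [μ.IsAddHaarMeasure]
    {f : E → ℝ} (hf : ContDiff ℝ 1 f) (hc : HasCompactSupport f) (v : E) :
    ∫ x, fderiv ℝ f x v ∂μ = 0 := by
  -- Integration by parts against the constant function `1`.
  have h := integral_mul_fderiv_eq_neg_fderiv_mul_of_integrable (μ := μ) (f := fun _ : E => (1 : ℝ))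
    (g := f) (v := v) (by simp) ?_ ?_ (fun _ _ => differentiableAt_const _)
    (fun x _ => hf.differentiable one_ne_zero x)
  · simpa using h
  · simp only [one_mul]
    exact ((hf.continuous_fderiv one_ne_zero).clm_apply continuous_const).integrable_of_hasCompactSupport
      (hc.fderiv_apply ℝ v)
  · simp only [one_mul]
    exact hf.continuous.integrable_of_hasCompactSupport hc

theorem integral_extDeriv_eq_zero {m : ℕ}
    {B : EuclideanSpace ℝ (Fin (m + 1)) → EuclideanSpace ℝ (Fin (m + 1)) [⋀^Fin m]→L[ℝ] ℝ}
    (hB : ContDiff ℝ 1 B) (hc : HasCompactSupport B)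
    (v : Fin (m + 1) → EuclideanSpace ℝ (Fin (m + 1))) :
    ∫ y, extDeriv B y v = 0 := by
  have hBv : ∀ u, ContDiff ℝ 1 (fun y => B y u) := fun u =>
    (ContinuousAlternatingMap.apply ℝ (EuclideanSpace ℝ (Fin (m + 1))) ℝ u).contDiff.comp hB
  have hcv : ∀ u, HasCompactSupport (fun y => B y u) := fun u =>
    hc.comp_left (g := fun b : EuclideanSpace ℝ (Fin (m + 1)) [⋀^Fin m]→L[ℝ] ℝ => b u) rfl
  simp only [fun y => extDeriv_apply (hB.differentiable one_ne_zero y) v]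
  rw [integral_finsetSum]
  · refine Finset.sum_eq_zero fun i _ => ?_
    have := integral_fderiv_eq_zero (volume : Measure (EuclideanSpace ℝ (Fin (m + 1))))
      (hBv (i.removeNth v)) (hcv _) (v i)
    simp only [zsmul_eq_mul]
    rw [integral_const_mul, this, mul_zero]
  · intro i _
    simp only [zsmul_eq_mul]
    refine Integrable.const_mul ?_ _
    exact (((hBv _).continuous_fderiv one_ne_zero).clm_apply
      continuous_const).integrable_of_hasCompactSupport ((hcv _).fderiv_apply ℝ _)

variable {F H : Type*} [NormedAddCommGroup F] [NormedSpace ℝ F] [TopologicalSpace H]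
  {I : ModelWithCorners ℝ F H} {Q : Type*} [TopologicalSpace Q] [ChartedSpace H Q]

theorem IsC1Form.smul [IsManifold I ∞ Q] {r : ℕ} {β : DForm I r Q} (hβ : IsC1Form I β) {f : Q → ℝ}
    (hf : ContMDiff I 𝓘(ℝ, ℝ) ∞ f) : IsC1Form I (fun x => f x • β x) := by
  intro P
  have h1 : ContDiffOn ℝ 1 (f ∘ (extChartAt I P).symm) (extChartAt I P).target := by
    have h := hf.comp_contMDiffOn (contMDiffOn_extChartAt_symm (n := ∞) P)
    exact (contMDiffOn_iff_contDiffOn.1 h).of_le (by norm_cast)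
  exact h1.smul (hβ P)

theorem exteriorDeriv_eq_zero_of_eventually {r : ℕ} {β : DForm I r Q} {x : Q}
    (h : ∀ᶠ z in 𝓝 x, β z = 0) : exteriorDeriv I β x = 0 := by
  have h1 : formPull I (extChartAt I x).symm (range I) β =ᶠ[𝓝[range I] (extChartAt I x x)]
      fun _ => 0 := by
    have h2 := (continuousAt_extChartAt_symm (I := I) x).tendsto
    rw [(extChartAt I x).left_inv (mem_extChartAt_source x)] at h2
    filter_upwards [(h2.mono_left nhdsWithin_le_nhds).eventually h] with y hy
    ext v
    change β _ _ = 0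
    rw [hy]
    rfl
  rw [exteriorDeriv_eq, h1.extDerivWithin_eq_of_mem (mem_range_self _)]
  have h3 : extDerivWithin (fun _ : F => (0 : F [⋀^Fin r]→L[ℝ] ℝ)) (range I) (extChartAt I x x) = 0 := by
    rw [extDerivWithin, fderivWithin_fun_const]
    exact map_zero (ContinuousAlternatingMap.alternatizeUncurryFinCLM ℝ F ℝ (n := r))
  rw [h3]
  rfl

theorem exteriorDeriv_sum {ι : Type*} (t : Finset ι) {r : ℕ} {β : ι → DForm I r Q}
    (hβ : ∀ i ∈ t, IsC1Form I (β i)) (x : Q) :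
    exteriorDeriv I (fun z => ∑ i ∈ t, β i z) x = ∑ i ∈ t, exteriorDeriv I (β i) x := by
  have h1 : formPull I (extChartAt I x).symm (range I) (fun z => ∑ i ∈ t, β i z) =
      fun y => ∑ i ∈ t, formPull I (extChartAt I x).symm (range I) (β i) y := by
    funext y
    exact map_sum (ContinuousAlternatingMap.compContinuousLinearMapₗ _) _ _
  have hd : ∀ i ∈ t, DifferentiableWithinAt ℝ (formPull I (extChartAt I x).symm (range I) (β i))
      (range I) (extChartAt I x x) := fun i hi =>
    ((hβ i hi x).differentiableOn one_ne_zero _ (mem_extChartAt_target x)).mono_of_mem_nhdsWithin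
      (extChartAt_target_mem_nhdsWithin _)
  have h3 : fderivWithin ℝ (fun y => ∑ i ∈ t, formPull I (extChartAt I x).symm (range I) (β i) y)
      (range I) (extChartAt I x x) = ∑ i ∈ t, fderivWithin ℝ
        (formPull I (extChartAt I x).symm (range I) (β i)) (range I) (extChartAt I x x) :=
    fderivWithin_fun_sum (I.uniqueDiffOn.uniqueDiffWithinAt (mem_range_self _)) hd
  have h2 := map_sum (ContinuousAlternatingMap.alternatizeUncurryFinCLM ℝ F ℝ (n := r))
    (fun i => fderivWithin ℝ (formPull I (extChartAt I x).symm (range I) (β i)) (range I)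
      (extChartAt I x x)) t
  have h4 : extDerivWithin (formPull I (extChartAt I x).symm (range I) (fun z => ∑ i ∈ t, β i z))
      (range I) (extChartAt I x x) = ∑ i ∈ t, extDerivWithin
        (formPull I (extChartAt I x).symm (range I) (β i)) (range I) (extChartAt I x x) := by
    rw [h1, extDerivWithin, h3]
    exact h2
  refine (congrArg (fun z => ContinuousAlternatingMap.compContinuousLinearMap z
    (mfderiv I 𝓘(ℝ, F) (extChartAt I x) x)) h4).trans ?_
  exact map_sum (ContinuousAlternatingMap.compContinuousLinearMapₗ _) _ _

variable {m : ℕ} {X : Type*} [TopologicalSpace X]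
  [ChartedSpace (EuclideanSpace ℝ (Fin (m + 1))) X] [IsManifold (𝓡 (m + 1)) ∞ X]

theorem chartCoeff_exteriorDeriv {β : DForm (𝓡 (m + 1)) m X} (hβ : IsC1Form (𝓡 (m + 1)) β)
    {i : X} {y : EuclideanSpace ℝ (Fin (m + 1))} (hy : y ∈ (extChartAt (𝓡 (m + 1)) i).target) :
    chartCoeff (exteriorDeriv (𝓡 (m + 1)) β) i y =
      extDeriv (formPull (𝓡 (m + 1)) (extChartAt (𝓡 (m + 1)) i).symm
        (extChartAt (𝓡 (m + 1)) i).target β) y (stdFrame (m + 1)) := by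
  have ho := isOpen_target (n := m + 1) i
  rw [chartCoeff_eq_formPull _ hy, ← hβ.extDerivWithin_formPull ho.uniqueDiffOn
    (by rw [ho.interior_eq]; exact subset_closure) (contMDiffOn_chart_symm i) hy, extDerivWithin,
    fderivWithin_of_isOpen ho hy, extDeriv]

theorem continuousOn_chartCoeff_exteriorDeriv {β : DForm (𝓡 (m + 1)) m X}
    (hβ : IsC1Form (𝓡 (m + 1)) β) (i : X) :
    ContinuousOn (chartCoeff (exteriorDeriv (𝓡 (m + 1)) β) i) (extChartAt (𝓡 (m + 1)) i).target := by
  have ho := isOpen_target (n := m + 1) i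
  refine ContinuousOn.congr ?_ fun y hy => chartCoeff_exteriorDeriv hβ hy
  have h1 := hβ.contDiffOn_formPull ho.uniqueDiffOn (contMDiffOn_chart_symm i)
  have h2 := h1.continuousOn_fderiv_of_isOpen ho le_rfl
  exact ((ContinuousAlternatingMap.apply ℝ (EuclideanSpace ℝ (Fin (m + 1))) ℝ
    (stdFrame (m + 1))).comp (ContinuousAlternatingMap.alternatizeUncurryFinCLM ℝ
      (EuclideanSpace ℝ (Fin (m + 1))) ℝ (n := m))).continuous.comp_continuousOn h2

/-- The signed coordinate expression of `β`, extended by zero, is a compactly supported `C¹` form on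
the whole vector space: the sign is locally constant, and the form vanishes off a compact subset of
the chart target. Stokes' theorem in the vector space applies to it. -/
theorem setIntegral_chartCoeff_exteriorDeriv_eq_zero {τ : DForm (𝓡 (m + 1)) (m + 1) X}
    (hτ : IsOrientation τ) {β : DForm (𝓡 (m + 1)) m X} (hβ : IsC1Form (𝓡 (m + 1)) β)
    {K : Set X} (hK : IsCompact K) [T2Space X] {j : X} (hKj : K ⊆ (extChartAt (𝓡 (m + 1)) j).source)
    (h0 : ∀ x, x ∉ K → β x = 0) :
    ∫ y in extChartAt (𝓡 (m + 1)) j '' K, chartSign τ j y *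
      chartCoeff (exteriorDeriv (𝓡 (m + 1)) β) j y = 0 := by
  classical
  set T := (extChartAt (𝓡 (m + 1)) j).target with hT
  have ho : IsOpen T := isOpen_target j
  set b := formPull (𝓡 (m + 1)) (extChartAt (𝓡 (m + 1)) j).symm T β with hb
  have hb1 : ContDiffOn ℝ 1 b T := hβ.contDiffOn_formPull ho.uniqueDiffOn (contMDiffOn_chart_symm j)
  set C := extChartAt (𝓡 (m + 1)) j '' K with hC
  have hCc : IsCompact C := hK.image_of_continuousOn ((continuousOn_extChartAt j).mono hKj)
  have hCT : C ⊆ T := by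
    rintro _ ⟨x, hx, rfl⟩
    exact (extChartAt (𝓡 (m + 1)) j).map_source (hKj hx)
  have hb0 : ∀ y ∈ T, y ∉ C → b y = 0 := by
    intro y hy hyC
    have : (extChartAt (𝓡 (m + 1)) j).symm y ∉ K := fun h =>
      hyC ⟨_, h, (extChartAt (𝓡 (m + 1)) j).right_inv hy⟩
    ext v
    change β _ _ = 0
    rw [h0 _ this]
    rfl
  let B : EuclideanSpace ℝ (Fin (m + 1)) → EuclideanSpace ℝ (Fin (m + 1)) [⋀^Fin m]→L[ℝ] ℝ :=
    fun y => if y ∈ T then chartSign τ j y • b y else 0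
  have hB0 : ∀ y, y ∉ C → B y = 0 := by
    intro y hy
    by_cases hyT : y ∈ T
    · simp only [B, if_pos hyT, hb0 y hyT hy, smul_zero]
    · simp only [B, if_neg hyT]
  have hBT : ∀ y ∈ T, B =ᶠ[𝓝 y] fun z => chartSign τ j y • b z := by
    intro y hy
    filter_upwards [hτ.eventually_chartSign_eq hy, ho.mem_nhds hy] with z hz hzT
    simp only [B, if_pos hzT, hz]
  have hBC : ∀ y, y ∉ C → B =ᶠ[𝓝 y] fun _ => 0 := fun y hy => by
    filter_upwards [hCc.isClosed.isOpen_compl.mem_nhds hy] with z hz using hB0 z hz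
  have hB1 : ContDiff ℝ 1 B := by
    rw [contDiff_iff_contDiffAt]
    intro y
    by_cases hy : y ∈ C
    · have h : ContDiffAt ℝ 1 (fun z => chartSign τ j y • b z) y :=
        (hb1.contDiffAt (ho.mem_nhds (hCT hy))).const_smul _
      exact h.congr_of_eventuallyEq (hBT y (hCT hy))
    · exact contDiffAt_const.congr_of_eventuallyEq (hBC y hy)
  have hBc : HasCompactSupport B := HasCompactSupport.intro hCc hB0
  refine Eq.trans ?_ ((setIntegral_eq_integral_of_forall_compl_eq_zero (μ := volume) (s := C)
    (f := fun y => extDeriv B y (stdFrame (m + 1))) ?_).trans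
    (integral_extDeriv_eq_zero hB1 hBc (stdFrame (m + 1))))
  · refine setIntegral_congr_fun hCc.measurableSet fun y hy => ?_
    rw [chartCoeff_exteriorDeriv hβ (hCT hy), (hBT y (hCT hy)).extDeriv_eq]
    exact (DFunLike.congr_fun (extDeriv_smul (chartSign τ j y) b) (stdFrame (m + 1))).symm
  · intro y hy
    rw [(hBC y hy).extDeriv_eq, extDeriv, fderiv_fun_const]
    exact DFunLike.congr_fun (map_zero (ContinuousAlternatingMap.alternatizeUncurryFinCLM ℝ
      (EuclideanSpace ℝ (Fin (m + 1))) ℝ (n := m))) _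

variable [T2Space X] [SigmaCompactSpace X]

/-- The integral of a form supported in the domain of a chart. -/
theorem integralForm_eq_setIntegral_of_subset_source {n : ℕ} {X : Type*} [TopologicalSpace X]
    [ChartedSpace (EuclideanSpace ℝ (Fin n)) X] [IsManifold (𝓡 n) ∞ X] [T2Space X]
    [SigmaCompactSpace X] {τ : DForm (𝓡 n) n X} (hτ : IsOrientation τ) {η : DForm (𝓡 n) n X}
    {S K : Set X} (hS : IsCompact S) (hK : IsCompact K) (hKS : K ⊆ S) {j : X}
    (hKj : K ⊆ (extChartAt (𝓡 n) j).source)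
    (hη : ContinuousOn (chartCoeff η j) (extChartAt (𝓡 n) j).target)
    (hη0 : ∀ x, x ∉ K → η x = 0) :
    integralForm τ S η = ∫ y in extChartAt (𝓡 n) j '' K, chartSign τ j y * chartCoeff η j y := by
  have hη0' : ∀ (i : X) y, (extChartAt (𝓡 n) i).symm y ∉ K → chartCoeff η i y = 0 := by
    intro i y hy
    rw [chartCoeff, hη0 _ hy]
    rfl
  have hCc : IsCompact (extChartAt (𝓡 n) j '' K) :=
    hK.image_of_continuousOn ((continuousOn_extChartAt j).mono hKj)
  have hCT : ∀ y ∈ extChartAt (𝓡 n) j '' K, y ∈ (extChartAt (𝓡 n) j).target ∧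
      (extChartAt (𝓡 n) j).symm y ∈ K := by
    rintro _ ⟨x, hx, rfl⟩
    exact ⟨(extChartAt (𝓡 n) j).map_source (hKj hx), by
      rwa [(extChartAt (𝓡 n) j).left_inv (hKj hx)]⟩
  rw [integralForm_eq_sum τ hS]
  -- All terms are transported to the single chart at `j`; there the partition functions add up to
  -- `1` on `K`.
  have hterm : ∀ i : X, ∫ y in chartPart S i, integralPartition n X i
        ((extChartAt (𝓡 n) i).symm y) * (chartSign τ i y * chartCoeff η i y) =
      ∫ y in extChartAt (𝓡 n) j '' K, integralPartition n X i
        ((extChartAt (𝓡 n) j).symm y) * (chartSign τ j y * chartCoeff η j y) := by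
    intro i
    have hsrc := tsupport_integralPartition_subset (n := n) (X := X) i
    have hBc : IsCompact (K ∩ tsupport (integralPartition n X i)) :=
      hK.inter_right (isClosed_tsupport _)
    refine Eq.trans ?_ ((setIntegral_chart_change (τ := τ) η i j hBc (inter_subset_right.trans hsrc)
      (inter_subset_left.trans hKj) (integralPartition n X i)).trans ?_)
    · refine setIntegral_eq_of_subset_of_forall_sdiff_eq_zero
        (isCompact_chartPart hS i).measurableSet (image_mono (inter_subset_inter_left _ hKS)) ?_
      rintro _ ⟨⟨x, hx, rfl⟩, hx'⟩
      rw [hη0', mul_zero, mul_zero]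
      rw [(extChartAt (𝓡 n) i).left_inv (hsrc hx.2)]
      exact fun h => hx' ⟨x, ⟨h, hx.2⟩, rfl⟩
    · refine (setIntegral_eq_of_subset_of_forall_sdiff_eq_zero hCc.measurableSet
        (image_mono inter_subset_left) ?_).symm
      rintro _ ⟨⟨x, hx, rfl⟩, hx'⟩
      rw [(extChartAt (𝓡 n) j).left_inv (hKj hx)]
      have : integralPartition n X i x = 0 := by
        by_contra h
        exact hx' ⟨x, ⟨hx, subset_tsupport _ h⟩, rfl⟩
      rw [this, zero_mul]
  rw [Finset.sum_congr rfl fun i _ => hterm i, ← integral_finsetSum]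
  · refine setIntegral_congr_fun hCc.measurableSet fun y hy => ?_
    rw [← Finset.sum_mul, sum_integralPartition_eq_one hS (hKS (hCT y hy).2), one_mul]
  · intro i _
    refine ContinuousOn.integrableOn_compact hCc ?_
    have hsub : extChartAt (𝓡 n) j '' K ⊆ (extChartAt (𝓡 n) j).target :=
      fun y hy => (hCT y hy).1
    refine ContinuousOn.mul ?_ (((hτ.continuousOn_chartSign j).mono hsub).mul
      (hη.mono hsub))
    exact (integralPartition n X i).contMDiff.continuous.comp_continuousOn
      ((continuousOn_extChartAt_symm j).mono hsub)

theorem integralForm_exteriorDeriv_of_subset_source {τ : DForm (𝓡 (m + 1)) (m + 1) X}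
    (hτ : IsOrientation τ) {β : DForm (𝓡 (m + 1)) m X} (hβ : IsC1Form (𝓡 (m + 1)) β)
    {S K : Set X} (hS : IsCompact S) (hK : IsCompact K) (hKS : K ⊆ S) {j : X}
    (hKj : K ⊆ (extChartAt (𝓡 (m + 1)) j).source)
    (h0 : ∀ x, x ∉ K → β x = 0) :
    integralForm τ S (exteriorDeriv (𝓡 (m + 1)) β) = 0 := by
  rw [integralForm_eq_setIntegral_of_subset_source hτ hS hK hKS hKj
    (continuousOn_chartCoeff_exteriorDeriv hβ j)]
  · exact setIntegral_chartCoeff_exteriorDeriv_eq_zero hτ hβ hK hKj h0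
  · exact fun x hx => exteriorDeriv_eq_zero_of_eventually
      (by filter_upwards [hK.isClosed.isOpen_compl.mem_nhds hx] with z hz using h0 z hz)

/-- Stokes' theorem for a form that vanishes outside a compact set. -/
theorem integralForm_exteriorDeriv_eq_zero {τ : DForm (𝓡 (m + 1)) (m + 1) X}
    (hτ : IsOrientation τ) {β : DForm (𝓡 (m + 1)) m X} (hβ : IsC1Form (𝓡 (m + 1)) β)
    {S : Set X} (hS : IsCompact S) (h0 : ∀ x, x ∉ S → β x = 0) :
    integralForm τ S (exteriorDeriv (𝓡 (m + 1)) β) = 0 := by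
  set t := (finite_integralPartition (n := m + 1) hS).toFinset with ht
  -- `β` is cut into pieces each supported in one chart. The functions with index in `t` are known
  -- to sum to `1` on `S` only, but `β` is zero elsewhere.
  let βj : X → DForm (𝓡 (m + 1)) m X := fun j x => integralPartition (m + 1) X j x • β x
  have hβj : ∀ j, IsC1Form (𝓡 (m + 1)) (βj j) := fun j =>
    hβ.smul (integralPartition (m + 1) X j).contMDiff
  have hsum : β = fun x => ∑ j ∈ t, βj j x := by
    funext x
    by_cases hx : x ∈ S
    · simp only [βj]
      rw [← Finset.sum_smul, sum_integralPartition_eq_one hS hx, one_smul]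
    · simp only [βj, h0 x hx, smul_zero, Finset.sum_const_zero]
  have hsum' : ∀ i y, chartCoeff (exteriorDeriv (𝓡 (m + 1)) β) i y =
      ∑ j ∈ t, chartCoeff (exteriorDeriv (𝓡 (m + 1)) (βj j)) i y := by
    intro i y
    have h1 : exteriorDeriv (𝓡 (m + 1)) β ((extChartAt (𝓡 (m + 1)) i).symm y) = _ :=
      (congrArg (fun b => exteriorDeriv (𝓡 (m + 1)) b ((extChartAt (𝓡 (m + 1)) i).symm y)) hsum).trans
        (exteriorDeriv_sum t (fun j _ => hβj j) _)
    rw [chartCoeff, h1]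
    exact map_sum (ContinuousAlternatingMap.apply ℝ _ ℝ (coordFrame i y)) _ _
  rw [integralForm_eq_sum τ hS]
  simp only [hsum', Finset.mul_sum]
  have hint : ∀ i, ∫ y in chartPart S i, ∑ j ∈ t, integralPartition (m + 1) X i
        ((extChartAt (𝓡 (m + 1)) i).symm y) * (chartSign τ i y *
          chartCoeff (exteriorDeriv (𝓡 (m + 1)) (βj j)) i y) =
      ∑ j ∈ t, ∫ y in chartPart S i, integralPartition (m + 1) X i
        ((extChartAt (𝓡 (m + 1)) i).symm y) * (chartSign τ i y *
          chartCoeff (exteriorDeriv (𝓡 (m + 1)) (βj j)) i y) := by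
    intro i
    rw [integral_finsetSum]
    intro j _
    refine ContinuousOn.integrableOn_compact (isCompact_chartPart hS i) ?_
    have hsub : chartPart S i ⊆ (extChartAt (𝓡 (m + 1)) i).target :=
      fun y hy => (mem_of_mem_chartPart hy).1
    refine ContinuousOn.mul ?_ (((hτ.continuousOn_chartSign i).mono hsub).mul
      ((continuousOn_chartCoeff_exteriorDeriv (hβj j) i).mono hsub))
    exact (integralPartition (m + 1) X i).contMDiff.continuous.comp_continuousOn
      ((continuousOn_extChartAt_symm i).mono hsub)
  rw [Finset.sum_congr rfl fun i _ => hint i, Finset.sum_comm]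
  refine Finset.sum_eq_zero fun j _ => ?_
  rw [← integralForm_eq_sum τ hS]
  refine integralForm_exteriorDeriv_of_subset_source hτ (hβj j) hS
    (K := S ∩ tsupport (integralPartition (m + 1) X j))
    (hS.inter_right (isClosed_tsupport _)) inter_subset_left
    (inter_subset_right.trans (tsupport_integralPartition_subset j)) fun x hx => ?_
  simp only [βj]
  by_cases hxS : x ∈ S
  · have : integralPartition (m + 1) X j x = 0 := by
      by_contra h
      exact hx ⟨hxS, subset_tsupport _ h⟩
    rw [this, zero_smul]
  · rw [h0 x hxS, smul_zero]

end Stokes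

/-! ### The first variation of the integral of a form -/

section Variation

/-- Dominated convergence for one-sided difference quotients: by the mean value inequality they are
bounded by the maximum of the derivative on the compact set `[0, 1] × C`. -/
theorem hasDerivWithinAt_setIntegral {E : Type*} [NormedAddCommGroup E] [MeasurableSpace E]
    [BorelSpace E] (ν : Measure E) [IsFiniteMeasureOnCompacts ν] {C : Set E} (hC : IsCompact C)
    {a a' : ℝ → E → ℝ} (ha : ∀ s, 0 ≤ s → ∀ y ∈ C, HasDerivWithinAt (a · y) (a' s y) (Ici 0) s)
    (hac : ∀ s, 0 ≤ s → ContinuousOn (a s) C)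
    (ha' : ContinuousOn (Function.uncurry a') (Icc 0 1 ×ˢ C)) :
    HasDerivWithinAt (fun s => ∫ y in C, a s y ∂ν) (∫ y in C, a' 0 y ∂ν) (Ici 0) 0 := by
  obtain ⟨b, hb⟩ := (isCompact_Icc.prod hC).exists_bound_of_continuousOn ha'
  have hint : ∀ s, 0 ≤ s → IntegrableOn (a s) C ν := fun s hs => (hac s hs).integrableOn_compact hC
  rw [hasDerivWithinAt_iff_tendsto_slope, Ici_sdiff_left]
  have heq : (fun s => ∫ y in C, slope (a · y) 0 s ∂ν) =ᶠ[𝓝[>] 0]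
      slope (fun s => ∫ y in C, a s y ∂ν) 0 := by
    filter_upwards [self_mem_nhdsWithin] with s hs
    simp only [slope_def_module]
    rw [integral_smul, integral_sub (hint s hs.le) (hint 0 le_rfl)]
  refine Tendsto.congr' heq ?_
  refine tendsto_integral_filter_of_dominated_convergence (fun _ => b) ?_ ?_ ?_ ?_
  · filter_upwards [self_mem_nhdsWithin] with s hs
    simp only [slope_def_module]
    exact (((hint s hs.le).sub (hint 0 le_rfl)).smul (s - 0)⁻¹).aestronglyMeasurable
  · filter_upwards [Ioc_mem_nhdsGT (zero_lt_one (α := ℝ))] with s hs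
    refine (ae_restrict_iff' hC.measurableSet).2 (Eventually.of_forall fun y hy => ?_)
    have h := (convex_Icc (0 : ℝ) 1).norm_image_sub_le_of_norm_hasDerivWithin_le
      (f := (a · y)) (f' := (a' · y)) (C := b)
      (fun t ht => (ha t ht.1 y hy).mono Icc_subset_Ici_self) (fun t ht => hb (t, y) ⟨ht, hy⟩)
      (left_mem_Icc.2 zero_le_one) (Ioc_subset_Icc_self hs)
    simp only [slope_def_module, sub_zero, norm_smul, norm_inv] at h ⊢
    rw [inv_mul_le_iff₀ (norm_pos_iff.2 hs.1.ne'), mul_comm]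
    exact h
  · exact (integrableOn_const hC.measure_lt_top.ne)
  · refine (ae_restrict_iff' hC.measurableSet).2 (Eventually.of_forall fun y hy => ?_)
    have h := ha 0 le_rfl y hy
    rwa [hasDerivWithinAt_iff_tendsto_slope, Ici_sdiff_left] at h

variable {E : Type*} [NormedAddCommGroup E] [NormedSpace ℝ E] {m : ℕ}

/-- The contraction with `∂/∂s`, restricted to a slice, of a form on `ℝ × E`. -/
def contractTime : ((ℝ × E) [⋀^Fin (m + 1)]→L[ℝ] ℝ) →L[ℝ] (E [⋀^Fin m]→L[ℝ] ℝ) :=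
  (ContinuousAlternatingMap.compContinuousLinearMapCLM (ContinuousLinearMap.inr ℝ ℝ E)).comp
    ((ContinuousLinearMap.apply ℝ _ ((1 : ℝ), (0 : E))).comp
      (ContinuousAlternatingMap.curryLeftLI (𝕜 := ℝ) (E := ℝ × E) (F := ℝ) (n := m)).toContinuousLinearMap)

theorem contractTime_apply (a : (ℝ × E) [⋀^Fin (m + 1)]→L[ℝ] ℝ) (v : Fin m → E) :
    contractTime a v = a (Fin.cons (1, 0) fun j => (0, v j)) := rfl

/-- Cartan's formula for `∂/∂s` on `ℝ × E`, restricted to `s = 0`. In the alternating sum for `dA`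
on `(∂/∂s, v)` the first term is the time derivative. The others have their index shifted by one
with respect to the sum for the contracted form, hence opposite signs, and cancel against it. -/
theorem extDerivWithin_cons_time {A : ℝ × E → (ℝ × E) [⋀^Fin (m + 1)]→L[ℝ] ℝ} {T : Set E}
    (hT : IsOpen T) (hA : ContDiffOn ℝ 1 A (Ici 0 ×ˢ T)) {y : E} (hy : y ∈ T)
    (v : Fin (m + 1) → E) :
    fderivWithin ℝ A (Ici 0 ×ˢ T) (0, y) (1, 0) (fun j => (0, v j)) =
      extDerivWithin A (Ici 0 ×ˢ T) (0, y) (Fin.cons (1, 0) fun j => (0, v j)) +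
        extDeriv (fun z => contractTime (A (0, z))) y v := by
  have hD : UniqueDiffOn ℝ (Ici (0 : ℝ) ×ˢ T) := (uniqueDiffOn_Ici 0).prod hT.uniqueDiffOn
  have hmem : ((0 : ℝ), y) ∈ Ici (0 : ℝ) ×ˢ T := ⟨self_mem_Ici, hy⟩
  have hd : DifferentiableWithinAt ℝ A (Ici 0 ×ˢ T) (0, y) := hA.differentiableOn one_ne_zero _ hmem
  have hB : HasFDerivAt (fun z => contractTime (A (0, z)))
      ((contractTime.comp (fderivWithin ℝ A (Ici 0 ×ˢ T) (0, y))).comp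
        (ContinuousLinearMap.inr ℝ ℝ E)) y := by
    have h1 : HasFDerivWithinAt (fun z : E => ((0 : ℝ), z)) (ContinuousLinearMap.inr ℝ ℝ E) T y :=
      (hasFDerivAt_prodMk_right (0 : ℝ) y).hasFDerivWithinAt
    have h2 := hd.hasFDerivWithinAt.comp y h1 (fun z hz => ⟨self_mem_Ici, hz⟩)
    exact (contractTime.hasFDerivAt.comp_hasFDerivWithinAt y h2).hasFDerivAt (hT.mem_nhds hy)
  have hr : ∀ i : Fin (m + 1), i.succ.removeNth (Fin.cons ((1 : ℝ), (0 : E)) fun j => ((0 : ℝ), v j) :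
      Fin (m + 2) → ℝ × E) = Fin.cons (1, 0) fun j => (0, i.removeNth v j) := fun i =>
    Fin.cons_comp_succ_succAbove _ _ i
  rw [extDerivWithin, extDeriv, hB.fderiv]
  simp only [ContinuousAlternatingMap.alternatizeUncurryFin_apply]
  rw [Fin.sum_univ_succ, add_assoc, ← Finset.sum_add_distrib, Finset.sum_eq_zero, add_zero]
  · simp
  · intro i _
    rw [hr, Fin.cons_succ, Fin.val_succ, pow_succ]
    simp [contractTime_apply]

variable {F H : Type*} [NormedAddCommGroup F] [NormedSpace ℝ F] [TopologicalSpace H]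
  {J : ModelWithCorners ℝ F H} {M : Type*} [TopologicalSpace M] [ChartedSpace H M]
  {n : ℕ} {X : Type*} [TopologicalSpace X] [ChartedSpace (EuclideanSpace ℝ (Fin n)) X]

/-- The pull-back by `γ` of the contraction of a form with a vector field along `γ`. -/
def contractAlong {r : ℕ} (γ : X → M) (ξ : X → F) (β : DForm J (r + 1) M) : DForm (𝓡 n) r X :=
  fun x => ContinuousAlternatingMap.compContinuousLinearMap
    (ContinuousAlternatingMap.curryLeft (E := F) (β (γ x)) (ξ x)) (mfderiv (𝓡 n) J γ x)

theorem contractAlong_apply {r : ℕ} (γ : X → M) (ξ : X → F) (β : DForm J (r + 1) M) (x : X)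
    (v : Fin r → TangentSpace (𝓡 n) x) :
    contractAlong γ ξ β x v =
      β (γ x) (Fin.cons (ξ x) fun j => mfderiv (𝓡 n) J γ x (v j)) := rfl

variable (J) in
/-- The initial velocity of a variation `(Φ_s)_{s ≥ 0}`. -/
def initialVelocity {X : Type*} (Φ : ℝ → X → M) (x : X) : F :=
  mfderivWithin 𝓘(ℝ, ℝ) J (fun s => Φ s x) (Ici 0) 0 (1 : ℝ)

theorem initialVelocity_eq_zero {X : Type*} {Φ : ℝ → X → M} {x : X} (h : ∀ s, 0 ≤ s → Φ s x = Φ 0 x) :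
    initialVelocity J Φ x = 0 := by
  have h1 : mfderivWithin 𝓘(ℝ, ℝ) J (fun s => Φ s x) (Ici 0) 0 =
      mfderivWithin 𝓘(ℝ, ℝ) J (fun _ => Φ 0 x) (Ici 0) 0 :=
    mfderivWithin_congr (fun s hs => h s hs) rfl
  have h2 : mfderivWithin 𝓘(ℝ, ℝ) J (fun _ : ℝ => Φ 0 x) (Ici 0) 0 = 0 := mfderivWithin_const
  exact DFunLike.congr_fun (h1.trans h2) (1 : ℝ)

/-- A variation in the chart at `i`. -/
def chartVariation (Φ : ℝ → X → M) (i : X) (a : ℝ × EuclideanSpace ℝ (Fin n)) : M :=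
  Φ a.1 ((extChartAt (𝓡 n) i).symm a.2)

variable (n) in
/-- The domain of `chartVariation`. -/
def variationDomain (i : X) : Set (ℝ × EuclideanSpace ℝ (Fin n)) :=
  Ici 0 ×ˢ (extChartAt (𝓡 n) i).target

theorem uniqueDiffOn_variationDomain (i : X) : UniqueDiffOn ℝ (variationDomain n i) :=
  (uniqueDiffOn_Ici 0).prod (isOpen_target i).uniqueDiffOn

/-- Lets naturality of `d` reach the initial slice `s = 0`, which lies on the boundary of the
domain. -/
theorem variationDomain_subset_closure_interior (i : X) :
    variationDomain n i ⊆ closure (interior (variationDomain n i)) := by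
  rw [variationDomain, interior_prod_eq, interior_Ici, (isOpen_target i).interior_eq,
    closure_prod_eq, closure_Ioi]
  exact prod_mono_right subset_closure

/-- A smooth variation `(Φ_s)_{s ≥ 0}` of maps. -/
abbrev IsSmoothVariation (n : ℕ) [ChartedSpace (EuclideanSpace ℝ (Fin n)) X]
    (J : ModelWithCorners ℝ F H) (Φ : ℝ → X → M) : Prop :=
  ContMDiffOn (𝓘(ℝ, ℝ).prod (𝓡 n)) J ∞ (fun a : ℝ × X => Φ a.1 a.2) (Ici 0 ×ˢ univ)

theorem IsSmoothVariation.contMDiff {Φ : ℝ → X → M} (hΦ : IsSmoothVariation n J Φ) {s : ℝ} (hs : 0 ≤ s) : ContMDiff (𝓡 n) J ∞ (Φ s) := by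
  rw [← contMDiffOn_univ]
  have h : ContMDiffOn (𝓡 n) (𝓘(ℝ, ℝ).prod (𝓡 n)) ∞ (fun x : X => (s, x)) univ :=
    (contMDiff_const.prodMk contMDiff_id).contMDiffOn
  exact ContMDiffOn.comp (g := fun a : ℝ × X => Φ a.1 a.2) hΦ h fun x _ => ⟨hs, mem_univ _⟩

variable [IsManifold (𝓡 n) ∞ X] {Φ : ℝ → X → M}

theorem IsSmoothVariation.contMDiffOn_chartVariation (hΦ : IsSmoothVariation n J Φ) (i : X) :
    ContMDiffOn 𝓘(ℝ, ℝ × EuclideanSpace ℝ (Fin n)) J ∞ (chartVariation Φ i)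
      (variationDomain n i) := by
  have h2 : ContMDiffOn 𝓘(ℝ, ℝ × EuclideanSpace ℝ (Fin n)) (𝓡 n) ∞
      (fun a : ℝ × EuclideanSpace ℝ (Fin n) => (extChartAt (𝓡 n) i).symm a.2)
      (variationDomain n i) :=
    (contMDiffOn_chart_symm i).comp (contMDiff_iff_contDiff.2 contDiff_snd).contMDiffOn
      fun a ha => ha.2
  have h1 : ContMDiffOn 𝓘(ℝ, ℝ × EuclideanSpace ℝ (Fin n)) 𝓘(ℝ, ℝ) ∞
      (fun a : ℝ × EuclideanSpace ℝ (Fin n) => a.1) (variationDomain n i) :=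
    (contMDiff_iff_contDiff.2 contDiff_fst).contMDiffOn
  exact ContMDiffOn.comp hΦ (h1.prodMk h2) fun a ha => ⟨ha.1, mem_univ _⟩

theorem IsSmoothVariation.mfderivWithin_inr (hΦ : IsSmoothVariation n J Φ) (i : X) {s : ℝ} (hs : 0 ≤ s)
    {y : EuclideanSpace ℝ (Fin n)} (hy : y ∈ (extChartAt (𝓡 n) i).target)
    (v : EuclideanSpace ℝ (Fin n)) :
    (mfderivWithin 𝓘(ℝ, ℝ × EuclideanSpace ℝ (Fin n)) J (chartVariation Φ i)
      (variationDomain n i) (s, y) (0, v) : F) =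
      mfderiv (𝓡 n) J (Φ s) ((extChartAt (𝓡 n) i).symm y)
        (mfderiv 𝓘(ℝ, EuclideanSpace ℝ (Fin n)) (𝓡 n) (extChartAt (𝓡 n) i).symm y v) := by
  have hG := ((hΦ.contMDiffOn_chartVariation i (s, y) ⟨hs, hy⟩).mdifferentiableWithinAt
    (by simp)).hasMFDerivWithinAt
  have h1 : HasMFDerivWithinAt 𝓘(ℝ, EuclideanSpace ℝ (Fin n))
      𝓘(ℝ, ℝ × EuclideanSpace ℝ (Fin n)) (fun z : EuclideanSpace ℝ (Fin n) => (s, z))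
      (extChartAt (𝓡 n) i).target y (ContinuousLinearMap.inr ℝ ℝ (EuclideanSpace ℝ (Fin n))) :=
    (hasFDerivAt_prodMk_right s y).hasFDerivWithinAt.hasMFDerivWithinAt
  have h2 := hG.comp y h1 fun z hz => ⟨hs, hz⟩
  have h3 := (((hΦ.contMDiff hs).mdifferentiable (by simp)
    ((extChartAt (𝓡 n) i).symm y)).hasMFDerivAt.comp_hasMFDerivWithinAt y
    ((contMDiffOn_chart_symm i y hy).mdifferentiableWithinAt (by simp)).hasMFDerivWithinAt)
  have h4 := UniqueMDiffWithinAt.eq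
    ((isOpen_target i).uniqueDiffWithinAt hy).uniqueMDiffWithinAt h2 h3
  have h5 := DFunLike.congr_fun h4 v
  rw [← mfderivWithin_of_isOpen (isOpen_target i) hy]
  exact h5

theorem IsSmoothVariation.mfderivWithin_inl (hΦ : IsSmoothVariation n J Φ) (i : X) {y : EuclideanSpace ℝ (Fin n)}
    (hy : y ∈ (extChartAt (𝓡 n) i).target) :
    (mfderivWithin 𝓘(ℝ, ℝ × EuclideanSpace ℝ (Fin n)) J (chartVariation Φ i)
      (variationDomain n i) (0, y) (1, 0) : F) =
      initialVelocity J Φ ((extChartAt (𝓡 n) i).symm y) := by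
  have hG := ((hΦ.contMDiffOn_chartVariation i (0, y) ⟨self_mem_Ici, hy⟩).mdifferentiableWithinAt
    (by simp)).hasMFDerivWithinAt
  have h1 : HasMFDerivWithinAt 𝓘(ℝ, ℝ)
      𝓘(ℝ, ℝ × EuclideanSpace ℝ (Fin n)) (fun s : ℝ => (s, y))
      (Ici 0) 0 (ContinuousLinearMap.inl ℝ ℝ (EuclideanSpace ℝ (Fin n))) :=
    (hasFDerivAt_prodMk_left (0 : ℝ) y).hasFDerivWithinAt.hasMFDerivWithinAt
  have hs : MapsTo (fun s : ℝ => (s, y)) (Ici 0) (variationDomain n i) := fun z hz => ⟨hz, hy⟩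
  have h2 := hG.comp (0 : ℝ) h1 hs
  have h5 := DFunLike.congr_fun
    (h2.mfderivWithin ((uniqueDiffOn_Ici (0 : ℝ)) 0 self_mem_Ici).uniqueMDiffWithinAt) (1 : ℝ)
  exact h5.symm

theorem IsSmoothVariation.formPull_apply_inr (hΦ : IsSmoothVariation n J Φ) {r : ℕ} (β : DForm J r M) (i : X) {s : ℝ} (hs : 0 ≤ s)
    {y : EuclideanSpace ℝ (Fin n)} (hy : y ∈ (extChartAt (𝓡 n) i).target)
    (v : Fin r → EuclideanSpace ℝ (Fin n)) :
    formPull J (chartVariation Φ i) (variationDomain n i) β (s, y) (fun j => (0, v j)) =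
      pullbackForm (J := 𝓡 n) (Φ s) β ((extChartAt (𝓡 n) i).symm y)
        (fun j => mfderiv 𝓘(ℝ, EuclideanSpace ℝ (Fin n)) (𝓡 n) (extChartAt (𝓡 n) i).symm y (v j)) := by
  change β (Φ s ((extChartAt (𝓡 n) i).symm y)) _ = β (Φ s ((extChartAt (𝓡 n) i).symm y)) _
  congr 1
  funext j
  exact hΦ.mfderivWithin_inr i hs hy (v j)

theorem IsSmoothVariation.formPull_apply_cons (hΦ : IsSmoothVariation n J Φ) {r : ℕ} (β : DForm J (r + 1) M) (i : X)
    {y : EuclideanSpace ℝ (Fin n)} (hy : y ∈ (extChartAt (𝓡 n) i).target)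
    (v : Fin r → EuclideanSpace ℝ (Fin n)) :
    formPull J (chartVariation Φ i) (variationDomain n i) β (0, y)
        (Fin.cons (1, 0) fun j => (0, v j)) =
      contractAlong (Φ 0) (initialVelocity J Φ) β ((extChartAt (𝓡 n) i).symm y)
        (fun j => mfderiv 𝓘(ℝ, EuclideanSpace ℝ (Fin n)) (𝓡 n) (extChartAt (𝓡 n) i).symm y (v j)) := by
  rw [contractAlong_apply]
  change β (Φ 0 ((extChartAt (𝓡 n) i).symm y)) _ = β (Φ 0 ((extChartAt (𝓡 n) i).symm y)) _
  congr 1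
  funext j
  refine Fin.cases ?_ (fun j => ?_) j
  · exact hΦ.mfderivWithin_inl i hy
  · exact hΦ.mfderivWithin_inr i le_rfl hy (v j)

/-- The variation carries `∂/∂s` at `s = 0` to the initial velocity. This translates Cartan's
formula on `ℝ × E` into a statement about forms on `X`. -/
theorem IsSmoothVariation.contractTime_formPull (hΦ : IsSmoothVariation n J Φ) {r : ℕ} (β : DForm J (r + 1) M) (i : X)
    {y : EuclideanSpace ℝ (Fin n)} (hy : y ∈ (extChartAt (𝓡 n) i).target) :
    contractTime (formPull J (chartVariation Φ i) (variationDomain n i) β (0, y)) =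
      formPull (𝓡 n) (extChartAt (𝓡 n) i).symm (extChartAt (𝓡 n) i).target
        (contractAlong (Φ 0) (initialVelocity J Φ) β) y := by
  ext v
  rw [contractTime_apply, hΦ.formPull_apply_cons β i hy, formPull,
    mfderivWithin_of_isOpen (isOpen_target i) hy]
  rfl

end Variation

/-! ### The first variation formula. -/

section FirstVariation

variable {F H : Type*} [NormedAddCommGroup F] [NormedSpace ℝ F] [TopologicalSpace H]
  {J : ModelWithCorners ℝ F H} {M : Type*} [TopologicalSpace M] [ChartedSpace H M]
  {m : ℕ} {X : Type*} [TopologicalSpace X] [ChartedSpace (EuclideanSpace ℝ (Fin (m + 1))) X]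
  [IsManifold (𝓡 (m + 1)) ∞ X] {Φ : ℝ → X → M} {α : DForm J (m + 1) M}
  {μ : DForm J (m + 1 + 1) M}

theorem IsExteriorDerivative.contDiffOn_contractTime (hα : IsExteriorDerivative J α μ)
    (hΦ : IsSmoothVariation (m + 1) J Φ) (i : X) :
    ContDiffOn ℝ 1 (fun z => contractTime (formPull J (chartVariation Φ i)
      (variationDomain (m + 1) i) α (0, z))) (extChartAt (𝓡 (m + 1)) i).target := by
  have hA := hα.contDiffOn _ _ (uniqueDiffOn_variationDomain i) (hΦ.contMDiffOn_chartVariation i)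
  exact contractTime.contDiff.comp_contDiffOn (hA.comp
    (f := fun z : EuclideanSpace ℝ (Fin (m + 1)) => ((0 : ℝ), z))
    (contDiff_const.prodMk contDiff_id).contDiffOn fun z hz => ⟨self_mem_Ici, hz⟩)

/-- In a chart the form is the contraction with the constant field `∂/∂s` of a `C¹` form, so the
regularity of the velocity field need not be examined separately. -/
theorem IsExteriorDerivative.isC1Form_contractAlong (hα : IsExteriorDerivative J α μ)
    (hΦ : IsSmoothVariation (m + 1) J Φ) :
    IsC1Form (𝓡 (m + 1)) (contractAlong (Φ 0) (initialVelocity J Φ) α) := by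
  intro i
  refine (hα.contDiffOn_contractTime hΦ i).congr fun y hy => ?_
  rw [hΦ.contractTime_formPull α i hy, formPull, formPull,
    mfderivWithin_of_isOpen (isOpen_target i) hy, (𝓡 (m + 1)).range_eq_univ, mfderivWithin_univ]

theorem IsExteriorDerivative.chartCoeff_add (hα : IsExteriorDerivative J α μ)
    (hΦ : IsSmoothVariation (m + 1) J Φ) (i : X) {y : EuclideanSpace ℝ (Fin (m + 1))}
    (hy : y ∈ (extChartAt (𝓡 (m + 1)) i).target) :
    fderivWithin ℝ (formPull J (chartVariation Φ i) (variationDomain (m + 1) i) α)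
        (variationDomain (m + 1) i) (0, y) (1, 0) (fun j => (0, stdFrame (m + 1) j)) =
      chartCoeff (contractAlong (Φ 0) (initialVelocity J Φ) μ) i y +
        chartCoeff (exteriorDeriv (𝓡 (m + 1)) (contractAlong (Φ 0) (initialVelocity J Φ) α)) i y := by
  have hG := hΦ.contMDiffOn_chartVariation i
  have hA := hα.contDiffOn _ _ (uniqueDiffOn_variationDomain i) hG
  refine (extDerivWithin_cons_time (isOpen_target i) hA hy (stdFrame (m + 1))).trans ?_
  have h1 := hα.extDerivWithin_eq _ _ (uniqueDiffOn_variationDomain i)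
    (variationDomain_subset_closure_interior i) hG (0, y) ⟨self_mem_Ici, hy⟩
  congr 1
  · refine (DFunLike.congr_fun h1 _).trans ?_
    exact hΦ.formPull_apply_cons μ i hy (stdFrame (m + 1))
  · rw [chartCoeff_exteriorDeriv (hα.isC1Form_contractAlong hΦ) hy]
    refine DFunLike.congr_fun (Filter.EventuallyEq.extDeriv_eq ?_) _
    filter_upwards [(isOpen_target i).mem_nhds hy] with z hz using hΦ.contractTime_formPull α i hz

theorem IsExteriorDerivative.continuousOn_deriv (hα : IsExteriorDerivative J α μ)
    (hΦ : IsSmoothVariation (m + 1) J Φ) (i : X) (v : Fin (m + 1) → ℝ × EuclideanSpace ℝ (Fin (m + 1))) :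
    ContinuousOn (fun a => fderivWithin ℝ (formPull J (chartVariation Φ i)
      (variationDomain (m + 1) i) α) (variationDomain (m + 1) i) a (1, 0) v)
      (variationDomain (m + 1) i) := by
  have hA := hα.contDiffOn _ _ (uniqueDiffOn_variationDomain i) (hΦ.contMDiffOn_chartVariation i)
  exact (ContinuousAlternatingMap.apply ℝ _ ℝ v).continuous.comp_continuousOn
    ((hA.continuousOn_fderivWithin (uniqueDiffOn_variationDomain i) le_rfl).clm_apply
      continuousOn_const)

/-- `μ` is not assumed continuous. By Cartan's formula the coefficient is the difference of a time
derivative and the coefficient of an exterior derivative, both of `C¹` forms. -/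
theorem IsExteriorDerivative.continuousOn_chartCoeff_contractAlong
    (hα : IsExteriorDerivative J α μ) (hΦ : IsSmoothVariation (m + 1) J Φ) (i : X) :
    ContinuousOn (chartCoeff (contractAlong (Φ 0) (initialVelocity J Φ) μ) i)
      (extChartAt (𝓡 (m + 1)) i).target := by
  have h1 : ContinuousOn (fun y : EuclideanSpace ℝ (Fin (m + 1)) => ((0 : ℝ), y))
      (extChartAt (𝓡 (m + 1)) i).target := (Continuous.prodMk_right 0).continuousOn
  have h2 := (hα.continuousOn_deriv hΦ i fun j => (0, stdFrame (m + 1) j)).comp h1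
    fun y hy => ⟨self_mem_Ici, hy⟩
  refine (h2.sub (continuousOn_chartCoeff_exteriorDeriv (hα.isC1Form_contractAlong hΦ) i)).congr
    fun y hy => ?_
  exact eq_sub_of_add_eq (hα.chartCoeff_add hΦ i hy).symm

variable [T2Space X] [SigmaCompactSpace X]

theorem IsExteriorDerivative.hasDerivWithinAt_chartPart (hα : IsExteriorDerivative J α μ)
    (hΦ : IsSmoothVariation (m + 1) J Φ) {τ : DForm (𝓡 (m + 1)) (m + 1) X} (hτ : IsOrientation τ)
    {S : Set X} (hS : IsCompact S) (i : X) :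
    HasDerivWithinAt (fun s => ∫ y in chartPart S i,
        integralPartition (m + 1) X i ((extChartAt (𝓡 (m + 1)) i).symm y) * (chartSign τ i y *
          chartCoeff (pullbackForm (Φ s) α) i y))
      (∫ y in chartPart S i,
        integralPartition (m + 1) X i ((extChartAt (𝓡 (m + 1)) i).symm y) * (chartSign τ i y *
          (chartCoeff (contractAlong (Φ 0) (initialVelocity J Φ) μ) i y +
        chartCoeff (exteriorDeriv (𝓡 (m + 1)) (contractAlong (Φ 0) (initialVelocity J Φ) α)) i y)))
      (Ici 0) 0 := by
  set A := formPull J (chartVariation Φ i) (variationDomain (m + 1) i) α with hAdef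
  set D := variationDomain (m + 1) i with hD
  have hA : ContDiffOn ℝ 1 A D :=
    hα.contDiffOn _ _ (uniqueDiffOn_variationDomain i) (hΦ.contMDiffOn_chartVariation i)
  have hsub : chartPart S i ⊆ (extChartAt (𝓡 (m + 1)) i).target :=
    fun y hy => (mem_of_mem_chartPart hy).1
  have hρ : ContinuousOn (fun y => integralPartition (m + 1) X i
      ((extChartAt (𝓡 (m + 1)) i).symm y)) (chartPart S i) :=
    (integralPartition (m + 1) X i).contMDiff.continuous.comp_continuousOn
      ((continuousOn_extChartAt_symm i).mono hsub)
  have hσ : ContinuousOn (chartSign τ i) (chartPart S i) := (hτ.continuousOn_chartSign i).mono hsub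
  have hAe : ∀ s, 0 ≤ s → ∀ y ∈ chartPart S i, chartCoeff (pullbackForm (Φ s) α) i y =
      A (s, y) (fun j => (0, stdFrame (m + 1) j)) := fun s hs y hy =>
    (hΦ.formPull_apply_inr α i hs (hsub hy) (stdFrame (m + 1))).symm
  have main := hasDerivWithinAt_setIntegral volume (isCompact_chartPart hS i)
    (a := fun s y => integralPartition (m + 1) X i ((extChartAt (𝓡 (m + 1)) i).symm y) *
      (chartSign τ i y * A (s, y) (fun j => (0, stdFrame (m + 1) j))))
    (a' := fun s y => integralPartition (m + 1) X i ((extChartAt (𝓡 (m + 1)) i).symm y) *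
      (chartSign τ i y * fderivWithin ℝ A D (s, y) (1, 0) (fun j => (0, stdFrame (m + 1) j))))
    ?_ ?_ ?_
  · refine (main.congr_deriv ?_).congr ?_ ?_
    · refine setIntegral_congr_fun (isCompact_chartPart hS i).measurableSet fun y hy => ?_
      rw [hα.chartCoeff_add hΦ i (hsub hy)]
    · intro s hs
      refine setIntegral_congr_fun (isCompact_chartPart hS i).measurableSet fun y hy => ?_
      rw [hAe s hs y hy]
    · refine setIntegral_congr_fun (isCompact_chartPart hS i).measurableSet fun y hy => ?_
      rw [hAe 0 le_rfl y hy]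
  · intro s hs y hy
    refine HasDerivWithinAt.const_mul _ (HasDerivWithinAt.const_mul _ ?_)
    have h1 := (hA.differentiableOn one_ne_zero (s, y) ⟨hs, hsub hy⟩).hasFDerivWithinAt
    have h2 : HasDerivWithinAt (fun t : ℝ => (t, y)) ((1 : ℝ), (0 : EuclideanSpace ℝ (Fin (m + 1))))
        (Ici 0) s := (hasDerivWithinAt_id s _).prodMk (hasDerivWithinAt_const s _ y)
    have hm : MapsTo (fun t : ℝ => (t, y)) (Ici 0) D := fun t ht => ⟨ht, hsub hy⟩
    have h3 := h1.comp_hasDerivWithinAt s h2 hm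
    exact (ContinuousAlternatingMap.apply ℝ _ ℝ
      (fun j => ((0 : ℝ), stdFrame (m + 1) j))).hasFDerivAt.comp_hasDerivWithinAt s h3
  · intro s hs
    refine hρ.mul (hσ.mul ?_)
    refine (ContinuousAlternatingMap.apply ℝ _ ℝ _).continuous.comp_continuousOn
      (hA.continuousOn.comp (Continuous.prodMk_right s).continuousOn fun y hy => ⟨hs, hsub hy⟩)
  · have hsnd : MapsTo Prod.snd (Icc (0 : ℝ) 1 ×ˢ chartPart (n := m + 1) S i) (chartPart (n := m + 1) S i) := fun a ha => ha.2
    refine (hρ.comp continuousOn_snd hsnd).mul ((hσ.comp continuousOn_snd hsnd).mul ?_)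
    exact (hα.continuousOn_deriv hΦ i _).mono fun a ha => ⟨ha.1.1, hsub ha.2⟩

/-- The formula for the first variation of the integral of a form. -/
theorem IsExteriorDerivative.hasDerivWithinAt_integralForm (hα : IsExteriorDerivative J α μ)
    (hΦ : IsSmoothVariation (m + 1) J Φ) {τ : DForm (𝓡 (m + 1)) (m + 1) X} (hτ : IsOrientation τ)
    {S : Set X} (hS : IsCompact S) (h0 : ∀ s, 0 ≤ s → ∀ x, x ∉ S → Φ s x = Φ 0 x) :
    HasDerivWithinAt (fun s => integralForm τ S (pullbackForm (Φ s) α))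
      (integralForm τ S (contractAlong (Φ 0) (initialVelocity J Φ) μ)) (Ici 0) 0 := by
  have hβ := hα.isC1Form_contractAlong hΦ
  -- Points outside `S` do not move, so the velocity and the contracted form vanish there and
  -- Stokes' theorem applies.
  have hst := integralForm_exteriorDeriv_eq_zero hτ hβ hS fun x hx => by
    ext v
    have := initialVelocity_eq_zero (J := J) (fun s hs => h0 s hs x hx)
    rw [contractAlong_apply, this]
    exact (α (Φ 0 x)).map_coord_zero 0 rfl
  refine HasDerivWithinAt.congr_deriv
    (f' := integralForm τ S (contractAlong (Φ 0) (initialVelocity J Φ) μ) +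
      integralForm τ S (exteriorDeriv (𝓡 (m + 1)) (contractAlong (Φ 0) (initialVelocity J Φ) α)))
    ?_ (by rw [hst, add_zero])
  simp only [integralForm_eq_sum τ hS]
  rw [← Finset.sum_add_distrib]
  refine HasDerivWithinAt.fun_sum fun i _ => ?_
  refine (hα.hasDerivWithinAt_chartPart hΦ hτ hS i).congr_deriv ?_
  have hsub : chartPart S i ⊆ (extChartAt (𝓡 (m + 1)) i).target :=
    fun y hy => (mem_of_mem_chartPart hy).1
  have hρ : ContinuousOn (fun y => integralPartition (m + 1) X i
      ((extChartAt (𝓡 (m + 1)) i).symm y)) (chartPart S i) :=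
    (integralPartition (m + 1) X i).contMDiff.continuous.comp_continuousOn
      ((continuousOn_extChartAt_symm i).mono hsub)
  have hσ : ContinuousOn (chartSign τ i) (chartPart S i) := (hτ.continuousOn_chartSign i).mono hsub
  rw [← integral_add]
  · simp only [mul_add]
  · exact (hρ.mul (hσ.mul ((hα.continuousOn_chartCoeff_contractAlong hΦ i).mono
      hsub))).integrableOn_compact (isCompact_chartPart hS i)
  · exact (hρ.mul (hσ.mul ((continuousOn_chartCoeff_exteriorDeriv hβ i).mono hsub))).integrableOn_compact
      (isCompact_chartPart hS i)

end FirstVariation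

/-! ### Localised deformations -/

section Push

variable {F H : Type*} [NormedAddCommGroup F] [NormedSpace ℝ F] [TopologicalSpace H]
  {J : ModelWithCorners ℝ F H} {M : Type*} [TopologicalSpace M] [ChartedSpace H M]

/-- The expression in the chart at `p` of the deformation `pushToward`. -/
def pushCoord (J : ModelWithCorners ℝ F H) (p : M) (ρ : M → ℝ) (e : F) (a : ℝ × M) : F :=
  extChartAt J p a.2 + ((1 - Real.exp (-a.1)) * ρ a.2) • (e - extChartAt J p a.2)

open Classical in
/-- The deformation that, in the chart at `p`, moves the points in the direction of the point of
coordinates `e`, with a speed localised by `ρ`. -/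
def pushToward (J : ModelWithCorners ℝ F H) (p : M) (ρ : M → ℝ) (e : F) (s : ℝ) (m : M) : M :=
  if m ∈ (extChartAt J p).source then (extChartAt J p).symm (pushCoord J p ρ e (s, m)) else m

/-- The field on the domain of the chart at `p` that points to the point of coordinates `e`. -/
def fieldToward (J : ModelWithCorners ℝ F H) (p : M) (e : F) (m : M) : F :=
  mfderivWithin 𝓘(ℝ, F) J (extChartAt J p).symm (range J) (extChartAt J p m)
    (e - extChartAt J p m : F)

/-- The conditions on the cut-off function `ρ` and on the target point `e` under which
`pushToward J p ρ e` is a deformation. -/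
structure IsPushCutoff (J : ModelWithCorners ℝ F H) (p : M) (ρ : M → ℝ) (e : F) : Prop where
  contMDiff : ContMDiff J 𝓘(ℝ, ℝ) ∞ ρ
  mem_Icc : ∀ m, ρ m ∈ Icc (0 : ℝ) 1
  tsupport_subset : tsupport ρ ⊆ (extChartAt J p).source
  exists_convex : ∃ B ⊆ (extChartAt J p).target, Convex ℝ B ∧ e ∈ B ∧
    ∀ m ∈ tsupport ρ, extChartAt J p m ∈ B

variable {p : M} {ρ : M → ℝ} {e : F}

/-- For `s ≥ 0` the factor `(1 - exp (-s)) ρ` lies in `[0, 1]`, so a moving point stays on a segment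
between two points of the convex set `B`. This keeps the deformation inside `M`, also at the
boundary, for all `s ≥ 0`. -/
theorem IsPushCutoff.pushCoord_mem_target (h : IsPushCutoff J p ρ e) {s : ℝ} (hs : 0 ≤ s) {m : M}
    (hm : m ∈ (extChartAt J p).source) : pushCoord J p ρ e (s, m) ∈ (extChartAt J p).target := by
  by_cases hmρ : m ∈ tsupport ρ
  · obtain ⟨B, hBt, hB, he, hmB⟩ := h.exists_convex
    refine hBt (hB.add_smul_sub_mem (hmB m hmρ) he ⟨?_, ?_⟩)
    · exact mul_nonneg (by simpa using hs) (h.mem_Icc m).1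
    · refine mul_le_one₀ (by simpa using (Real.exp_pos (-s)).le) (h.mem_Icc m).1 (h.mem_Icc m).2
  · rw [pushCoord, image_eq_zero_of_notMem_tsupport hmρ, mul_zero, zero_smul, add_zero]
    exact (extChartAt J p).map_source hm

theorem pushToward_of_eq_zero {s : ℝ} {m : M} (hm : ρ m = 0) : pushToward J p ρ e s m = m := by
  rw [pushToward]
  split_ifs with h
  · rw [pushCoord, hm, mul_zero, zero_smul, add_zero, (extChartAt J p).left_inv h]
  · rfl

theorem pushToward_zero (m : M) : pushToward J p ρ e 0 m = m := by
  rw [pushToward]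
  split_ifs with h
  · rw [pushCoord, neg_zero, Real.exp_zero, sub_self, zero_mul, zero_smul, add_zero,
      (extChartAt J p).left_inv h]
  · rfl

theorem IsPushCutoff.isDeformation [IsManifold J ∞ M] (h : IsPushCutoff J p ρ e) :
    IsDeformation J (tsupport ρ) (pushToward J p ρ e) where
  map_zero := pushToward_zero
  eq_of_notMem s _ m hm := pushToward_of_eq_zero (image_eq_zero_of_notMem_tsupport hm)
  contMDiffOn := by
    have hsrc : ContMDiffOn (𝓘(ℝ, ℝ).prod J) J ∞
        (fun a : ℝ × M => (extChartAt J p).symm (pushCoord J p ρ e a))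
        (Ici 0 ×ˢ (extChartAt J p).source) := by
      refine (contMDiffOn_extChartAt_symm p).comp ?_ fun a ha => h.pushCoord_mem_target ha.1 ha.2
      have h1 : ContMDiffOn (𝓘(ℝ, ℝ).prod J) 𝓘(ℝ, F) ∞ (fun a : ℝ × M => extChartAt J p a.2)
          (Ici 0 ×ˢ (extChartAt J p).source) := by
        refine ContMDiffOn.comp (t := (chartAt H p).source) contMDiffOn_extChartAt
          contMDiff_snd.contMDiffOn fun a ha => ?_
        rw [← extChartAt_source J]
        exact ha.2
      have h2 : ContMDiff (𝓘(ℝ, ℝ).prod J) 𝓘(ℝ, ℝ) ∞ (fun a : ℝ × M => 1 - Real.exp (-a.1)) := by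
        have : ContDiff ℝ ∞ (fun s : ℝ => 1 - Real.exp (-s)) := by fun_prop
        exact this.contMDiff.comp contMDiff_fst
      have h3 : ContMDiff (𝓘(ℝ, ℝ).prod J) 𝓘(ℝ, ℝ) ∞ (fun a : ℝ × M => ρ a.2) :=
        h.contMDiff.comp contMDiff_snd
      exact h1.add ((h2.mul h3).contMDiffOn.smul (contMDiffOn_const.sub h1))
    rintro ⟨s, m⟩ ⟨hs, -⟩
    -- The chart formula is smooth on the open chart domain, which contains `tsupport ρ`; on the
    -- open complement of `tsupport ρ` the map is `m` itself.
    by_cases hm : m ∈ tsupport ρ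
    · have hms := h.tsupport_subset hm
      have hnhds : Ici (0 : ℝ) ×ˢ (extChartAt J p).source ∈ 𝓝[Ici (0 : ℝ) ×ˢ univ] (s, m) := by
        refine mem_nhdsWithin.2 ⟨univ ×ˢ (extChartAt J p).source,
          isOpen_univ.prod (isOpen_extChartAt_source p), ⟨mem_univ _, hms⟩, ?_⟩
        rintro a ⟨ha, hb⟩
        exact ⟨hb.1, ha.2⟩
      refine ((hsrc (s, m) ⟨hs, hms⟩).congr (fun a ha => if_pos ha.2)
        (if_pos hms)).mono_of_mem_nhdsWithin hnhds
    · refine (contMDiffWithinAt_snd (I := 𝓘(ℝ, ℝ)) (J := J)).congr_of_eventuallyEq_of_mem ?_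
        ⟨hs, mem_univ _⟩
      have : univ ×ˢ (tsupport ρ)ᶜ ∈ 𝓝 (s, m) :=
        (isOpen_univ.prod (isClosed_tsupport ρ).isOpen_compl).mem_nhds ⟨mem_univ _, hm⟩
      filter_upwards [mem_nhdsWithin_of_mem_nhds this] with a ha
      exact pushToward_of_eq_zero (image_eq_zero_of_notMem_tsupport ha.2)

theorem IsPushCutoff.initialVelocity_eq [IsManifold J ∞ M] (h : IsPushCutoff J p ρ e) {X : Type*}
    {γ : X → M} {x : X} (hx : γ x ∈ (extChartAt J p).source) :
    initialVelocity J (fun s x => pushToward J p ρ e s (γ x)) x =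
      ρ (γ x) • fieldToward J p e (γ x) := by
  set c := extChartAt J p (γ x) with hc
  have hd : HasDerivWithinAt (fun s : ℝ => pushCoord J p ρ e (s, γ x)) (ρ (γ x) • (e - c))
      (Ici 0) 0 := by
    have h1 : HasDerivAt (fun s : ℝ => 1 - Real.exp (-s)) 1 0 := by
      simpa using ((hasDerivAt_neg (0 : ℝ)).exp).const_sub 1
    have h2 := ((h1.mul_const (ρ (γ x))).smul_const (e - c)).const_add c
    rw [one_mul] at h2
    exact h2.hasDerivWithinAt
  have h0 : pushCoord J p ρ e (0, γ x) = c := by simp [pushCoord, hc]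
  have hsymm : ∀ q, q = c → HasMFDerivWithinAt 𝓘(ℝ, F) J (extChartAt J p).symm (range J) q
      (mfderivWithin 𝓘(ℝ, F) J (extChartAt J p).symm (range J) q) := by
    rintro _ rfl
    exact (mdifferentiableWithinAt_extChartAt_symm ((extChartAt J p).map_source hx)).hasMFDerivWithinAt
  have hmaps : Ici (0 : ℝ) ⊆ (fun s => pushCoord J p ρ e (s, γ x)) ⁻¹' range J := fun s hs =>
    extChartAt_target_subset_range p (h.pushCoord_mem_target hs hx)
  have hcomp := (hsymm _ h0).comp (0 : ℝ) hd.hasFDerivWithinAt.hasMFDerivWithinAt hmaps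
  have hcongr : HasMFDerivWithinAt 𝓘(ℝ, ℝ) J (fun s => pushToward J p ρ e s (γ x)) (Ici 0) 0 _ :=
    hcomp.congr_of_eventuallyEq (Eventually.of_forall fun s => if_pos hx) (if_pos hx)
  have hfin := DFunLike.congr_fun
    (hcongr.mfderivWithin ((uniqueDiffOn_Ici (0 : ℝ)) 0 self_mem_Ici).uniqueMDiffWithinAt) (1 : ℝ)
  -- The derivative is taken at `pushCoord` at time `0`, which equals `c` only propositionally.
  have key : ∀ q, q = c → (mfderivWithin 𝓘(ℝ, F) J (extChartAt J p).symm (range J) q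
      ((1 : ℝ) • (ρ (γ x) • (e - c)) : F) : F) = ρ (γ x) • fieldToward J p e (γ x) := by
    rintro _ rfl
    rw [one_smul]
    exact ContinuousLinearMap.map_smul (M₁ := F) (M₂ := F) _ _ _
  exact hfin.trans (key _ h0)

/-- Otherwise `l` would be constant near `c` on `range J`, so `0` and `l` would both be derivatives
of `l` there, against uniqueness of derivatives within `range J`. At a boundary point this replaces
the free choice of a direction. -/
theorem exists_mem_range_apply_sub_ne_zero {c : F} (hc : c ∈ range J) {l : F →L[ℝ] ℝ} (hl : l ≠ 0)
    {r : ℝ} (hr : 0 < r) : ∃ e ∈ Metric.closedBall c r ∩ range J, l (e - c) ≠ 0 := by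
  by_contra! h
  have h1 : (l : F → ℝ) =ᶠ[𝓝[range J] c] fun _ => l c := by
    filter_upwards [self_mem_nhdsWithin,
      mem_nhdsWithin_of_mem_nhds (Metric.closedBall_mem_nhds c hr)] with e he1 he2
    exact sub_eq_zero.1 ((map_sub l e c).symm.trans (h e ⟨he2, he1⟩))
  have h2 : HasFDerivWithinAt l (0 : F →L[ℝ] ℝ) (range J) c :=
    (hasFDerivWithinAt_const (l c) c (range J)).congr_of_eventuallyEq h1 rfl
  exact hl (J.uniqueDiffOn.eq hc l.hasFDerivWithinAt h2)

/-- The wide bump `f₀` fixes the convex set and hence the admissible targets `e`; the support of `f`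
can then be shrunk without changing `e`. -/
theorem isPushCutoff_smoothBumpFunction [FiniteDimensional ℝ F] [T2Space M] [IsManifold J ∞ M]
    (f₀ f : SmoothBumpFunction J p) (hf : tsupport f ⊆ tsupport f₀)
    (he : e ∈ Metric.closedBall (extChartAt J p p) f₀.rOut ∩ range J) : IsPushCutoff J p f e where
  contMDiff := f.contMDiff
  mem_Icc _ := f.mem_Icc
  tsupport_subset := f.tsupport_subset_extChartAt_source
  exists_convex := by
    refine ⟨_, f₀.closedBall_subset, (convex_closedBall _ _).inter J.convex_range, he, fun m hm => ?_⟩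
    obtain ⟨y, hy, rfl⟩ := f₀.tsupport_subset_symm_image_closedBall (hf hm)
    rwa [(extChartAt J p).right_inv (f₀.closedBall_subset hy)]

end Push

/-! ### The Euler–Lagrange equations -/

section EulerLagrange

variable {F H : Type*} [NormedAddCommGroup F] [NormedSpace ℝ F] [TopologicalSpace H]
  {J : ModelWithCorners ℝ F H} {M : Type*} [TopologicalSpace M] [ChartedSpace H M]
  {m : ℕ} {X : Type*} [TopologicalSpace X] [ChartedSpace (EuclideanSpace ℝ (Fin (m + 1))) X]
  {w α : DForm J (m + 1) M} {μ : DForm J (m + 1 + 1) M} {γ : X → M}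

theorem IsDeformation.isSmoothVariation {K : Set M} {φ : ℝ → M → M} (hφ : IsDeformation J K φ)
    (hγ : ContMDiff (𝓡 (m + 1)) J ∞ γ) : IsSmoothVariation (m + 1) J fun s x => φ s (γ x) := by
  have h : ContMDiff (𝓘(ℝ, ℝ).prod (𝓡 (m + 1))) (𝓘(ℝ, ℝ).prod J) ∞
      (fun a : ℝ × X => (a.1, γ a.2)) := contMDiff_fst.prodMk (hγ.comp contMDiff_snd)
  exact hφ.contMDiffOn.comp h.contMDiffOn fun a ha => ⟨ha.1, mem_univ _⟩

variable [IsManifold (𝓡 (m + 1)) ∞ X] [T2Space X] [SigmaCompactSpace X]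

theorem IsExteriorDerivative.hasDerivWithinAt_of_isDeformation (hα : IsExteriorDerivative J α μ)
    (hγ : ContMDiff (𝓡 (m + 1)) J ∞ γ) (hτ : IsOrientation (pullbackForm (J := 𝓡 (m + 1)) γ w))
    {K : Set M} (hK : IsCompact (γ ⁻¹' K)) {φ : ℝ → M → M} (hφ : IsDeformation J K φ) :
    HasDerivWithinAt (fun s => integralForm (pullbackForm γ w) (γ ⁻¹' K)
        (pullbackForm (fun x => φ s (γ x)) α))
      (integralForm (pullbackForm γ w) (γ ⁻¹' K)
        (contractAlong γ (initialVelocity J fun s x => φ s (γ x)) μ)) (Ici 0) 0 := by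
  have h := hα.hasDerivWithinAt_integralForm (hφ.isSmoothVariation hγ) hτ hK fun s hs x hx => by
    rw [hφ.eq_of_notMem s hs _ hx, hφ.map_zero]
  have h0 : (fun x => φ 0 (γ x)) = γ := funext fun x => hφ.map_zero _
  rwa [h0] at h

theorem IsExteriorDerivative.isCritical (hα : IsExteriorDerivative J α μ)
    (hγ : ContMDiff (𝓡 (m + 1)) J ∞ γ) (hτ : IsOrientation (pullbackForm (J := 𝓡 (m + 1)) γ w))
    (h : ∀ x (ξ : F) (v : Fin (m + 1) → EuclideanSpace ℝ (Fin (m + 1))),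
      μ (γ x) (Fin.cons ξ fun j => mfderiv (𝓡 (m + 1)) J γ x (v j)) = 0) :
    IsCritical J w α γ := by
  intro K _ hK φ hφ
  refine (hα.hasDerivWithinAt_of_isDeformation hγ hτ hK hφ).congr_deriv ?_
  rw [integralForm_eq_sum _ hK]
  refine Finset.sum_eq_zero fun i _ => setIntegral_eq_zero_of_forall_eq_zero fun y _ => ?_
  have : chartCoeff (contractAlong γ (initialVelocity J fun s x => φ s (γ x)) μ) i y = 0 := h _ _ _
  rw [this, mul_zero, mul_zero]

/-- The fundamental lemma of the calculus of variations, with two bumps. The wide one, `f₀`, gives a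
deformation whose first variation has a continuous density `q` with `q y₀ ≠ 0`. A narrow one, `f`,
supported where `q` keeps its sign and `f₀ ∘ γ = 1`, gives the density `f q`, whose integral cannot
vanish. -/
theorem IsExteriorDerivative.apply_eq_zero_of_isCritical [FiniteDimensional ℝ F] [T2Space M]
    [IsManifold J ∞ M] (hα : IsExteriorDerivative J α μ)
    (hγ : ContMDiff (𝓡 (m + 1)) J ∞ γ) (hγe : IsEmbedding γ)
    (hτ : IsOrientation (pullbackForm (J := 𝓡 (m + 1)) γ w))
    (hcrit : IsCritical J w α γ) (x₀ : X) (ξ : F) :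
    chartCoeff (contractAlong γ (fun _ => ξ) μ) x₀ (extChartAt (𝓡 (m + 1)) x₀ x₀) = 0 := by
  set τ := pullbackForm (J := 𝓡 (m + 1)) γ w with hτdef
  set T := (extChartAt (𝓡 (m + 1)) x₀).target with hT
  set ψ := (extChartAt (𝓡 (m + 1)) x₀).symm with hψ
  set y₀ := extChartAt (𝓡 (m + 1)) x₀ x₀ with hy₀
  have hy₀T : y₀ ∈ T := mem_extChartAt_target x₀
  have hψy₀ : ψ y₀ = x₀ := extChartAt_to_inv x₀
  by_contra hne
  -- the linear form to be tested
  set p := γ x₀ with hp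
  have hpsrc : p ∈ (extChartAt J p).source := mem_extChartAt_source p
  let l₀ : F →L[ℝ] ℝ := (ContinuousAlternatingMap.apply ℝ F ℝ
    (fun j => mfderiv (𝓡 (m + 1)) J γ (ψ y₀) (coordFrame x₀ y₀ j))).comp
      (ContinuousAlternatingMap.curryLeft (E := F) (μ (γ (ψ y₀))))
  have hl₀ : ∀ v : X → F, chartCoeff (contractAlong γ v μ) x₀ y₀ = l₀ (v (ψ y₀)) := fun v => rfl
  let A : F →L[ℝ] F := mfderivWithin 𝓘(ℝ, F) J (extChartAt J p).symm (range J) (extChartAt J p p)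
  -- The derivative of the inverse chart is invertible, so a form `l₀` that is nonzero on `ξ`
  -- remains nonzero in coordinates.
  have hA : Function.Surjective A := by
    obtain ⟨B, hB⟩ := isInvertible_mfderivWithin_extChartAt_symm (I := J)
      (mem_extChartAt_target (I := J) p)
    intro v
    refine ⟨B.symm v, ?_⟩
    exact (DFunLike.congr_fun hB (B.symm v)).symm.trans (B.apply_symm_apply v)
  have hl : l₀.comp A ≠ 0 := by
    intro h
    obtain ⟨u, hu⟩ := hA ξ
    refine hne ((hl₀ _).trans ?_)
    rw [← hu]
    exact DFunLike.congr_fun h u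
  obtain ⟨f₀⟩ : Nonempty (SmoothBumpFunction J p) := inferInstance
  obtain ⟨e, he, hle⟩ := exists_mem_range_apply_sub_ne_zero
    (extChartAt_target_subset_range (I := J) p (mem_extChartAt_target p)) hl f₀.rOut_pos
  have hcut₀ : IsPushCutoff J p f₀ e := isPushCutoff_smoothBumpFunction f₀ f₀ Subset.rfl he
  -- continuity of the first variation of the deformation defined by `f₀`
  have hcont : ∀ f : M → ℝ, IsPushCutoff J p f e → ContinuousOn (chartCoeff (contractAlong γ
      (initialVelocity J fun s x => pushToward J p f e s (γ x)) μ) x₀) T := by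
    intro f hf
    have h := hα.continuousOn_chartCoeff_contractAlong (hf.isDeformation.isSmoothVariation hγ) x₀
    have h0 : (fun x => pushToward J p f e 0 (γ x)) = γ := funext fun x => pushToward_zero _
    rwa [h0] at h
  set q : EuclideanSpace ℝ (Fin (m + 1)) → ℝ := fun y => chartSign τ x₀ y *
    chartCoeff (contractAlong γ (initialVelocity J fun s x => pushToward J p f₀ e s (γ x)) μ) x₀ y
    with hq
  have hqc : ContinuousOn q T := (hτ.continuousOn_chartSign x₀).mul (hcont f₀ hcut₀)
  have hq₀ : q y₀ ≠ 0 := by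
    refine mul_ne_zero ?_ ?_
    · rcases lt_or_gt_of_ne (hτ.ne_zero x₀ y₀ hy₀T) with h | h
      · simp [chartSign, sign_neg h]
      · simp [chartSign, sign_pos h]
    · have h1 := hcut₀.initialVelocity_eq (γ := γ) (x := x₀) hpsrc
      rw [hl₀, hψy₀, h1, f₀.eq_one, one_smul]
      exact hle
  have hev : ∀ᶠ x in 𝓝 x₀, x ∈ (extChartAt (𝓡 (m + 1)) x₀).source ∧
      0 < q (extChartAt (𝓡 (m + 1)) x₀ x) * q y₀ ∧ f₀ (γ x) = 1 ∧
      γ x ∈ (extChartAt J p).source := by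
    have hqa : ContinuousAt (fun x => q (extChartAt (𝓡 (m + 1)) x₀ x) * q y₀) x₀ :=
      ((hqc.continuousAt ((isOpen_target x₀).mem_nhds hy₀T)).comp (continuousAt_extChartAt (I := 𝓡 (m + 1)) x₀)).mul
        continuousAt_const
    have hγc : ContinuousAt γ x₀ := hγ.continuous.continuousAt
    filter_upwards [extChartAt_source_mem_nhds (I := 𝓡 (m + 1)) x₀,
      hqa.eventually_const_lt (mul_self_pos.2 hq₀), hγc.eventually f₀.eventuallyEq_one,
      hγc.eventually (extChartAt_source_mem_nhds (I := J) p)] with x h1 h2 h3 h4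
    exact ⟨h1, h2, h3, h4⟩
  have : LocallyCompactSpace X := Manifold.locallyCompact_of_finiteDimensional (𝓡 (m + 1))
  obtain ⟨C, hC, hCev, hCc⟩ := local_compact_nhds hev
  -- As `γ` is an embedding, a small neighbourhood of `γ x₀` in `M` meets `Γ` only at points of `C`:
  -- no other sheet of `Γ` enters the support of `f`.
  rw [hγe.toIsInducing.nhds_eq_comap, mem_comap] at hC
  obtain ⟨U, hU, hUC⟩ := hC
  obtain ⟨f, -, hf⟩ := (SmoothBumpFunction.nhds_basis_tsupport (I := J) p).mem_iff.1
    (inter_mem hU f₀.tsupport_mem_nhds)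
  have hcut : IsPushCutoff J p f e :=
    isPushCutoff_smoothBumpFunction f₀ f (hf.trans inter_subset_right) he
  set S := γ ⁻¹' tsupport f with hS
  have hSC : S ⊆ C := (preimage_mono (hf.trans inter_subset_left)).trans hUC
  have hSc : IsCompact S := hCc.of_isClosed_subset
    ((isClosed_tsupport f).preimage hγ.continuous) hSC
  have hSsrc : S ⊆ (extChartAt (𝓡 (m + 1)) x₀).source := fun x hx => (hCev (hSC hx)).1
  have hSimg : IsCompact (extChartAt (𝓡 (m + 1)) x₀ '' S) :=
    hSc.image_of_continuousOn ((continuousOn_extChartAt x₀).mono hSsrc)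
  have hST : extChartAt (𝓡 (m + 1)) x₀ '' S ⊆ T := by
    rintro _ ⟨x, hx, rfl⟩
    exact (extChartAt (𝓡 (m + 1)) x₀).map_source (hSsrc hx)
  -- Criticality and the first variation formula give two right derivatives at `0` of the same
  -- function; they agree.
  have hzero : integralForm τ S (contractAlong γ
      (initialVelocity J fun s x => pushToward J p f e s (γ x)) μ) = 0 :=
    (uniqueDiffOn_Ici (0 : ℝ) 0 self_mem_Ici).eq_deriv _
      (hα.hasDerivWithinAt_of_isDeformation hγ hτ hSc hcut.isDeformation)
      (hcrit _ f.hasCompactSupport hSc _ hcut.isDeformation)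
  rw [integralForm_eq_setIntegral_of_subset_source hτ hSc hSc Subset.rfl hSsrc (hcont f hcut)] at hzero
  swap
  · intro x hx
    have h0 : initialVelocity J (fun s x => pushToward J p f e s (γ x)) x = 0 :=
      initialVelocity_eq_zero fun s _ => by
        rw [pushToward_zero, pushToward_of_eq_zero (image_eq_zero_of_notMem_tsupport hx)]
    ext v
    rw [contractAlong_apply, h0]
    exact (μ (γ x)).map_coord_zero 0 rfl
  have hint : ∀ y ∈ extChartAt (𝓡 (m + 1)) x₀ '' S, chartSign τ x₀ y * chartCoeff (contractAlong γ
      (initialVelocity J fun s x => pushToward J p f e s (γ x)) μ) x₀ y = f (γ (ψ y)) * q y := by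
    rintro _ ⟨x, hx, rfl⟩
    obtain ⟨hx1, -, hx3, hx4⟩ := hCev (hSC hx)
    have hψx : ψ (extChartAt (𝓡 (m + 1)) x₀ x) = x := (extChartAt (𝓡 (m + 1)) x₀).left_inv hx1
    have hlin : ∀ y, ∀ (a : ℝ) (u v : X → F), u (ψ y) = a • v (ψ y) →
        chartCoeff (contractAlong γ u μ) x₀ y = a * chartCoeff (contractAlong γ v μ) x₀ y := by
      intro y a u v huv
      let l : F →L[ℝ] ℝ := (ContinuousAlternatingMap.apply ℝ F ℝ
        (fun j => mfderiv (𝓡 (m + 1)) J γ (ψ y) (coordFrame x₀ y j))).comp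
          (ContinuousAlternatingMap.curryLeft (E := F) (μ (γ (ψ y))))
      have h1 : l (u (ψ y)) = a * l (v (ψ y)) := by rw [huv, map_smul, smul_eq_mul]
      exact h1
    rw [hlin _ (f (γ (ψ (extChartAt (𝓡 (m + 1)) x₀ x)))) _
      (initialVelocity J fun s x => pushToward J p f₀ e s (γ x)), hq]
    · ring
    · rw [hψx, hcut.initialVelocity_eq hx4, hcut₀.initialVelocity_eq hx4, hx3, one_smul]
  rw [setIntegral_congr_fun hSimg.measurableSet hint] at hzero
  -- The constant factor `q y₀` makes the integrand nonnegative whatever the sign of `q`; it is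
  -- nonzero on a neighbourhood of `y₀`.
  have hpos : 0 < ∫ y in extChartAt (𝓡 (m + 1)) x₀ '' S, f (γ (ψ y)) * q y * q y₀ := by
    rw [setIntegral_pos_iff_support_of_nonneg_ae]
    · refine Measure.measure_pos_of_mem_nhds volume (x := y₀) ?_
      have hψc : Tendsto ψ (𝓝 y₀) (𝓝 x₀) := by
        have := continuousAt_extChartAt_symm (I := 𝓡 (m + 1)) x₀
        rwa [ContinuousAt, extChartAt_to_inv] at this
      have hfp : ∀ᶠ x in 𝓝 x₀, γ x ∈ Function.support f :=
        hγ.continuous.continuousAt.eventually f.support_mem_nhds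
      filter_upwards [hψc.eventually hfp, (isOpen_target x₀).mem_nhds hy₀T] with y hy hyT
      have hyS : ψ y ∈ S := subset_tsupport _ hy
      have hyy : extChartAt (𝓡 (m + 1)) x₀ (ψ y) = y := (extChartAt (𝓡 (m + 1)) x₀).right_inv hyT
      refine ⟨?_, ψ y, hyS, hyy⟩
      have h2 := (hCev (hSC hyS)).2.1
      rw [hyy] at h2
      rw [Function.mem_support, mul_assoc]
      exact mul_ne_zero hy h2.ne'
    · refine (ae_restrict_iff' hSimg.measurableSet).2 (Eventually.of_forall ?_)
      rintro _ ⟨x, hx, rfl⟩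
      change 0 ≤ f (γ (ψ _)) * q _ * q y₀
      rw [mul_assoc]
      exact mul_nonneg f.nonneg (hCev (hSC hx)).2.1.le
    · refine ContinuousOn.integrableOn_compact hSimg ?_
      refine ((f.continuous.comp hγ.continuous).comp_continuousOn
        ((continuousOn_extChartAt_symm x₀).mono hST)).mul (hqc.mono hST) |>.mul continuousOn_const
  rw [integral_mul_const, hzero, zero_mul] at hpos
  exact lt_irrefl _ hpos

end EulerLagrange

/-! ### Hamilton's equations for `n`-vectors -/

section HamiltonVector

variable {n : ℕ}

theorem exists_eq_smul_of_ne_zero {τ : EuclideanSpace ℝ (Fin n) [⋀^Fin n]→L[ℝ] ℝ} (hτ : τ ≠ 0)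
    (η : EuclideanSpace ℝ (Fin n) [⋀^Fin n]→L[ℝ] ℝ) : ∃ c : ℝ, η = c • τ := by
  have h : τ (stdFrame n) ≠ 0 := fun h => hτ (eq_zero_of_apply_stdFrame h)
  refine ⟨η (stdFrame n) / τ (stdFrame n), sub_eq_zero.1 (eq_zero_of_apply_stdFrame ?_)⟩
  change η (stdFrame n) - η (stdFrame n) / τ (stdFrame n) * τ (stdFrame n) = 0
  rw [div_mul_cancel₀ _ h, sub_self]

theorem exists_multiVector_apply_eq_one {τ : EuclideanSpace ℝ (Fin n) [⋀^Fin n]→L[ℝ] ℝ}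
    (hτ : τ ≠ 0) : ∃ Y : MultiVector n (EuclideanSpace ℝ (Fin n)), Y τ = 1 := by
  have h : τ (stdFrame n) ≠ 0 := fun h => hτ (eq_zero_of_apply_stdFrame h)
  exact ⟨(τ (stdFrame n))⁻¹ • wedge (stdFrame n), inv_mul_cancel₀ h⟩

theorem multiVector_eq_of_apply_eq {τ : EuclideanSpace ℝ (Fin n) [⋀^Fin n]→L[ℝ] ℝ}
    (hτ : τ ≠ 0) {Y Z : MultiVector n (EuclideanSpace ℝ (Fin n))} (h : Y τ = Z τ) : Y = Z := by
  ext η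
  obtain ⟨c, rfl⟩ := exists_eq_smul_of_ne_zero hτ η
  rw [map_smul, map_smul, h]

variable {V : Type*} {τ : EuclideanSpace ℝ (Fin n) [⋀^Fin n]→L[ℝ] ℝ} {a : V → ℝ}
  {η : V → EuclideanSpace ℝ (Fin n) [⋀^Fin n]→L[ℝ] ℝ}

/-- Top-degree forms make up a line spanned by `τ`, so `Y τ = 1` determines `Y`, and `Y` applied to
`c • τ` recovers the coefficient `c`. -/
theorem forall_eq_smul_iff_existsUnique_normalised (hτ : τ ≠ 0) :
    (∀ ξ, η ξ = a ξ • τ) ↔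
      ∃! Y : MultiVector n (EuclideanSpace ℝ (Fin n)), Y τ = 1 ∧ ∀ ξ, Y (η ξ) = a ξ := by
  constructor
  · intro h
    obtain ⟨Y, hY⟩ := exists_multiVector_apply_eq_one hτ
    refine ⟨Y, ⟨hY, fun ξ => ?_⟩, fun Z hZ => multiVector_eq_of_apply_eq hτ (hZ.1.trans hY.symm)⟩
    rw [h, map_smul, hY, smul_eq_mul, mul_one]
  · rintro ⟨Y, ⟨hY, hYη⟩, -⟩ ξ
    obtain ⟨c, hc⟩ := exists_eq_smul_of_ne_zero hτ (η ξ)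
    have h := hYη ξ
    rw [hc, map_smul, hY, smul_eq_mul, mul_one] at h
    rw [hc, h]

/-- At `ξ₀` the equation reads `a ξ₀ * Y τ = a ξ₀`, which forces the normalisation `Y τ = 1` and
hence uniqueness. -/
theorem existsUnique_of_forall_eq_smul (hτ : τ ≠ 0) (h : ∀ ξ, η ξ = a ξ • τ) {ξ₀ : V}
    (hξ₀ : a ξ₀ ≠ 0) :
    ∃! Y : MultiVector n (EuclideanSpace ℝ (Fin n)), ∀ ξ, Y (η ξ) = a ξ := by
  obtain ⟨Y, hY⟩ := exists_multiVector_apply_eq_one hτ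
  refine ⟨Y, fun ξ => ?_, fun Z hZ => multiVector_eq_of_apply_eq hτ ?_⟩
  · rw [h, map_smul, hY, smul_eq_mul, mul_one]
  · have h1 := hZ ξ₀
    rw [h, map_smul, smul_eq_mul] at h1
    rw [hY]
    exact mul_left_cancel₀ hξ₀ (h1.trans (mul_one _).symm)

/-- Here the equation at `ξ₀` is the normalisation `Y τ = 1` itself, so imposing it separately
changes nothing. -/
theorem forall_eq_smul_iff_existsUnique (hτ : τ ≠ 0) {ξ₀ : V} (hξ₀ : a ξ₀ = 1)
    (hη : η ξ₀ = τ) : (∀ ξ, η ξ = a ξ • τ) ↔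
      ∃! Y : MultiVector n (EuclideanSpace ℝ (Fin n)), ∀ ξ, Y (η ξ) = a ξ := by
  refine ⟨fun h => existsUnique_of_forall_eq_smul hτ h (hξ₀ ▸ one_ne_zero), ?_⟩
  rintro ⟨Y, hY, hu⟩
  have hY1 : Y τ = 1 := by rw [← hη, hY, hξ₀]
  exact (forall_eq_smul_iff_existsUnique_normalised hτ).2 ⟨Y, ⟨hY1, hY⟩, fun Z hZ => hu Z hZ.2⟩

theorem oneWedge_cons_of_eq_zero [NormedAddCommGroup V] [NormedSpace ℝ V] (b : V →L[ℝ] ℝ) (p : V [⋀^Fin n]→L[ℝ] ℝ) (ξ : V) (v : Fin n → V)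
    (hv : ∀ j, b (v j) = 0) : oneWedge b p (Fin.cons ξ v) = b ξ * p v := by
  rw [oneWedge, ContinuousAlternatingMap.alternatizeUncurryFin_apply, Fin.sum_univ_succ,
    Finset.sum_eq_zero, add_zero]
  · simp
  · intro i _
    simp [hv]

end HamiltonVector

/-! ### The Legendre correspondence along the direction of `ω` -/

section LegendreShift

variable {n : ℕ} {V : Type*} [NormedAddCommGroup V] [NormedSpace ℝ V]
  {w p : V [⋀^Fin n]→L[ℝ] ℝ} {ℓ : MultiVector n V → ℝ}

/-- On `D^ω` the pairing with `ω` is constantly `1`, so adding `t ω` to `p` changes `W` by the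
constant `t` and leaves its critical points alone. -/
theorem isLegendreRelated_add_smul (z : MultiVector n V) (t : ℝ) :
    IsLegendreRelated w ℓ z (p + t • w) ↔ IsLegendreRelated w ℓ z p := by
  refine forall_congr' fun c => forall_congr' fun _ => forall_congr' fun _ =>
    forall_congr' fun hc => ?_
  have h : (fun s => c s (p + t • w) - ℓ (c s)) = fun s => (c s p - ℓ (c s)) + t := by
    funext s
    rw [map_add, map_smul, (hc s).2, smul_eq_mul]
    ring
  rw [h, hasDerivAt_add_const_iff]

theorem legendreSet_add_smul (t : ℝ) : legendreSet w ℓ (p + t • w) = legendreSet w ℓ p := by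
  ext z
  exact and_congr_right fun _ => isLegendreRelated_add_smul z t

theorem legendreValue_add_smul (h : (legendreSet w ℓ p).Nonempty) (t : ℝ) :
    legendreValue w ℓ (p + t • w) = legendreValue w ℓ p + t := by
  -- The two sets `Z` coincide, so after substitution the same point is chosen in both; independence
  -- of the choice is not needed.
  have key : ∀ (A : Set (MultiVector n V)) (_ : A = legendreSet w ℓ p) (hA : A.Nonempty),
      hA.some (p + t • w) - ℓ hA.some = h.some p - ℓ h.some + t := by
    rintro _ rfl hA
    have h1 : hA.some ∈ legendreSet w ℓ p := hA.some_mem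
    rw [map_add, map_smul, h1.1.2, smul_eq_mul]
    ring
  have h' : (legendreSet w ℓ (p + t • w)).Nonempty := by rwa [legendreSet_add_smul]
  rw [legendreValue, dif_pos h', legendreValue, dif_pos h]
  exact key _ (legendreSet_add_smul t) h'

end LegendreShift

/-! ### Curves lifted through an immersion -/

section Lift

/-- In adapted charts an immersion is `u ↦ (u, 0)` up to a linear isomorphism, so the coordinates of
`g` are a linear projection of those of `ι ∘ g`. Continuity of `g` keeps it inside the adapted
chart. -/
theorem contMDiffWithinAt_of_comp_isImmersionAt {E F F' H H' : Type*} [NormedAddCommGroup E]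
    [NormedSpace ℝ E] [NormedAddCommGroup F] [NormedSpace ℝ F] [NormedAddCommGroup F']
    [NormedSpace ℝ F'] [TopologicalSpace H] [TopologicalSpace H'] {J : ModelWithCorners ℝ F H}
    {J' : ModelWithCorners ℝ F' H'} {M M' : Type*} [TopologicalSpace M] [ChartedSpace H M]
    [TopologicalSpace M'] [ChartedSpace H' M'] {ι : M → M'} {g : E → M} {s : Set E} {x : E}
    (hι : IsImmersionAt J J' ∞ ι (g x)) (hg : ContinuousWithinAt g s x)
    (h : ContMDiffWithinAt 𝓘(ℝ, E) J' ∞ (ι ∘ g) s x) : ContMDiffWithinAt 𝓘(ℝ, E) J ∞ g s x := by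
  have hsrc : ∀ᶠ y in 𝓝[s] x, g y ∈ hι.domChart.source :=
    hg (hι.domChart.open_source.mem_nhds hι.mem_domChart_source)
  have hu : ∀ y, g y ∈ hι.domChart.source → hι.domChart.extend J (g y) =
      (hι.equiv.symm (hι.codChart.extend J' (ι (g y)))).1 := by
    intro y hy
    have hmem : hι.domChart.extend J (g y) ∈ (hι.domChart.extend J).target := by
      rw [hι.domChart.extend_target_eq_image_source]
      exact mem_image_of_mem _ hy
    have h1 := hι.writtenInCharts hmem
    simp only [Function.comp_apply] at h1
    rw [hι.domChart.extend_left_inv hy] at h1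
    rw [h1, ContinuousLinearEquiv.symm_apply_apply]
  have h1 : ContMDiffWithinAt 𝓘(ℝ, E) 𝓘(ℝ, F)  ∞
      (fun y => (hι.equiv.symm (hι.codChart.extend J' (ι (g y)))).1) s x := by
    have h2 : ContMDiff 𝓘(ℝ, F') 𝓘(ℝ, F) ∞ (fun z : F' => (hι.equiv.symm z).1) := by
      rw [contMDiff_iff_contDiff]
      fun_prop
    have h3 := hι.codChart.contMDiffAt_extend hι.codChart_mem_maximalAtlas hι.mem_codChart_source
    exact h2.contMDiffAt.comp_contMDiffWithinAt x (h3.comp_contMDiffWithinAt x h)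
  have h2 : ContMDiffWithinAt 𝓘(ℝ, E) 𝓘(ℝ, F) ∞ (fun y => hι.domChart.extend J (g y)) s x :=
    h1.congr_of_eventuallyEq (hsrc.mono hu) (hu x hι.mem_domChart_source)
  have h3 : ContMDiffWithinAt 𝓘(ℝ, F) J ∞ (hι.domChart.extend J).symm (J '' hι.domChart.target)
      (hι.domChart.extend J (g x)) :=
    contMDiffOn_extend_symm hι.domChart_mem_maximalAtlas _
      ⟨_, hι.domChart.map_source hι.mem_domChart_source, rfl⟩
  have hmem : (fun y => hι.domChart.extend J (g y)) ⁻¹' (J '' hι.domChart.target) ∈ 𝓝[s] x :=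
    hsrc.mono fun y hy => ⟨_, hι.domChart.map_source hy, rfl⟩
  have h4 := (h3.comp' x h2).mono_of_mem_nhdsWithin (inter_mem self_mem_nhdsWithin hmem)
  refine h4.congr_of_eventuallyEq (hsrc.mono fun y hy => ?_) ?_
  · exact (hι.domChart.extend_left_inv hy).symm
  · exact (hι.domChart.extend_left_inv hι.mem_domChart_source).symm

variable {n k : ℕ} {N : Type*} [TopologicalSpace N]
  [ChartedSpace (EuclideanSpace ℝ (Fin (n + k))) N] [IsManifold (𝓡 (n + k)) ∞ N]
  {F H : Type*} [NormedAddCommGroup F] [NormedSpace ℝ F] [TopologicalSpace H]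
  {J : ModelWithCorners ℝ F H} {M : Type*} [TopologicalSpace M] [ChartedSpace H M]
  {ι : M → FormBundle n k N}

/-- If `ι m + t p'` lies in the submanifold for small `t ≥ 0`, then the vertical vector `p'` is
tangent to the submanifold. -/
theorem exists_mfderiv_eq_verticalVector (hι : IsSmoothEmbedding J (formModel n k) ∞ ι) (m₀ : M)
    (p' : ModelForms n k)
    (h : ∀ᶠ t : ℝ in 𝓝[≥] 0, ∃ m : M,
      ι m = ⟨(ι m₀).1, (show ModelForms n k from (ι m₀).2) + t • p'⟩) :
    ∃ v : TangentSpace J m₀, mfderiv J (formModel n k) ι m₀ v = verticalVector (ι m₀) p' ∧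
      ∀ (f : M → ℝ) (_ : MDifferentiableAt J 𝓘(ℝ, ℝ) f m₀) (c : ℝ),
        (∀ (t : ℝ) (m : M), ι m = ⟨(ι m₀).1, (show ModelForms n k from (ι m₀).2) + t • p'⟩ →
          f m = f m₀ + t * c) → mvfderiv J f m₀ v = c := by
  classical
  set curve : ℝ → FormBundle n k N := fun t =>
    ⟨(ι m₀).1, (show ModelForms n k from (ι m₀).2) + t • p'⟩ with hcurve
  have hcurve0 : curve 0 = ι m₀ := by
    change (⟨(ι m₀).1, (show ModelForms n k from (ι m₀).2) + (0 : ℝ) • p'⟩ : FormBundle n k N) = _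
    rw [zero_smul, add_zero]
  -- The lift of the vertical curve to `M`. The default value is never taken for small `t ≥ 0`; the
  -- embedding property makes `g` right-continuous at `0`, and the immersion property makes it
  -- smooth there.
  let g : ℝ → M := fun t => if ht : ∃ m : M, ι m = curve t then ht.choose else m₀
  have hgt : ∀ᶠ t : ℝ in 𝓝[≥] 0, ι (g t) = curve t := by
    filter_upwards [h] with t ht
    have h1 : g t = ht.choose := dif_pos ht
    rw [h1]
    exact ht.choose_spec
  have hg0 : g 0 = m₀ := hι.isEmbedding.injective ((hgt.self_of_nhdsWithin self_mem_Ici).trans hcurve0)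
  have hcs : ContMDiff 𝓘(ℝ, ℝ) (formModel n k) ∞ curve := contMDiff_verticalCurve (ι m₀) p'
  have hgc : ContinuousWithinAt g (Ici 0) 0 := by
    rw [hι.isEmbedding.isInducing.continuousWithinAt_iff]
    exact hcs.continuous.continuousWithinAt.congr_of_eventuallyEq hgt
      (hgt.self_of_nhdsWithin self_mem_Ici)
  have hgs : ContMDiffWithinAt 𝓘(ℝ, ℝ) J ∞ g (Ici 0) 0 :=
    contMDiffWithinAt_of_comp_isImmersionAt (hι.isImmersion.isImmersionAt (g 0)) hgc
      (hcs.contMDiffAt.contMDiffWithinAt.congr_of_eventuallyEq hgt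
        (hgt.self_of_nhdsWithin self_mem_Ici))
  have hgd := (hgs.mdifferentiableWithinAt (by simp)).hasMFDerivWithinAt
  have huniq : UniqueMDiffWithinAt 𝓘(ℝ, ℝ) (Ici (0 : ℝ)) 0 :=
    (uniqueDiffOn_Ici (0 : ℝ) 0 self_mem_Ici).uniqueMDiffWithinAt
  let v₀ : F := mfderivWithin 𝓘(ℝ, ℝ) J g (Ici 0) 0 (1 : ℝ)
  refine ⟨v₀, ?_, ?_⟩
  · have h1 : HasMFDerivWithinAt 𝓘(ℝ, ℝ) (formModel n k) (ι ∘ g) (Ici 0) 0 _ :=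
      (hι.contMDiff.mdifferentiable (by simp) (g 0)).hasMFDerivAt.comp_hasMFDerivWithinAt 0 hgd
    have h2 : HasMFDerivWithinAt 𝓘(ℝ, ℝ) (formModel n k) (ι ∘ g) (Ici 0) 0 _ :=
      ((hcs.mdifferentiable (by simp) 0).hasMFDerivAt.hasMFDerivWithinAt).congr_of_eventuallyEq hgt
        (hgt.self_of_nhdsWithin self_mem_Ici)
    have h3 := DFunLike.congr_fun (huniq.eq h1 h2) (1 : ℝ)
    have h4 : ∀ q, q = m₀ → (mfderiv J (formModel n k) ι q v₀ :
        EuclideanSpace ℝ (Fin (n + k)) × ModelForms n k) = mfderiv J (formModel n k) ι m₀ v₀ := by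
      rintro _ rfl
      rfl
    exact (h4 _ hg0).symm.trans h3
  · intro f hf c hc
    have hf' : ∀ q, q = m₀ → MDifferentiableAt J 𝓘(ℝ, ℝ) f q := by
      rintro _ rfl
      exact hf
    have h1 : HasMFDerivWithinAt 𝓘(ℝ, ℝ) 𝓘(ℝ, ℝ) (f ∘ g) (Ici 0) 0 _ :=
      (hf' _ hg0).hasMFDerivAt.comp_hasMFDerivWithinAt 0 hgd
    have h2 : HasDerivWithinAt (f ∘ g) c (Ici 0) 0 := by
      have h3 : HasDerivWithinAt (fun t : ℝ => f m₀ + t * c) c (Ici 0) 0 := by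
        simpa using ((hasDerivWithinAt_id (0 : ℝ) (Ici 0)).mul_const c).const_add (f m₀)
      exact h3.congr_of_eventuallyEq (hgt.mono fun t ht => hc t _ ht)
        (hc 0 _ (hgt.self_of_nhdsWithin self_mem_Ici))
    have h3 := DFunLike.congr_fun (huniq.eq h1 h2.hasFDerivWithinAt.hasMFDerivWithinAt) (1 : ℝ)
    have h4 : ∀ q, q = m₀ → (mfderiv J 𝓘(ℝ, ℝ) f q v₀ : ℝ) = mfderiv J 𝓘(ℝ, ℝ) f m₀ v₀ := by
      rintro _ rfl
      rfl
    have h5 : (mfderiv J 𝓘(ℝ, ℝ) f m₀ v₀ : ℝ) = (1 : ℝ) • c := (h4 _ hg0).symm.trans h3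
    rw [one_smul] at h5
    exact h5

end Lift

/-! ### Critical points -/

section CriticalPoints

theorem eq_zero_of_chartCoeff_eq_zero {n : ℕ} {X : Type*} [TopologicalSpace X]
    [ChartedSpace (EuclideanSpace ℝ (Fin n)) X] [IsManifold (𝓡 n) ∞ X] {β : DForm (𝓡 n) n X} {i : X}
    {y : EuclideanSpace ℝ (Fin n)} (hy : y ∈ (extChartAt (𝓡 n) i).target)
    (h : chartCoeff β i y = 0) : β ((extChartAt (𝓡 n) i).symm y) = 0 := by
  have : IsManifold (𝓡 n) 1 X := IsManifold.of_le (n := ∞) (by simp)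
  have h1 := eq_zero_of_apply_stdFrame ((chartCoeff_eq_formPull β hy).symm.trans h)
  obtain ⟨B, hB⟩ := isInvertible_mfderivWithin_extChartAt_symm (I := 𝓡 n) hy
  have hr : range (𝓡 n) = univ := (𝓡 n).range_eq_univ
  rw [hr, mfderivWithin_univ, ← mfderivWithin_of_isOpen (isOpen_target i) hy] at hB
  ext v
  have h2 := DFunLike.congr_fun h1 (fun j => B.symm (v j))
  refine Eq.trans ?_ h2
  change β _ _ = β _ _
  congr 1
  funext j
  exact ((DFunLike.congr_fun hB (B.symm (v j))).symm.trans (B.apply_symm_apply (v j))).symm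

variable {n k : ℕ} {N : Type*} [TopologicalSpace N]
  [ChartedSpace (EuclideanSpace ℝ (Fin (n + k))) N] [IsManifold (𝓡 (n + k)) ∞ N]
  {w : DForm (𝓡 (n + k)) n N} {H₁ : Type*} [TopologicalSpace H₁] {d : ℕ}
  {J : ModelWithCorners ℝ (EuclideanSpace ℝ (Fin (n + k + d))) H₁}
  {M : Type*} [TopologicalSpace M] [ChartedSpace H₁ M] {ι : M → FormBundle n k N}
  {X : Type*} [TopologicalSpace X] [ChartedSpace (EuclideanSpace ℝ (Fin n)) X]
  {γ : X → M}

theorem tangentInterior_apply (γ : X → M) (x : X) (Y : MultiVector n (EuclideanSpace ℝ (Fin n)))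
    (μ : DForm J (n + 1) M) (ξ : EuclideanSpace ℝ (Fin (n + k + d))) :
    tangentInterior J γ x Y μ ξ = (-1 : ℝ) ^ n * Y (contractAlong γ (fun _ => ξ) μ x) := rfl

theorem forall_tangentInterior_eq_zero_iff (μ : DForm J (n + 1) M) (x : X) :
    (∀ Y : MultiVector n (EuclideanSpace ℝ (Fin n)), tangentInterior J γ x Y μ = 0) ↔
      ∀ ξ, contractAlong (n := n) γ (fun _ => ξ) μ x = 0 := by
  constructor
  · intro h ξ
    ext v
    have h1 := DFunLike.congr_fun (h (wedge v)) ξ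
    rw [tangentInterior_apply] at h1
    exact (mul_eq_zero.1 h1).resolve_left (pow_ne_zero _ (by norm_num))
  · intro h Y
    ext ξ
    rw [tangentInterior_apply, h]
    exact mul_eq_zero_of_right _ (map_zero Y)

theorem tangentInterior_eq_smul_iff (μ : DForm J (n + 1) M) (x : X)
    (Y : MultiVector n (EuclideanSpace ℝ (Fin n)))
    (a : EuclideanSpace ℝ (Fin (n + k + d)) →L[ℝ] ℝ) :
    tangentInterior J γ x Y μ = (-1 : ℝ) ^ n • a ↔
      ∀ ξ, Y (contractAlong γ (fun _ => ξ) μ x) = a ξ := by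
  rw [ContinuousLinearMap.ext_iff]
  refine forall_congr' fun ξ => ?_
  rw [tangentInterior_apply]
  exact mul_right_inj' (pow_ne_zero _ (by norm_num))

/-- When `dℋ` vanishes on `TΓ`, only the term of `dℋ ∧ ω` that feeds `ξ` to `dℋ` survives. -/
theorem contractAlong_hamiltonForm (L : LagrangianDensity n k N) {x : X}
    (h0 : ∀ v, mvfderiv J (hamiltonian w L ι) (γ x) (mfderiv (𝓡 n) J γ x v) = 0)
    (ξ : EuclideanSpace ℝ (Fin (n + k + d))) :
    contractAlong (n := n) γ (fun _ => ξ) (hamiltonForm J w L ι) x = 0 ↔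
      contractAlong (n := n) γ (fun _ => ξ) (multisymplecticOn J ι) x =
        (mvfderiv J (hamiltonian w L ι) (γ x) ξ : ℝ) • pullbackForm (J := 𝓡 n) γ (volumeOn J w ι) x := by
  rw [← sub_eq_zero (b := (mvfderiv J (hamiltonian w L ι) (γ x) ξ : ℝ) • _)]
  have h : contractAlong (n := n) γ (fun _ => ξ) (hamiltonForm J w L ι) x =
      contractAlong (n := n) γ (fun _ => ξ) (multisymplecticOn J ι) x -
        (mvfderiv J (hamiltonian w L ι) (γ x) ξ : ℝ) •
          pullbackForm (J := 𝓡 n) γ (volumeOn J w ι) x := by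
    ext v
    exact congrArg (multisymplecticOn J ι (γ x) (Fin.cons ξ fun j => mfderiv (𝓡 n) J γ x (v j)) - ·)
      (oneWedge_cons_of_eq_zero (V := EuclideanSpace ℝ (Fin (n + k + d)))
        (mvfderiv J (hamiltonian w L ι) (γ x)) (volumeOn J w ι (γ x)) ξ
        (fun j => mfderiv (𝓡 n) J γ x (v j)) fun j => h0 (v j))
  rw [h]

theorem mvfderiv_comp_eq_zero_of_const {f : M → ℝ} {x : X} (hf : MDifferentiableAt J 𝓘(ℝ, ℝ) f (γ x))
    (hγ : MDifferentiableAt (𝓡 n) J γ x) {c : ℝ} (hc : ∀ x, f (γ x) = c)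
    (v : EuclideanSpace ℝ (Fin n)) : mvfderiv J f (γ x) (mfderiv (𝓡 n) J γ x v) = 0 := by
  have h1 := mfderiv_comp x hf hγ
  have h2 : f ∘ γ = fun _ => c := funext hc
  rw [h2] at h1
  have h3 : mfderiv (𝓡 n) 𝓘(ℝ, ℝ) (fun _ : X => c) x v = 0 :=
    DFunLike.congr_fun (mfderiv_const (c := c)) v
  exact (DFunLike.congr_fun h1 v).symm.trans h3

/-- Contracting `Ω` with the vertical lift of `ω` gives the pull-back of `ω`. The vector `v` is thus
the direction in which Hamilton's equation reads `⟨X, ω⟩ = dℋ(v)`. -/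
theorem contractAlong_multisymplecticOn_of_verticalVector
    (hι : ContMDiff J (formModel n k) ∞ ι) {x : X} {v : EuclideanSpace ℝ (Fin (n + k + d))}
    (hv : mfderiv J (formModel n k) ι (γ x) v = verticalVector (ι (γ x)) (w (ι (γ x)).1)) :
    contractAlong (n := n) γ (fun _ => v) (multisymplecticOn J ι) x =
      pullbackForm (J := 𝓡 n) γ (volumeOn J w ι) x := by
  ext u
  rw [contractAlong_apply]
  have h1 : (fun i => mfderiv J (formModel n k) ι (γ x)
      ((Fin.cons v fun j => mfderiv (𝓡 n) J γ x (u j) : Fin (n + 1) → TangentSpace J (γ x)) i)) =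
      Fin.cons (verticalVector (ι (γ x)) (w (ι (γ x)).1))
        fun j => mfderiv J (formModel n k) ι (γ x) (mfderiv (𝓡 n) J γ x (u j)) := by
    funext i
    refine Fin.cases ?_ (fun j => ?_) i
    · exact hv
    · rfl
  refine (congrArg (multisymplectic n k N (ι (γ x))) h1).trans
    ((multisymplectic_verticalVector _ _ _).trans ?_)
  have h2 := mfderiv_comp (γ x) (g := fun P : FormBundle n k N => P.1) (I'' := 𝓡 (n + k))
    (contMDiff_proj_formBundle.mdifferentiable (by simp) (ι (γ x)))
    (hι.mdifferentiable (by simp) (γ x))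
  change w (ι (γ x)).1 _ = w (ι (γ x)).1 _
  congr 1
  funext j
  exact (DFunLike.congr_fun h2 (mfderiv (𝓡 n) J γ x (u j))).symm

variable [IsManifold (𝓡 n) ∞ X]

theorem isOrientation_pullbackForm_volumeOn (hw : IsSmoothForm w)
    (hι : ContMDiff J (formModel n k) ∞ ι) (hγ : IsPositiveSubmanifold J (volumeOn J w ι) γ) :
    IsOrientation (pullbackForm (J := 𝓡 n) γ (volumeOn J w ι)) where
  ne_zero i y hy h := hγ.ne_zero _ (eq_zero_of_chartCoeff_eq_zero hy h)
  continuousOn i := by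
    have hπι : ContMDiff J (𝓡 (n + k)) ∞ (fun m => (ι m).1) := contMDiff_proj_formBundle.comp hι
    have h1 := hw.isC1Form.contDiffOn_formPull (isOpen_target i).uniqueDiffOn
      ((hπι.comp hγ.contMDiff).comp_contMDiffOn (contMDiffOn_chart_symm i))
    refine ((ContinuousAlternatingMap.apply ℝ _ ℝ (stdFrame n)).continuous.comp_continuousOn
      h1.continuousOn).congr fun y hy => ?_
    have hψ : MDifferentiableWithinAt 𝓘(ℝ, EuclideanSpace ℝ (Fin n)) (𝓡 n)
        (extChartAt (𝓡 n) i).symm (extChartAt (𝓡 n) i).target y :=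
      (contMDiffOn_chart_symm i y hy).mdifferentiableWithinAt (by simp)
    have hγd := hγ.contMDiff.mdifferentiable (by simp) ((extChartAt (𝓡 n) i).symm y)
    have hu := (isOpen_target i).uniqueDiffWithinAt (𝕜 := ℝ) hy
    rw [chartCoeff_eq_formPull _ hy, formPull_pullbackForm _ hγd hψ hu, volumeOn,
      formPull_pullbackForm _ (hπι.mdifferentiable (by simp) _)
        (hγd.comp_mdifferentiableWithinAt y hψ) hu]
    rfl

end CriticalPoints

/-! ### The criterion for critical points. -/

section Criterion

variable {n k d : ℕ} {N : Type*} [TopologicalSpace N]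
  [ChartedSpace (EuclideanSpace ℝ (Fin (n + k))) N] [IsManifold (𝓡 (n + k)) ∞ N]
  {w : DForm (𝓡 (n + k)) n N} {L : LagrangianDensity n k N} {H₁ : Type*} [TopologicalSpace H₁]
  {J : ModelWithCorners ℝ (EuclideanSpace ℝ (Fin (n + k + d))) H₁}
  {M : Type*} [TopologicalSpace M] [ChartedSpace H₁ M] [IsManifold J ∞ M] [T2Space M]
  {ι : M → FormBundle n k N} {X : Type*} [TopologicalSpace X]
  [ChartedSpace (EuclideanSpace ℝ (Fin n)) X] [IsManifold (𝓡 n) ∞ X] [T2Space X]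
  [SigmaCompactSpace X] {γ : X → M}

theorem isCritical_actionForm_iff (hn : 1 ≤ n) (hw : IsSmoothForm w)
    (hw_closed : ∀ q, exteriorDeriv (𝓡 (n + k)) w q = 0)
    (hι : ContMDiff J (formModel n k) ∞ ι)
    (hℋ : ContMDiff J 𝓘(ℝ, ℝ) 1 (hamiltonian w L ι))
    (hγ : IsPositiveSubmanifold J (volumeOn J w ι) γ) :
    IsCritical J (volumeOn J w ι) (actionForm J w L ι) γ ↔
      ∀ x ξ, contractAlong (n := n) γ (fun _ => ξ) (hamiltonForm J w L ι) x = 0 := by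
  -- Stokes' theorem is applied to the contraction of `α` with the velocity, a form of degree `n -
  -- 1`; hence `n = m + 1`.
  obtain ⟨m, rfl⟩ := Nat.exists_eq_add_of_le' hn
  have hα := isExteriorDerivative_actionForm hw hw_closed hι hℋ
  have hτ := isOrientation_pullbackForm_volumeOn hw hι hγ
  constructor
  · intro h x ξ
    have h1 := eq_zero_of_chartCoeff_eq_zero (mem_extChartAt_target x)
      (hα.apply_eq_zero_of_isCritical hγ.contMDiff hγ.isEmbedding hτ h x ξ)
    rwa [extChartAt_to_inv] at h1
  · intro h
    refine hα.isCritical hγ.contMDiff hτ fun x ξ v => ?_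
    exact DFunLike.congr_fun (h x ξ) v

end Criterion

end LepageDedecker

end

/-! ### The theorem. -/

theorem mainTheorem2 {n k d : ℕ} (hn : 1 ≤ n) (hk : 1 ≤ k)
    {N : Type*} [TopologicalSpace N] [ChartedSpace (EuclideanSpace ℝ (Fin (n + k))) N]
    [IsManifold (𝓡 (n + k)) ∞ N] [T2Space N] [SigmaCompactSpace N]
    (w : DForm (𝓡 (n + k)) n N)
    (hw : IsSmoothForm w)
    (hw_ne : ∀ q, w q ≠ 0)
    (hw_closed : ∀ q, exteriorDeriv (𝓡 (n + k)) w q = 0)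
    (L : LagrangianDensity n k N)
    (hL : IsSmoothLagrangian w L)
    {H₁ : Type*} [TopologicalSpace H₁]
    (J : ModelWithCorners ℝ (EuclideanSpace ℝ (Fin (n + k + d))) H₁)
    {M : Type*} [TopologicalSpace M] [ChartedSpace H₁ M] [IsManifold J ∞ M] [T2Space M]
    {H₂ : Type*} [TopologicalSpace H₂]
    (JS : ModelWithCorners ℝ (EuclideanSpace ℝ (Fin d)) H₂)
    {S : Type*} [TopologicalSpace S] [ChartedSpace H₂ S] [IsManifold JS ∞ S]
    (ι : M → FormBundle n k N)
    (hι : LegendreCorrespondence J JS S w L ι)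
    (hℋ : ContMDiff J 𝓘(ℝ, ℝ) 1 (hamiltonian w L ι))
    {X : Type*} [TopologicalSpace X] [ChartedSpace (EuclideanSpace ℝ (Fin n)) X]
    [IsManifold (𝓡 n) ∞ X] [T2Space X] [SigmaCompactSpace X]
    (γ : X → M)
    (hγ : IsPositiveSubmanifold J (volumeOn J w ι) γ) :
    (IsCritical J (volumeOn J w ι)
        (actionForm J w L ι) γ ↔
      ∀ x, ∀ Y : MultiVector n (EuclideanSpace ℝ (Fin n)),
        tangentInterior J γ x Y (hamiltonForm J w L ι) = 0) ∧
    ((∃ h : ℝ, ∀ x, hamiltonian w L ι (γ x) = h) →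
      (IsCritical J (volumeOn J w ι)
          (actionForm J w L ι) γ ↔
        ∀ x, ∃! Y : MultiVector n (EuclideanSpace ℝ (Fin n)),
          Y (pullbackForm (J := 𝓡 n) γ (volumeOn J w ι) x) = 1 ∧
          tangentInterior J γ x Y (multisymplecticOn J ι) =
            (-1 : ℝ) ^ n • mvfderiv J (hamiltonian w L ι) (γ x)) ∧
      (IsCritical J (volumeOn J w ι)
          (actionForm J w L ι) γ →
        ∀ x, mvfderiv J (hamiltonian w L ι) (γ x) ≠ 0 →
          ∃! Y : MultiVector n (EuclideanSpace ℝ (Fin n)),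
            tangentInterior J γ x Y (multisymplecticOn J ι) =
              (-1 : ℝ) ^ n • mvfderiv J (hamiltonian w L ι) (γ x)) ∧
      ((∀ x, ∀ᶠ t : ℝ in 𝓝[≥] 0, ∃ m : M, ι m =
          ⟨(ι (γ x)).1, (show ModelForms n k from (ι (γ x)).2) +
            t • (show ModelForms n k from w (ι (γ x)).1)⟩) →
        (IsCritical J (volumeOn J w ι)
            (actionForm J w L ι) γ ↔
          ∀ x, ∃! Y : MultiVector n (EuclideanSpace ℝ (Fin n)),
            tangentInterior J γ x Y (multisymplecticOn J ι) =
              (-1 : ℝ) ^ n • mvfderiv J (hamiltonian w L ι) (γ x)))) := by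
  have hιs := hι.isSmoothEmbedding.contMDiff
  have hcrit := isCritical_actionForm_iff hn hw hw_closed hιs hℋ hγ
  have hτ : ∀ x, pullbackForm (J := 𝓡 n) γ (volumeOn J w ι) x ≠ 0 := hγ.ne_zero
  refine ⟨hcrit.trans (forall_congr' fun x => (forall_tangentInterior_eq_zero_iff _ x).symm), ?_⟩
  rintro ⟨h, hh⟩
  have hℋd : MDifferentiable J 𝓘(ℝ, ℝ) (hamiltonian w L ι) := hℋ.mdifferentiable one_ne_zero
  have hcrit' : IsCritical J (volumeOn J w ι) (actionForm J w L ι) γ ↔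
      ∀ x ξ, contractAlong (n := n) γ (fun _ => ξ) (multisymplecticOn J ι) x =
        (mvfderiv J (hamiltonian w L ι) (γ x) ξ : ℝ) •
          pullbackForm (J := 𝓡 n) γ (volumeOn J w ι) x :=
    hcrit.trans <| forall_congr' fun x => forall_congr' fun ξ => contractAlong_hamiltonForm L
      (mvfderiv_comp_eq_zero_of_const (hℋd _) (hγ.contMDiff.mdifferentiable (by simp) x) hh) ξ
  have hT := fun (x : X) (Y : MultiVector n (EuclideanSpace ℝ (Fin n))) =>
    tangentInterior_eq_smul_iff (γ := γ) (multisymplecticOn J ι) x Y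
      (mvfderiv J (hamiltonian w L ι) (γ x))
  refine ⟨?_, ?_, ?_⟩
  · exact hcrit'.trans (forall_congr' fun x =>
      (forall_eq_smul_iff_existsUnique_normalised (hτ x)).trans
        (existsUnique_congr fun Y => and_congr_right fun _ => (hT x Y).symm))
  · intro hc x hx
    obtain ⟨ξ₀, hξ₀⟩ : ∃ ξ₀, mvfderiv J (hamiltonian w L ι) (γ x) ξ₀ ≠ 0 := by
      by_contra! h0
      exact hx (ContinuousLinearMap.ext h0)
    exact (existsUnique_congr (hT x)).2 (existsUnique_of_forall_eq_smul (hτ x) (hcrit'.1 hc x) hξ₀)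
  · intro hω
    refine hcrit'.trans (forall_congr' fun x => ?_)
    obtain ⟨v, hv, hvf⟩ := exists_mfderiv_eq_verticalVector hι.isSmoothEmbedding (γ x)
      (w (ι (γ x)).1) (hω x)
    -- Along `p + tω` the Hamiltonian grows at unit rate, so `dℋ(v) = 1`; non-emptiness of `Z_q(p)`
    -- is needed for its value to be that of `W`.
    have hv1 : mvfderiv J (hamiltonian w L ι) (γ x) v = 1 := hvf _ (hℋd _) 1 fun t m hm => ?_
    · exact (forall_eq_smul_iff_existsUnique
        (η := fun ξ => contractAlong (n := n) γ (fun _ => ξ) (multisymplecticOn J ι) x) (hτ x) hv1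
        (contractAlong_multisymplecticOn_of_verticalVector hιs hv)).trans
          (existsUnique_congr (hT x)).symm
    rw [hamiltonian, hm, mul_one]
    exact legendreValue_add_smul (hι.isConnected (γ x)).nonempty t
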